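/- Let $p>2$ be a prime, $f\ge 2$, $q=p^f$, $G=\mathrm{GL}_2(\mathbb Q_{p^f})$, $K=\mathrm{GL}_2(\mathbb Z_{p^f})$, $Z$ the centre of $G$. Let $E$ be an algebraic extension of $\mathbb Q_p$ (for instance a finite extension, or $\bar{\mathbb Q}_p$) with an embedding of $\mathbb Q_{p^f}$, let $\mathcal O_E$ be its ring of integers, $k_E$ its residue field, and $v$ its valuation with $v(p)=1$. For a $\mathbb Z_{p^f}$-algebra $R$ and $b=(b_0,\dots,b_{f-1})$, $s\ge 0$, let $\bigotimes_i\mathrm{Sym}^{b_i}R^2\otimes D^s$ be the space of polynomials over $R$ homogeneous of degree $b_i$ in $X_i,Y_i$ for each $0\le i\le f-1$, on which $\left(\begin{smallmatrix}a&b\\c&d\end{smallmatrix}\right)\in K$ acts by the $s$-th power of its determinant times the substitution $X_i\mapsto a^{\mathrm{Fr}^i}X_i+c^{\mathrm{Fr}^i}Y_i$, $Y_i\mapsto b^{\mathrm{Fr}^i}X_i+d^{\mathrm{Fr}^i}Y_i$, and $p\in Z$ acts trivially. On $\mathrm{ind}_{KZ}^G$ (compact induction) of this representation let $T$ be the Hecke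 operator $$T[g,v]=\sum_{\lambda\in\mathbb F_q}\Big[g\left(\begin{smallmatrix}p&[\lambda]\\0&1\end{smallmatrix}\right),v(X_i,-[\lambda]^{p^i}X_i+pY_i)\Big]+\Big[g\left(\begin{smallmatrix}1&0\\0&p\end{smallmatrix}\right),v(pX_i,Y_i)\Big],$$ where $[g,v]$ is the function supported on $KZg^{-1}$ with value $v$ at $g^{-1}$, and $[\lambda]$ is the Teichm\"uller lift. Let $r=(r_0,\dots,r_{f-1})$ with $r_i\ge q$ for all $i$ and $a_p\in E$. Let $\Theta$ be the image of $\mathrm{ind}_{KZ}^G\bigotimes\mathrm{Sym}^{r_i}\mathcal O_E^2$ in $\mathrm{ind}_{KZ}^G(\bigotimes\mathrm{Sym}^{r_i}E^2)/(T-a_p)$ and $\bar\Theta=\Theta\otimes_{\mathcal O_E}k_E$. Let $V_r=\bigotimes\mathrm{Sym}^{r_i}k_E^2$, let $X_r\subset V_r$ be the subrepresentation generated by $\prod_iX_i^{r_i}$ and $V_r^*\subset V_r$ the subrepresentation of the multiples of the polynomials $X_iY_{i-1}^p-Y_iX_{i-1}^p$, $0\le i\le f-1$ (indices mod $f$). Put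 $Q=V_r/(V_r^*+X_r)$ and let $0=Q_0\subset Q_1\subset Q_2\subset\cdots$ be its socle filtration. Assume $\sum_ir_ip^i\equiv a_0\pmod{q-1}$ with $1\le a_0\le p-1$, that $p\nmid r_1$, that $p\mid r_0$ if $a_0=1$, and that $\tfrac12<v(a_p)<1$. Then: 1. $Q_{f-1}/Q_{f-2}$ is irreducible and isomorphic to the weight $W=\bigotimes_i\mathrm{Sym}^{b_i}k_E^2\otimes D^p$ with $b=(a_0-1,p-2,p-1,\dots,p-1)$. 2. The natural map $\mathrm{ind}_{KZ}^GV_r\to\bar\Theta$ factors through a map $\mathrm{ind}_{KZ}^GQ\to\bar\Theta$. Let $F_i$ be the image of $\mathrm{ind}_{KZ}^GQ_i$ under it and $F_s=F_{f-1}/F_{f-2}$. 3. The induced surjection $\mathrm{ind}_{KZ}^G(Q_{f-1}/Q_{f-2})\twoheadrightarrow F_s$ factors through $T$: for every isomorphism $Q_{f-1}/Q_{f-2}\cong W$, the resulting map $\mathrm{ind}_{KZ}^GW\to F_s$ factors through $\mathrm{ind}_{KZ}^GW/T(\mathrm{ind}_{KZ}^GW)$. -/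

import Mathlib

open MvPolynomial
open scoped MonoidAlgebra TensorProduct

noncomputable section

namespace HeckeRed

/-! ### The groups -/

/-- The residue field `𝔽_q`, `q = p ^ f`. -/
abbrev Fq (p f : ℕ) [Fact p.Prime] : Type := GaloisField p f

/-- `ℤ_{p^f}`, the ring of Witt vectors of `𝔽_q`. -/
abbrev Zq (p f : ℕ) [Fact p.Prime] : Type := WittVector p (Fq p f)

/-- `ℚ_{p^f}`, the unramified extension of `ℚ_p` of degree `f`. -/
abbrev Qq (p f : ℕ) [Fact p.Prime] : Type := FractionRing (Zq p f)

/-- `G = GL₂(ℚ_{p^f})`. -/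
abbrev G (p f : ℕ) [Fact p.Prime] : Type := GL (Fin 2) (Qq p f)

/-- `K = GL₂(ℤ_{p^f})`. -/
abbrev K (p f : ℕ) [Fact p.Prime] : Type := GL (Fin 2) (Zq p f)

variable {p f : ℕ} [Fact p.Prime]

theorem natCast_p_ne_zero : ((p : ℕ) : Zq p f) ≠ 0 := WittVector.p_nonzero p _

/-- The inclusion of `K` in `G`. -/
def inclK : K p f →* G p f := Matrix.GeneralLinearGroup.map (algebraMap (Zq p f) (Qq p f))

/-- The subgroup `KZ` of `G`. -/
def KZ (p f : ℕ) [Fact p.Prime] : Subgroup (G p f) :=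
  (inclK (p := p) (f := f)).range ⊔ Subgroup.center (G p f)

theorem det_map_ne_zero (y : Matrix (Fin 2) (Fin 2) (Zq p f)) (hy : y.det ≠ 0) :
    (y.map (algebraMap (Zq p f) (Qq p f))).det ≠ 0 := by
  have := RingHom.map_det (algebraMap (Zq p f) (Qq p f)) y
  rw [RingHom.mapMatrix_apply] at this
  rw [← this]
  exact fun h => hy ((map_eq_zero_iff _ (IsFractionRing.injective (Zq p f) (Qq p f))).mp h)

/-- An integral matrix with nonzero determinant, as an element of `G`. -/
def toG (y : Matrix (Fin 2) (Fin 2) (Zq p f)) (hy : y.det ≠ 0) : G p f :=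
  Matrix.GeneralLinearGroup.mkOfDetNeZero (y.map (algebraMap (Zq p f) (Qq p f)))
    (det_map_ne_zero y hy)

/-- The scalar matrix `p`, an element of the centre `Z` of `G`. Note `KZ = K × p ^ ℤ`. -/
def scalarP (p f : ℕ) [Fact p.Prime] : G p f :=
  toG !![(p : Zq p f), 0; 0, (p : Zq p f)] (by
    rw [Matrix.det_fin_two_of]; simpa using natCast_p_ne_zero)

/-! ### Symmetric powers -/

section Sym

variable {R : Type*} [CommRing R]

/-- The substitution `v(X_i, Y_i) ↦ v(a^{Fr^i} X_i + c^{Fr^i} Y_i, b^{Fr^i} X_i + d^{Fr^i} Y_i)`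
attached to a matrix `(a b; c d)` over `ℤ_{p^f}` and a `ℤ_{p^f}`-algebra `R`. The variables
`X_i` and `Y_i` are `X (i, 0)` and `X (i, 1)`. -/
def subst (ι : Zq p f →+* R) (m : Matrix (Fin 2) (Fin 2) (Zq p f)) :
    MvPolynomial (Fin f × Fin 2) R →ₐ[R] MvPolynomial (Fin f × Fin 2) R :=
  aeval fun x => ∑ l : Fin 2,
    C (ι (((WittVector.frobenius : Zq p f →+* Zq p f) ^ (x.1 : ℕ)) (m l x.2))) * X (x.1, l)

/-- The polynomials over `R` that are homogeneous of degree `r i` in `X_i, Y_i` for every `i`. -/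
def symSpace (R : Type*) [CommRing R] (r : Fin f → ℕ) :
    Submodule R (MvPolynomial (Fin f × Fin 2) R) :=
  weightedHomogeneousSubmodule R (fun x : Fin f × Fin 2 => (Pi.single x.1 1 : Fin f → ℕ)) r

theorem subst_mem (ι : Zq p f →+* R) (m : Matrix (Fin 2) (Fin 2) (Zq p f)) (r : Fin f → ℕ)
    (v : MvPolynomial (Fin f × Fin 2) R) (hv : v ∈ symSpace R r) :
    subst ι m v ∈ symSpace R r := by
  rw [v.as_sum, map_sum]
  refine Submodule.sum_mem _ fun d hd => ?_
  have hd' := hv (mem_support_iff.mp hd)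
  rw [subst, aeval_monomial, algebraMap_eq]
  refine IsWeightedHomogeneous.C_mul ?_ _
  rw [← hd', Finsupp.weight_apply]
  refine IsWeightedHomogeneous.prod _ _ _ fun i _ => ?_
  refine IsWeightedHomogeneous.pow ?_ _
  refine IsWeightedHomogeneous.sum _ _ _ fun l _ => ?_
  exact IsWeightedHomogeneous.C_mul (isWeightedHomogeneous_X _ _ (i.1, l)) _

theorem subst_mul (ι : Zq p f →+* R) (m n : Matrix (Fin 2) (Fin 2) (Zq p f))
    (v : MvPolynomial (Fin f × Fin 2) R) : subst ι (m * n) v = subst ι m (subst ι n v) := by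
  suffices h : subst ι (m * n) = (subst ι m).comp (subst ι n) by rw [h]; rfl
  refine MvPolynomial.algHom_ext fun x => ?_
  simp only [subst, aeval_X, AlgHom.comp_apply, map_mul, Matrix.mul_apply,
    Fin.sum_univ_two, map_add, algHom_C, algebraMap_eq]
  ring

theorem subst_one (ι : Zq p f →+* R) (v : MvPolynomial (Fin f × Fin 2) R) :
    subst ι 1 v = v := by
  suffices h : subst ι 1 = AlgHom.id R (MvPolynomial (Fin f × Fin 2) R) by rw [h]; rfl
  refine MvPolynomial.algHom_ext fun x => ?_
  obtain ⟨i, j⟩ := x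
  fin_cases j <;> simp [subst, Fin.sum_univ_two]

/-- The substitution attached to a matrix, on `⨂ Sym^{r_i} R²`. -/
def symAct (ι : Zq p f →+* R) (r : Fin f → ℕ) (m : Matrix (Fin 2) (Fin 2) (Zq p f)) :
    symSpace R r →ₗ[R] symSpace R r :=
  (subst ι m).toLinearMap.restrict (subst_mem ι m r)

theorem symAct_mul (ι : Zq p f →+* R) (r : Fin f → ℕ) (m n : Matrix (Fin 2) (Fin 2) (Zq p f))
    (v : symSpace R r) : symAct ι r (m * n) v = symAct ι r m (symAct ι r n v) :=
  Subtype.ext (subst_mul ι m n v.1)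

/-- The representation `(⨂ Sym^{r_i} R²) ⊗ D^s` of `K`, where `D` is the determinant. -/
def symRep (ι : Zq p f →+* R) (r : Fin f → ℕ) (s : ℕ) :
    Representation R (K p f) (symSpace R r) where
  toFun k := ι ((k : Matrix (Fin 2) (Fin 2) (Zq p f)).det) ^ s • symAct ι r k
  map_one' := by
    ext v : 2
    simp [symAct, subst_one]
  map_mul' k l := by
    ext v : 2
    have h := symAct_mul ι r k l v
    simp only [Units.val_mul, Matrix.det_mul, map_mul, mul_pow, LinearMap.smul_apply,
      Module.End.mul_apply, map_smul, h, mul_smul]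
    rw [smul_comm]

/-- `(⨂ Sym^{r_i} R²) ⊗ D^s` as a module over the group algebra `R[K]`. -/
def SymMod (_ι : Zq p f →+* R) (r : Fin f → ℕ) (_s : ℕ) : Type _ := symSpace R r

instance (ι : Zq p f →+* R) (r : Fin f → ℕ) (s : ℕ) : AddCommGroup (SymMod ι r s) :=
  inferInstanceAs (AddCommGroup (symSpace R r))

instance (ι : Zq p f →+* R) (r : Fin f → ℕ) (s : ℕ) : Module R (SymMod ι r s) :=
  inferInstanceAs (Module R (symSpace R r))

/-- The identity, from `(⨂ Sym^{r_i} R²) ⊗ D^s` to the underlying space of polynomials. -/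
def symEquiv (ι : Zq p f →+* R) (r : Fin f → ℕ) (s : ℕ) : SymMod ι r s ≃ₗ[R] symSpace R r :=
  LinearEquiv.refl R (symSpace R r)

instance (ι : Zq p f →+* R) (r : Fin f → ℕ) (s : ℕ) : Module R[K p f] (SymMod ι r s) :=
  Module.compHom (symSpace R r) (symRep ι r s).asAlgebraHom.toRingHom

theorem symMod_smul (ι : Zq p f →+* R) (r : Fin f → ℕ) (s : ℕ) (a : R[K p f])
    (v : SymMod ι r s) :
    a • v = (symEquiv ι r s).symm ((symRep ι r s).asAlgebraHom a (symEquiv ι r s v)) := rfl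

instance (ι : Zq p f →+* R) (r : Fin f → ℕ) (s : ℕ) :
    IsScalarTower R R[K p f] (SymMod ι r s) where
  smul_assoc c a v := by
    rw [symMod_smul, symMod_smul, map_smul, LinearMap.smul_apply, map_smul]

/-- Extension of scalars on `⨂ Sym^{r_i}`. -/
def symMap {R' : Type*} [CommRing R'] (φ : R →+* R') (r : Fin f → ℕ) :
    symSpace R r →ₛₗ[φ] symSpace R' r where
  toFun v := ⟨MvPolynomial.map φ v.1, fun d hd => v.2 (fun h => hd (by rw [coeff_map, h, map_zero]))⟩
  map_add' v w := Subtype.ext (by simp)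
  map_smul' c v := Subtype.ext (by simp [MvPolynomial.smul_eq_C_mul])

theorem symMap_symRep {R' : Type*} [CommRing R'] (φ : R →+* R') (ι : Zq p f →+* R)
    (r : Fin f → ℕ) (s : ℕ) (k : K p f) (v : symSpace R r) :
    symMap φ r (symRep ι r s k v) = symRep (φ.comp ι) r s k (symMap φ r v) := by
  have h : ∀ m : Matrix (Fin 2) (Fin 2) (Zq p f),
      (MvPolynomial.map φ).comp (subst ι m).toRingHom =
        (subst (φ.comp ι) m).toRingHom.comp (MvPolynomial.map φ) := by
    intro m
    refine MvPolynomial.ringHom_ext (fun c => ?_) (fun x => ?_)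
    · simp
    · simp [subst]
  refine Subtype.ext ?_
  have h' := RingHom.congr_fun (h k) v.1
  change MvPolynomial.map φ (ι _ ^ s • subst ι k v.1) =
    (φ (ι _)) ^ s • subst (φ.comp ι) k (MvPolynomial.map φ v.1)
  rw [MvPolynomial.smul_eq_C_mul, MvPolynomial.smul_eq_C_mul, map_mul, MvPolynomial.map_C, map_pow]
  exact congrArg _ h'

end Sym

/-! ### Compact induction -/

section Ind

variable {R : Type*} [CommRing R]

/-- The compact induction `ind_{KZ}^G M` of a representation `M` of `K`, extended to `KZ` by
letting `p ∈ Z` act trivially: the functions `F : G → M` with `F (h g) = h • F g` for `h ∈ KZ`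
(as `KZ = K × p ^ ℤ`, it is enough to ask this for `h ∈ K` and for `h = p`) whose support is
compact modulo `KZ`, that is, contained in a finite union of cosets `KZ s`.
The group `G` acts on it by right translation. -/
def cInd (R M : Type*) [CommRing R] [AddCommGroup M] [Module R M] [Module R[K p f] M]
    [IsScalarTower R R[K p f] M] : Submodule R (G p f → M) where
  carrier := {F | (∀ (k : K p f) (g : G p f), F (inclK k * g) = MonoidAlgebra.of R (K p f) k • F g) ∧
    (∀ g : G p f, F (scalarP p f * g) = F g) ∧
    ∃ S : Finset (G p f), ∀ g : G p f, F g ≠ 0 → ∃ s ∈ S, g * s⁻¹ ∈ KZ p f}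
  add_mem' := by
    classical
    rintro F F' ⟨h1, h2, S, hS⟩ ⟨h1', h2', S', hS'⟩
    refine ⟨fun k g => ?_, fun g => ?_, S ∪ S', fun g hg => ?_⟩
    · simp only [Pi.add_apply, h1, h1', smul_add]
    · simp only [Pi.add_apply, h2, h2']
    · by_cases h : F g = 0
      · obtain ⟨s, hs, hs'⟩ := hS' g (fun h' => hg (by simp [h, h']))
        exact ⟨s, Finset.mem_union_right _ hs, hs'⟩
      · obtain ⟨s, hs, hs'⟩ := hS g h
        exact ⟨s, Finset.mem_union_left _ hs, hs'⟩
  zero_mem' := ⟨by simp, by simp, ∅, by simp⟩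
  smul_mem' := by
    rintro c F ⟨h1, h2, S, hS⟩
    refine ⟨fun k g => ?_, fun g => ?_, S, fun g hg => hS g (fun h => hg (by simp [h]))⟩
    · simp only [Pi.smul_apply, h1]
      exact smul_comm _ _ _
    · simp only [Pi.smul_apply, h2]

/-- Functoriality of compact induction. -/
def cIndMap {M N : Type*} [AddCommGroup M] [Module R M] [Module R[K p f] M]
    [IsScalarTower R R[K p f] M] [AddCommGroup N] [Module R N] [Module R[K p f] N]
    [IsScalarTower R R[K p f] N] (φ : M →ₗ[R[K p f]] N) :
    cInd (p := p) (f := f) R M →ₗ[R] cInd (p := p) (f := f) R N where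
  toFun F := ⟨fun g => φ (F.1 g), fun k g => by
      change φ (F.1 (inclK k * g)) = _ • φ (F.1 g)
      rw [F.2.1, map_smul], fun g => by
      change φ (F.1 (scalarP p f * g)) = φ (F.1 g)
      rw [F.2.2.1], by
      obtain ⟨S, hS⟩ := F.2.2.2
      refine ⟨S, fun g hg => hS g (fun h => hg ?_)⟩
      change φ (F.1 g) = 0
      rw [h, map_zero]⟩
  map_add' F F' := by ext g; simp
  map_smul' c F := by
    ext g
    exact (φ.restrictScalars R).map_smul c (F.1 g)

theorem of_smul_symMod (ι : Zq p f →+* R) (r : Fin f → ℕ) (s : ℕ) (k : K p f)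
    (v : SymMod ι r s) :
    MonoidAlgebra.of R (K p f) k • v =
      (symEquiv ι r s).symm (symRep ι r s k ((symEquiv ι r s) v)) := by
  rw [symMod_smul, Representation.asAlgebraHom_of]

/-- Extension of scalars from `R` to `R'`, applied to the values of a function in
`ind_{KZ}^G ((⨂ Sym^{r_i} R²) ⊗ D^s)`. -/
def cIndBaseChange {R' : Type*} [CommRing R'] (φ : R →+* R') (ι : Zq p f →+* R)
    (r : Fin f → ℕ) (s : ℕ) :
    cInd (p := p) (f := f) R (SymMod ι r s) →ₛₗ[φ] cInd (p := p) (f := f) R' (SymMod (φ.comp ι) r s) :=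
  let e := symEquiv ι r s
  let e' := symEquiv (φ.comp ι) r s
  { toFun F := ⟨fun g => e'.symm (symMap φ r (e (F.1 g))), fun k g => by
        change e'.symm (symMap φ r (e (F.1 (inclK k * g)))) = _ • e'.symm (symMap φ r (e (F.1 g)))
        rw [F.2.1, of_smul_symMod, of_smul_symMod]
        exact congrArg e'.symm (symMap_symRep φ ι r s k (e (F.1 g))), fun g => by
        change e'.symm (symMap φ r (e (F.1 (scalarP p f * g)))) = e'.symm (symMap φ r (e (F.1 g)))
        rw [F.2.2.1], by
        obtain ⟨S, hS⟩ := F.2.2.2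
        refine ⟨S, fun g hg => hS g (fun h => hg ?_)⟩
        change e'.symm (symMap φ r (e (F.1 g))) = 0
        rw [h, map_zero, map_zero, map_zero]⟩
    map_add' F F' := by
      ext g : 2
      exact congrArg e'.symm (map_add (symMap φ r) (e (F.1 g)) (e (F'.1 g)))
    map_smul' c F := by
      ext g : 2
      exact congrArg e'.symm ((symMap φ r).map_smulₛₗ c (e (F.1 g))) }

/-! ### The Hecke operator -/

instance : Fintype (Fq p f) := Fintype.ofFinite _

/-- Representatives `(p [λ]; 0 1)`, `λ ∈ 𝔽_q`, and `α = (1 0; 0 p)` of the cosets `y KZ` in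
`KZ α⁻¹ KZ = KZ α KZ`, where `[λ]` is the Teichmüller lift. -/
def heckeRep : Option (Fq p f) → Matrix (Fin 2) (Fin 2) (Zq p f)
  | none => !![1, 0; 0, (p : Zq p f)]
  | some l => !![(p : Zq p f), WittVector.teichmuller p l; 0, 1]

theorem det_heckeRep (x : Option (Fq p f)) : (heckeRep x).det = (p : Zq p f) := by
  cases x <;> simp [heckeRep, Matrix.det_fin_two_of]

theorem det_heckeRep_ne_zero (x : Option (Fq p f)) : (heckeRep x).det ≠ 0 := by
  rw [det_heckeRep]
  exact natCast_p_ne_zero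

theorem dvd_iff_coeff (a : Zq p f) : (p : Zq p f) ∣ a ↔ WittVector.constantCoeff a = 0 := by
  rw [← Ideal.mem_span_singleton, ← WittVector.ker_constantCoeff, RingHom.mem_ker]

theorem exists_decomp (m : Matrix (Fin 2) (Fin 2) (Zq p f)) (u : (Zq p f)ˣ)
    (hm : m.det = (p : Zq p f) * u) :
    ∃ (x : Option (Fq p f)) (k : K p f), m = heckeRep x * (k : Matrix (Fin 2) (Fin 2) (Zq p f)) := by
  have key : ∀ (x : Option (Fq p f)) (k : Matrix (Fin 2) (Fin 2) (Zq p f)),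
      m = heckeRep x * k → ∃ k' : K p f, m = heckeRep x * (k' : Matrix (Fin 2) (Fin 2) (Zq p f)) := by
    intro x k h
    have hd : k.det = u := by
      have := congrArg Matrix.det h
      rw [Matrix.det_mul, det_heckeRep, hm] at this
      exact (mul_left_cancel₀ natCast_p_ne_zero this).symm
    refine ⟨Matrix.GeneralLinearGroup.mk'' k (by rw [hd]; exact u.isUnit), ?_⟩
    rw [h]; rfl
  have h0 : WittVector.constantCoeff (m 0 0) * WittVector.constantCoeff (m 1 1) =
      WittVector.constantCoeff (m 0 1) * WittVector.constantCoeff (m 1 0) := by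
    rw [← sub_eq_zero, ← map_mul, ← map_mul, ← map_sub, ← dvd_iff_coeff, ← Matrix.det_fin_two, hm]
    exact dvd_mul_right _ _
  have fin (l : Fq p f)
      (ha : WittVector.constantCoeff (m 0 0) = l * WittVector.constantCoeff (m 1 0))
      (hb : WittVector.constantCoeff (m 0 1) = l * WittVector.constantCoeff (m 1 1)) :
      ∃ (x : Option (Fq p f)) (k : K p f),
        m = heckeRep x * (k : Matrix (Fin 2) (Fin 2) (Zq p f)) := by
    have ht : WittVector.constantCoeff (WittVector.teichmuller p l) = l :=
      WittVector.teichmuller_coeff_zero p l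
    obtain ⟨a, ha'⟩ := (dvd_iff_coeff (m 0 0 - WittVector.teichmuller p l * m 1 0)).2
      (by rw [map_sub, map_mul, ht, ha, sub_self])
    obtain ⟨b, hb'⟩ := (dvd_iff_coeff (m 0 1 - WittVector.teichmuller p l * m 1 1)).2
      (by rw [map_sub, map_mul, ht, hb, sub_self])
    refine ⟨some l, key (some l) !![a, b; m 1 0, m 1 1] ?_⟩
    ext i j
    fin_cases i <;> fin_cases j <;>
      simp [heckeRep, Matrix.mul_apply, Fin.sum_univ_two, ← ha', ← hb']
  by_cases hc : WittVector.constantCoeff (m 1 0) = 0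
  · by_cases hd : WittVector.constantCoeff (m 1 1) = 0
    · obtain ⟨c, hc'⟩ := (dvd_iff_coeff _).2 hc
      obtain ⟨d, hd'⟩ := (dvd_iff_coeff _).2 hd
      refine ⟨none, key none !![m 0 0, m 0 1; c, d] ?_⟩
      ext i j
      fin_cases i <;> fin_cases j <;>
        simp [heckeRep, Matrix.mul_apply, Fin.sum_univ_two, ← hc', ← hd']
    · refine fin (WittVector.constantCoeff (m 0 1) / WittVector.constantCoeff (m 1 1)) ?_ ?_
      · rw [div_mul_eq_mul_div, eq_div_iff hd, h0]
      · rw [div_mul_cancel₀ _ hd]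
  · refine fin (WittVector.constantCoeff (m 0 0) / WittVector.constantCoeff (m 1 0)) ?_ ?_
    · rw [div_mul_cancel₀ _ hc]
    · rw [div_mul_eq_mul_div, eq_div_iff hc, h0]

theorem heckeRep_inj (x z : Option (Fq p f)) (k : Matrix (Fin 2) (Fin 2) (Zq p f))
    (h : heckeRep x = heckeRep z * k) : x = z := by
  have hp : ∀ c : Zq p f, (p : Zq p f) * c ≠ 1 := fun c hc =>
    (WittVector.irreducible p (k := Fq p f)).not_isUnit (IsUnit.of_mul_eq_one _ hc)
  have h00 := congrFun (congrFun h 0) 0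
  have h01 := congrFun (congrFun h 0) 1
  have h10 := congrFun (congrFun h 1) 0
  have h11 := congrFun (congrFun h 1) 1
  rcases x with _ | l <;> rcases z with _ | l' <;>
    simp [heckeRep, Matrix.mul_apply, Fin.sum_univ_two] at h00 h01 h10 h11
  · rfl
  · rw [← h10, mul_zero, add_zero] at h00
    exact absurd h00.symm (hp _)
  · exact absurd h11.symm (hp _)
  · have := congrArg WittVector.constantCoeff h01
    rw [← h11, mul_one, map_add, (dvd_iff_coeff _).1 (dvd_mul_right _ _), zero_add] at this
    have e : l = l' := by
      have h1 : WittVector.constantCoeff (WittVector.teichmuller p l) = l :=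
        WittVector.teichmuller_coeff_zero p l
      have h2 : WittVector.constantCoeff (WittVector.teichmuller p l') = l' :=
        WittVector.teichmuller_coeff_zero p l'
      rw [← h1, this, h2]
    rw [e]

/-- The endomorphism by which a matrix acts on `⨂ Sym^{r_i} R²`, without determinant twist. -/
def symModAct (ι : Zq p f →+* R) (r : Fin f → ℕ) (s : ℕ) (m : Matrix (Fin 2) (Fin 2) (Zq p f)) :
    SymMod ι r s →ₗ[R] SymMod ι r s :=
  (symEquiv ι r s).symm.toLinearMap ∘ₗ symAct ι r m ∘ₗ
    (symEquiv ι r s).toLinearMap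

/-- The representative `y` as an element of `G`. -/
def heckeG (x : Option (Fq p f)) : G p f := toG (heckeRep x) (det_heckeRep_ne_zero x)

theorem exists_perm (k : K p f) :
    ∃ (σ : Equiv.Perm (Option (Fq p f))) (κ : Option (Fq p f) → K p f), ∀ x,
      (k : Matrix (Fin 2) (Fin 2) (Zq p f)) * heckeRep x =
        heckeRep (σ x) * (κ x : Matrix (Fin 2) (Fin 2) (Zq p f)) := by
  have h : ∀ x, ∃ (z : Option (Fq p f)) (κ : K p f),
      (k : Matrix (Fin 2) (Fin 2) (Zq p f)) * heckeRep x =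
        heckeRep z * (κ : Matrix (Fin 2) (Fin 2) (Zq p f)) := fun x =>
    exists_decomp _ (Matrix.GeneralLinearGroup.det k) (by
      rw [Matrix.det_mul, det_heckeRep, mul_comm]; rfl)
  choose σ κ hσ using h
  have inj : Function.Injective σ := by
    intro x z hxz
    refine heckeRep_inj x z ((κ z)⁻¹ * κ x : K p f) ?_
    have hx := hσ x
    have hz := hσ z
    rw [← hxz] at hz
    have e1 : heckeRep (σ x) = (k : Matrix (Fin 2) (Fin 2) (Zq p f)) * heckeRep z *
        ((κ z)⁻¹ : K p f) := by
      rw [hz, mul_assoc, ← Units.val_mul, mul_inv_cancel, Units.val_one, mul_one]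
    calc heckeRep x = ((k⁻¹ * k : K p f) : Matrix (Fin 2) (Fin 2) (Zq p f)) * heckeRep x := by
          rw [inv_mul_cancel, Units.val_one, one_mul]
      _ = ((k⁻¹ * k : K p f) : Matrix (Fin 2) (Fin 2) (Zq p f)) * heckeRep z *
          (((κ z)⁻¹ * κ x : K p f) : Matrix (Fin 2) (Fin 2) (Zq p f)) := by
          rw [Units.val_mul, mul_assoc, hx, e1, Units.val_mul]
          simp only [mul_assoc]
      _ = _ := by rw [inv_mul_cancel, Units.val_one, one_mul]
  exact ⟨Equiv.ofBijective σ (Finite.injective_iff_bijective.mp inj), κ, hσ⟩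

theorem inclK_mul_heckeG {k κ : K p f} {x z : Option (Fq p f)}
    (h : (k : Matrix (Fin 2) (Fin 2) (Zq p f)) * heckeRep x =
      heckeRep z * (κ : Matrix (Fin 2) (Fin 2) (Zq p f))) :
    inclK k * heckeG x = heckeG z * inclK κ := by
  refine Units.ext ?_
  have := congrArg (fun m => m.map (algebraMap (Zq p f) (Qq p f))) h
  rw [Matrix.map_mul, Matrix.map_mul] at this
  exact this

theorem scalarP_comm (g : G p f) : scalarP p f * g = g * scalarP p f := by
  refine Units.ext ?_
  ext i j
  fin_cases i <;> fin_cases j <;>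
    simp [scalarP, toG, Matrix.mul_apply, Fin.sum_univ_two, mul_comm]

theorem exists_support (x : Option (Fq p f)) (h : G p f) (hh : h ∈ KZ p f) :
    ∃ z, heckeG x * h * heckeG z ∈ KZ p f := by
  rw [KZ, Subgroup.mem_sup_of_normal_right] at hh
  obtain ⟨_, ⟨k, rfl⟩, c, hc, rfl⟩ := hh
  let m : Matrix (Fin 2) (Fin 2) (Zq p f) := heckeRep x * (k : Matrix (Fin 2) (Fin 2) (Zq p f))
  let u : (Zq p f)ˣ := Matrix.GeneralLinearGroup.det k
  have hm : m.det = (p : Zq p f) * u := by rw [Matrix.det_mul, det_heckeRep]; rfl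
  obtain ⟨z, κ, hz⟩ := exists_decomp m.adjugate u (by rw [Matrix.det_adjugate, hm]; simp)
  let d : K p f := Units.map (Matrix.scalar (Fin 2)).toMonoidHom u
  have e : heckeG x * inclK k * heckeG z * inclK κ = scalarP p f * inclK d := by
    have e1 : heckeRep x * (k : Matrix (Fin 2) (Fin 2) (Zq p f)) * heckeRep z *
        (κ : Matrix (Fin 2) (Fin 2) (Zq p f)) =
        !![(p : Zq p f), 0; 0, (p : Zq p f)] * (d : Matrix (Fin 2) (Fin 2) (Zq p f)) := by
      rw [mul_assoc (heckeRep x * (k : Matrix (Fin 2) (Fin 2) (Zq p f))), ← hz]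
      change m * m.adjugate = _
      rw [Matrix.mul_adjugate, hm]
      ext i j
      fin_cases i <;> fin_cases j <;> simp [d, Matrix.mul_apply, Fin.sum_univ_two]
    refine Units.ext ?_
    have := congrArg (fun m => m.map (algebraMap (Zq p f) (Qq p f))) e1
    simp only [Matrix.map_mul] at this
    exact this
  refine ⟨z, ?_⟩
  have hK : ∀ k : K p f, inclK k ∈ KZ p f := fun k => Subgroup.mem_sup_left ⟨k, rfl⟩
  have hZ : ∀ c ∈ Subgroup.center (G p f), c ∈ KZ p f := fun c hc => Subgroup.mem_sup_right hc
  have hp : scalarP p f ∈ Subgroup.center (G p f) :=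
    Subgroup.mem_center_iff.2 fun g => (scalarP_comm g).symm
  have e2 : heckeG x * (inclK k * c) * heckeG z =
      c * (scalarP p f * inclK d * (inclK κ)⁻¹) := by
    rw [← e, mul_inv_cancel_right, ← mul_assoc, Subgroup.mem_center_iff.1 hc, mul_assoc c]
  rw [e2]
  exact mul_mem (hZ c hc) (mul_mem (mul_mem (hZ _ hp) (hK _)) (inv_mem (hK _)))

theorem symModAct_equivariant (ι : Zq p f →+* R) (r : Fin f → ℕ) (s : ℕ) {k κ : K p f}
    {x z : Option (Fq p f)}
    (h : (k : Matrix (Fin 2) (Fin 2) (Zq p f)) * heckeRep x =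
      heckeRep z * (κ : Matrix (Fin 2) (Fin 2) (Zq p f))) (v : SymMod ι r s) :
    symModAct ι r s (heckeRep z) (MonoidAlgebra.of R (K p f) κ • v) =
      MonoidAlgebra.of R (K p f) k • symModAct ι r s (heckeRep x) v := by
  have hd : (k : Matrix (Fin 2) (Fin 2) (Zq p f)).det =
      (κ : Matrix (Fin 2) (Fin 2) (Zq p f)).det := by
    have := congrArg Matrix.det h
    rw [Matrix.det_mul, Matrix.det_mul, det_heckeRep, det_heckeRep, mul_comm] at this
    exact mul_left_cancel₀ natCast_p_ne_zero this
  rw [of_smul_symMod, of_smul_symMod]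
  have key : ∀ v : symSpace R r, symAct ι r (heckeRep z) (symRep ι r s κ v) =
      symRep ι r s k (symAct ι r (heckeRep x) v) := by
    intro v
    change symAct ι r (heckeRep z) (ι _ ^ s • symAct ι r κ v) =
      ι _ ^ s • symAct ι r k (symAct ι r (heckeRep x) v)
    rw [map_smul, ← symAct_mul, ← symAct_mul, h, hd]
  exact key v

/-- The Hecke operator `T` on `ind_{KZ}^G ((⨂ Sym^{r_i} R²) ⊗ D^s)`. It is the operator attached to
the function `φ : G → End V` supported on `KZ α⁻¹ KZ`, `α = (1 0; 0 p)`, with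
`φ (k₁ g k₂) = k₁ φ(g) k₂` for `k₁, k₂ ∈ KZ` and `φ(α⁻¹) v(X_i, Y_i) = v(p X_i, Y_i)`, that is
`(T F)(g) = ∑ φ(y) (F (y⁻¹ g))` over `y KZ ∈ KZ α⁻¹ KZ / KZ`. For the representatives
`y = (p [λ]; 0 1), (1 0; 0 p)`, the map `φ(y)` is the substitution attached to the matrix `y`.
On the function `[g, v]` supported on `KZ g⁻¹` with value `v` at `g⁻¹` this reads
`T [g, v] = ∑_λ [g (p [λ]; 0 1), v(X_i, -[λ]^{p^i} X_i + p Y_i)] + [g (1 0; 0 p), v(p X_i, Y_i)]`. -/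
def heckeT (ι : Zq p f →+* R) (r : Fin f → ℕ) (s : ℕ) :
    cInd (p := p) (f := f) R (SymMod ι r s) →ₗ[R] cInd (p := p) (f := f) R (SymMod ι r s) where
  toFun F := ⟨fun g => ∑ x : Option (Fq p f),
      symModAct ι r s (heckeRep x) (F.1 ((heckeG x)⁻¹ * g)), by
    classical
    refine ⟨fun k g => ?_, fun g => ?_, ?_⟩
    · obtain ⟨σ, κ, h⟩ := exists_perm k
      change ∑ x : Option (Fq p f), _ = _ • ∑ x : Option (Fq p f), _
      rw [Finset.smul_sum, ← Equiv.sum_comp σ]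
      refine Finset.sum_congr rfl fun x _ => ?_
      have e : (heckeG (σ x))⁻¹ * (inclK k * g) = inclK (κ x) * ((heckeG x)⁻¹ * g) := by
        rw [inv_mul_eq_iff_eq_mul, ← mul_assoc (heckeG (σ x)), ← inclK_mul_heckeG (h x)]
        simp only [mul_assoc, mul_inv_cancel_left]
      rw [e, F.2.1, symModAct_equivariant ι r s (h x)]
    · refine Finset.sum_congr rfl fun x _ => ?_
      rw [← mul_assoc, ← scalarP_comm, mul_assoc, F.2.2.1]
    · obtain ⟨S, hS⟩ := F.2.2.2
      refine ⟨(Finset.univ ×ˢ S).image fun a => (heckeG a.1)⁻¹ * a.2, fun g hg => ?_⟩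
      obtain ⟨x, -, hx⟩ := Finset.exists_ne_zero_of_sum_ne_zero hg
      obtain ⟨s', hs, hs'⟩ := hS ((heckeG x)⁻¹ * g) (fun h0 => hx (by rw [h0, map_zero]))
      obtain ⟨z, hz⟩ := exists_support x _ hs'
      refine ⟨(heckeG z)⁻¹ * s', Finset.mem_image.2 ⟨(z, s'), by simp [hs], rfl⟩, ?_⟩
      convert hz using 1
      simp only [mul_inv_rev, inv_inv, mul_assoc, mul_inv_cancel_left]⟩
  map_add' F F' := by
    ext g : 2
    simp [Finset.sum_add_distrib]
  map_smul' c F := by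
    ext g : 2
    simp [Finset.smul_sum]

end Ind

/-! ### The socle filtration -/

section Socle

variable (A : Type*) [Ring A]

/-- The socle of a module: the sum of its simple submodules. -/
def socle (M : Type*) [AddCommGroup M] [Module A M] : Submodule A M :=
  sSup {N : Submodule A M | IsSimpleModule A N}

/-- The socle filtration `0 = S₀ ⊆ S₁ ⊆ ⋯` of a module: `S_{i+1} / S_i` is the socle of
`M / S_i`. -/
def socleFil (M : Type*) [AddCommGroup M] [Module A M] : ℕ → Submodule A M
  | 0 => ⊥
  | i + 1 => (socle A (M ⧸ socleFil M i)).comap (socleFil M i).mkQ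

end Socle

/-! ### The representation `Q` and the filtration on it -/

section Q

variable {k : Type*} [Field k]

/-- The polynomial `θ_i = X_i Y_{i-1}^p - Y_i X_{i-1}^p`, where `0 - 1 = f - 1`. -/
def thetaPoly (p f : ℕ) [NeZero f] (k : Type*) [Field k] (i : Fin f) :
    MvPolynomial (Fin f × Fin 2) k :=
  X (i, 0) * X (i - 1, 1) ^ p - X (i, 1) * X (i - 1, 0) ^ p

/-- The subrepresentation `V_r^*` of `V_r = ⨂ Sym^{r_i} k²` generated by the multiples of the
`θ_i`. -/
def Vstar [NeZero f] (ι : Zq p f →+* k) (r : Fin f → ℕ) : Submodule k[K p f] (SymMod ι r 0) :=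
  Submodule.span k[K p f] {v | (symEquiv ι r 0 v : MvPolynomial (Fin f × Fin 2) k) ∈
    Ideal.span (Set.range (thetaPoly p f k))}

/-- The subrepresentation `X_r` of `V_r` generated by `∏ X_i^{r_i}`. -/
def Xsub (ι : Zq p f →+* k) (r : Fin f → ℕ) : Submodule k[K p f] (SymMod ι r 0) :=
  Submodule.span k[K p f] {v | (symEquiv ι r 0 v : MvPolynomial (Fin f × Fin 2) k) =
    ∏ i : Fin f, X (i, 0) ^ r i}

/-- `Q = V_r / (V_r^* + X_r)`. -/
abbrev Qmod [NeZero f] (ι : Zq p f →+* k) (r : Fin f → ℕ) : Type _ :=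
  SymMod ι r 0 ⧸ (Vstar ι r ⊔ Xsub ι r)

/-- The `i`-th step `Q_i` of the socle filtration of `Q`; `Q_1` is the socle of `Q`. -/
abbrev Qfil [NeZero f] (ι : Zq p f →+* k) (r : Fin f → ℕ) (i : ℕ) :
    Submodule k[K p f] (Qmod ι r) :=
  socleFil k[K p f] (Qmod ι r) i

/-- The second highest layer `Q_{f-1} / Q_{f-2}` of the socle filtration of `Q`. -/
abbrev Qsecond [NeZero f] (ι : Zq p f →+* k) (r : Fin f → ℕ) : Type _ :=
  Qfil ι r (f - 1) ⧸ (Qfil ι r (f - 2)).submoduleOf (Qfil ι r (f - 1))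

end Q

/-! ### The standard lattice and its reduction -/

section Lattice

variable (E : Type*) [NormedField E] [IsUltrametricDist E]

/-- The ring of integers of `E`. -/
abbrev OE : ValuationSubring E := (NormedField.valuation (K := E)).valuationSubring

/-- The residue field of `E`. -/
abbrev kE : Type _ := IsLocalRing.ResidueField (OE E)

variable {E}

/-- The structure map `ℤ_{p^f} → E`. -/
abbrev toE (ι : Zq p f →+* OE E) : Zq p f →+* E := (OE E).subtype.comp ι

/-- The structure map `ℤ_{p^f} → k_E`. -/
abbrev toK (ι : Zq p f →+* OE E) : Zq p f →+* kE E := (IsLocalRing.residue (OE E)).comp ι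

/-- The submodule `(T - a_p) (ind ⨂ Sym^{r_i} E²) ∩ ind ⨂ Sym^{r_i} O_E²`. -/
def relations (ι : Zq p f →+* OE E) (r : Fin f → ℕ) (ap : E) :
    Submodule (OE E) (cInd (p := p) (f := f) (OE E) (SymMod ι r 0)) :=
  (LinearMap.range (heckeT (toE ι) r 0 - ap • LinearMap.id)).comap
    (cIndBaseChange (OE E).subtype ι r 0)

/-- The standard lattice `Θ_{k,a_p}`, `k_i = r_i + 2`: the image of `ind ⨂ Sym^{r_i} O_E²` in
`Π_{k,a_p} = ind (⨂ Sym^{r_i} E²) / (T - a_p)`. -/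
abbrev Theta (ι : Zq p f →+* OE E) (r : Fin f → ℕ) (ap : E) : Type _ :=
  cInd (p := p) (f := f) (OE E) (SymMod ι r 0) ⧸ relations ι r ap

/-- The reduction `Θ_{k,a_p} ⊗ k_E` of the standard lattice. -/
def ThetaBar (ι : Zq p f →+* OE E) (r : Fin f → ℕ) (ap : E) : Type _ :=
  kE E ⊗[OE E] Theta ι r ap

instance (ι : Zq p f →+* OE E) (r : Fin f → ℕ) (ap : E) : AddCommGroup (ThetaBar ι r ap) :=
  inferInstanceAs (AddCommGroup (kE E ⊗[OE E] Theta ι r ap))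

instance (ι : Zq p f →+* OE E) (r : Fin f → ℕ) (ap : E) : Module (kE E) (ThetaBar ι r ap) :=
  inferInstanceAs (Module (kE E) (kE E ⊗[OE E] Theta ι r ap))

/-- The class in `Θ̄` of an element of `ind ⨂ Sym^{r_i} O_E²`. -/
def toThetaBar (ι : Zq p f →+* OE E) (r : Fin f → ℕ) (ap : E)
    (F : cInd (p := p) (f := f) (OE E) (SymMod ι r 0)) : ThetaBar ι r ap :=
  (1 : kE E) ⊗ₜ[OE E] (Submodule.Quotient.mk F : Theta ι r ap)

/-- `ind V_r → ind Q`, for `V_r = ⨂ Sym^{r_i} k_E²`. -/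
abbrev indToQ [NeZero f] (ι : Zq p f →+* OE E) (r : Fin f → ℕ) :
    cInd (p := p) (f := f) (kE E) (SymMod (toK ι) r 0) →ₗ[kE E]
      cInd (p := p) (f := f) (kE E) (Qmod (toK ι) r) :=
  cIndMap (Vstar (toK ι) r ⊔ Xsub (toK ι) r).mkQ

/-- Given a map `ind Q → Θ̄`, its restriction to `ind Q_i`. -/
abbrev restrictFil [NeZero f] {ι : Zq p f →+* OE E} {r : Fin f → ℕ} {ap : E}
    (π : cInd (p := p) (f := f) (kE E) (Qmod (toK ι) r) →ₗ[kE E] ThetaBar ι r ap) (i : ℕ) :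
    cInd (p := p) (f := f) (kE E) (Qfil (toK ι) r i) →ₗ[kE E] ThetaBar ι r ap :=
  π ∘ₗ cIndMap (Qfil (toK ι) r i).subtype

/-- `F_i = Im (ind Q_i → Θ̄)`. -/
abbrev Ffil [NeZero f] {ι : Zq p f →+* OE E} {r : Fin f → ℕ} {ap : E}
    (π : cInd (p := p) (f := f) (kE E) (Qmod (toK ι) r) →ₗ[kE E] ThetaBar ι r ap) (i : ℕ) :
    Submodule (kE E) (ThetaBar ι r ap) :=
  LinearMap.range (restrictFil π i)

/-- `F_s = F_{f-1} / F_{f-2}`. -/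
abbrev Fsecond [NeZero f] {ι : Zq p f →+* OE E} {r : Fin f → ℕ} {ap : E}
    (π : cInd (p := p) (f := f) (kE E) (Qmod (toK ι) r) →ₗ[kE E] ThetaBar ι r ap) : Type _ :=
  Ffil π (f - 1) ⧸ (Ffil π (f - 2)).submoduleOf (Ffil π (f - 1))

end Lattice

/-- The `p`-adic valuation `v(x)` of `x ≠ 0`, normalized by `v(p) = 1`. -/
def slope (p : ℕ) {E : Type*} [NormedField E] (x : E) : ℝ := -Real.logb p ‖x‖

/-- The tuple `(a₀ - 1, p - 2, p - 1, …, p - 1)`. -/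
def secondWeight (p f : ℕ) [NeZero f] (a₀ : ℕ) (i : Fin f) : ℕ :=
  if i = 0 then a₀ - 1 else if i = 1 then p - 2 else p - 1

end HeckeRed

end

open HeckeRed
open scoped TensorProduct MonoidAlgebra

set_option linter.unusedSectionVars false

noncomputable section

namespace HeckeRed

variable {p f : ℕ} [Fact p.Prime]

/-! ### The group `KZ` -/

/-! Put `q = p ^ f`. The substitution `X_i = x ^ (p ^ i)`, `Y_i = y ^ (p ^ i)` turns `V_r` into
functions on `𝔽_q²`, compatibly with `K`, and its kernel is `V_r^*` (`mem_span_of_evPt_eq_zero`).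
Under it `X_r` becomes the forms of degree `a₀`, all of which are reached because `a₀ < p` keeps the
binomials `C(a₀, n)` prime to `p`. Power sums over `𝔽_q` show that these are the functions in the
image that are orthogonal to all forms of degree `q - 1 - a₀`. Hence `Q` is the space of functions
modulo that annihilator (`mem_sup_iff`, `exists_isQuot`), with basis `x ^ (q - 1 + a₀ - n) y ^ n`,
`a₀ ≤ n ≤ q - 1`.

The torus separates these basis vectors and the unipotents connect them with binomial coefficients.
By Lucas, the span of the `n` with `n % p ^ m < a₀` is a subrepresentation, and a subrepresentation
not contained in the `(m + 1)`-st span contains the `m`-th (`IsQuot.fil_le`). So `Q` is uniserial of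
length `f`, and `Q_{f-m}` is the `m`-th span. The layer `Q_{f-1} / Q_{f-2}` and the weight `W` are
both quotients of the symmetric power of degrees `(a₀ - 1, p, p - 1, …)`, with the same kernel
(`IsQuot.nonempty_equiv`). For `W` this is the isomorphism of `Sym^p / ⟨X^p, Y^p⟩` with `Sym^{p-2} ⊗
D`, twisted by Frobenius.

The slope enters through the integrality of `p / a_p` and `a_p² / p`, both in the maximal ideal.
From `T H = p F` follows that `H` dies in `Θ̄`; this kills `V_r^*`. Since `a_p` reduces to `0`,
everything in the image of `T` dies; this kills `∏ Y_i ^ r_i`, which is in the image of `T` modulo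
`p`, and hence `X_r`. Finally, if `U = T H + p F` and `T U = p D`, then `(T - a_p) (U + a_p H)` is
`p` times an integral vector congruent to `D`, so `D` dies (`thetaBarMap_of_heckeT_eq_smul`).

The last relation is applied to `U = [g, testVec]`. To first order in `p`, `T U` is a sum over `m`
of the vectors `r_i d_i(m) ∏ X_j ^ r_j · Y_i / X_i`, with `d_1(m) ≡ -1`. In `Q` the vector with
index `i` is the basis vector with `n = p ^ i`. For `i ≠ 1` it lies in `Q_{f-2}`, except for `i = 0`
and `a₀ = 1`, where `p ∣ r_0` removes it. As `p ∤ r_1`, the vector `∑_m [g (p [m]; 0 1), x ^ (q - 1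
+ a₀ - p) y ^ p]` dies in `F_s`. The torus character identifies this basis vector with a multiple of
`∏ X_i ^ b_i` in `W`, and the sum is then `T [g, ∏ X_i ^ b_i]`. As `W` is irreducible, the map kills
all of the image of `T` (`comp_heckeT_eq_zero`). -/

theorem scalarP_mem_center : scalarP p f ∈ Subgroup.center (G p f) :=
  Subgroup.mem_center_iff.2 fun g => (scalarP_comm g).symm

theorem scalarP_zpow_comm (n : ℤ) (g : G p f) : scalarP p f ^ n * g = g * scalarP p f ^ n :=
  (Subgroup.mem_center_iff.1 (Subgroup.zpow_mem _ scalarP_mem_center n) g).symm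

theorem inclK_mem_KZ (k : K p f) : inclK k ∈ KZ p f := Subgroup.mem_sup_left ⟨k, rfl⟩

theorem scalarP_zpow_mem_KZ (n : ℤ) : scalarP p f ^ n ∈ KZ p f :=
  Subgroup.mem_sup_right (Subgroup.zpow_mem _ scalarP_mem_center n)

theorem natCast_p_ne_zero_Qq : (p : Qq p f) ≠ 0 := by
  have := (map_ne_zero_iff (algebraMap (Zq p f) (Qq p f))
    (IsFractionRing.injective (Zq p f) (Qq p f))).2 natCast_p_ne_zero
  rwa [map_natCast] at this

theorem exists_zpow_mul_unit (c : Qq p f) (hc : c ≠ 0) :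
    ∃ (n : ℤ) (u : (Zq p f)ˣ), c = algebraMap (Zq p f) (Qq p f) u * (p : Qq p f) ^ n := by
  obtain ⟨a, b, hb, rfl⟩ := IsFractionRing.div_surjective (A := Zq p f) c
  have hb0 : b ≠ 0 := nonZeroDivisors.ne_zero hb
  have ha0 : a ≠ 0 := by rintro rfl; simp at hc
  obtain ⟨n, u, rfl⟩ := WittVector.exists_eq_pow_p_mul' a ha0
  obtain ⟨m, w, rfl⟩ := WittVector.exists_eq_pow_p_mul' b hb0
  have hp := natCast_p_ne_zero_Qq (p := p) (f := f)
  refine ⟨n - m, u * w⁻¹, ?_⟩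
  have hw : algebraMap (Zq p f) (Qq p f) w *
      algebraMap (Zq p f) (Qq p f) ((w⁻¹ : (Zq p f)ˣ) : Zq p f) = 1 := by
    rw [← map_mul, Units.mul_inv, map_one]
  have hb1 : algebraMap (Zq p f) (Qq p f) ((p : Zq p f) ^ m * w) ≠ 0 := by
    rw [map_mul, map_pow, map_natCast]
    exact mul_ne_zero (pow_ne_zero _ hp) (left_ne_zero_of_mul_eq_one hw)
  rw [div_eq_iff hb1, zpow_sub₀ hp]
  simp only [map_mul, map_pow, map_natCast, Units.val_mul, zpow_natCast]
  have hm := mul_inv_cancel₀ (pow_ne_zero m hp)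
  rw [div_eq_mul_inv]
  linear_combination (-(algebraMap (Zq p f) (Qq p f) u) * p ^ n) * (hw +
    algebraMap (Zq p f) (Qq p f) w *
      algebraMap (Zq p f) (Qq p f) ((w⁻¹ : (Zq p f)ˣ) : Zq p f) * hm)

theorem scalarP_zpow_val (n : ℤ) :
    ((scalarP p f ^ n : G p f) : Matrix (Fin 2) (Fin 2) (Qq p f)) =
      Matrix.scalar (Fin 2) ((p : Qq p f) ^ n) := by
  have h : scalarP p f = Units.map (Matrix.scalar (Fin 2)).toMonoidHom
      (Units.mk0 (p : Qq p f) natCast_p_ne_zero_Qq) := by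
    refine Units.ext ?_
    change Matrix.map !![(p : Zq p f), 0; 0, (p : Zq p f)] (algebraMap (Zq p f) (Qq p f)) =
      Matrix.scalar (Fin 2) (p : Qq p f)
    ext i j
    rw [Matrix.scalar_apply, Matrix.diagonal_apply]
    fin_cases i <;> fin_cases j <;> simp
  rw [h, ← map_zpow]
  change Matrix.scalar (Fin 2) ((Units.mk0 (p : Qq p f) natCast_p_ne_zero_Qq ^ n : (Qq p f)ˣ) :
    Qq p f) = _
  rw [Units.val_zpow_eq_zpow_val, Units.val_mk0]

/-- A central element is a scalar `u p ^ n` with `u` a unit of `ℤ_{p^f}`, and the scalar `u` is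
absorbed into `K`. -/
theorem mem_KZ_iff (h : G p f) :
    h ∈ KZ p f ↔ ∃ (k : K p f) (n : ℤ), h = inclK k * scalarP p f ^ n := by
  refine ⟨fun hh => ?_, ?_⟩
  · rw [KZ, Subgroup.mem_sup_of_normal_right] at hh
    obtain ⟨_, ⟨k, rfl⟩, c, hc, rfl⟩ := hh
    obtain ⟨c', hc'⟩ := Matrix.GeneralLinearGroup.mem_center_iff_val_mem_range_scalar.1 hc
    have hc0 : c' ≠ 0 := by
      rintro rfl
      have := c.ne_zero
      rw [← hc'] at this
      simp at this
    obtain ⟨n, u, hu⟩ := exists_zpow_mul_unit c' hc0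
    refine ⟨k * Units.map (Matrix.scalar (Fin 2)).toMonoidHom u, n, ?_⟩
    rw [map_mul, mul_assoc]
    congr 1
    refine Units.ext ?_
    rw [Units.val_mul, scalarP_zpow_val, ← hc', hu]
    ext i j
    fin_cases i <;> fin_cases j <;> simp [inclK]
  · rintro ⟨k, n, rfl⟩
    exact mul_mem (inclK_mem_KZ k) (scalarP_zpow_mem_KZ n)

theorem inclK_injective : Function.Injective (inclK (p := p) (f := f)) := by
  intro a b h
  refine Units.ext ?_
  ext i j : 1
  have := congrArg (fun g : G p f => (g : Matrix (Fin 2) (Fin 2) (Qq p f)) i j) h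
  exact IsFractionRing.injective (Zq p f) (Qq p f) this

theorem not_isUnit_natCast_p_pow {n : ℕ} (hn : n ≠ 0) : ¬ IsUnit ((p : Zq p f) ^ n) := by
  rw [isUnit_pow_iff hn]
  exact (WittVector.irreducible p (k := Fq p f)).not_isUnit

theorem zpow_eq_unit {n : ℤ} {u : (Zq p f)ˣ}
    (h : (p : Qq p f) ^ n = algebraMap (Zq p f) (Qq p f) u) : n = 0 := by
  have key : ∀ (n : ℕ) (u : (Zq p f)ˣ),
      (p : Qq p f) ^ n = algebraMap (Zq p f) (Qq p f) u → n = 0 := by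
    intro n u h
    by_contra hn
    refine not_isUnit_natCast_p_pow (p := p) (f := f) hn ?_
    have : (p : Zq p f) ^ n = u := IsFractionRing.injective (Zq p f) (Qq p f) (by simpa using h)
    rw [this]
    exact u.isUnit
  obtain ⟨m, rfl | rfl⟩ := n.eq_nat_or_neg
  · rw [zpow_natCast] at h
    rw [key m u h, Nat.cast_zero]
  · rw [zpow_neg, zpow_natCast, inv_eq_iff_eq_inv] at h
    rw [key m u⁻¹ (by
      rw [h]
      refine inv_eq_of_mul_eq_one_right ?_
      rw [← map_mul, Units.mul_inv, map_one]),
      Nat.cast_zero, neg_zero]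

theorem det_inclK (k : K p f) :
    ((inclK k : G p f) : Matrix (Fin 2) (Fin 2) (Qq p f)).det =
      algebraMap (Zq p f) (Qq p f) (Matrix.GeneralLinearGroup.det k : (Zq p f)ˣ) :=
  (RingHom.map_det (algebraMap (Zq p f) (Qq p f)) (k : Matrix (Fin 2) (Fin 2) (Zq p f))).symm

/-- Comparing determinants, `p ^ (2 (n - n'))` is a unit, so `n = n'`. This makes the chosen
decomposition in `kzExt` irrelevant. -/
theorem inclK_mul_scalarP_inj {k k' : K p f} {n n' : ℤ}
    (h : inclK k * scalarP p f ^ n = inclK k' * scalarP p f ^ n') : k = k' ∧ n = n' := by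
  have h1 : scalarP p f ^ (n - n') = inclK (k⁻¹ * k') := by
    rw [zpow_sub, map_mul, map_inv, eq_inv_mul_iff_mul_eq, ← mul_assoc, h, mul_inv_cancel_right]
  have h2 := congrArg (fun g : G p f => (g : Matrix (Fin 2) (Fin 2) (Qq p f)).det) h1
  simp only [scalarP_zpow_val, det_inclK] at h2
  have h3 : (n - n') * 2 = 0 := by
    refine zpow_eq_unit (p := p) (f := f) (u := Matrix.GeneralLinearGroup.det (k⁻¹ * k')) ?_
    rw [← h2, zpow_mul]
    simp [sq]
  have hn : n = n' := by omega
  subst hn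
  exact ⟨inclK_injective (mul_right_cancel h), rfl⟩

/-- `heckeG x` are representatives of distinct cosets of `KZ`. -/
theorem heckeG_inj {x z : Option (Fq p f)} (h : (heckeG x)⁻¹ * heckeG z ∈ KZ p f) : x = z := by
  obtain ⟨k, n, hk⟩ := (mem_KZ_iff _).1 h
  have e : heckeG z = heckeG x * (inclK k * scalarP p f ^ n) := by rw [← hk, mul_inv_cancel_left]
  have hd : ∀ x : Option (Fq p f), ((heckeG x : G p f) : Matrix (Fin 2) (Fin 2) (Qq p f)).det = p := by
    intro x
    have := (RingHom.map_det (algebraMap (Zq p f) (Qq p f)) (heckeRep x)).symm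
    rw [det_heckeRep, map_natCast] at this
    exact this
  have h2 := congrArg (fun g : G p f => (g : Matrix (Fin 2) (Fin 2) (Qq p f)).det) e
  simp only [Units.val_mul, Matrix.det_mul, hd, scalarP_zpow_val, det_inclK] at h2
  have h3 : n * 2 = 0 := by
    refine zpow_eq_unit (p := p) (f := f) (u := (Matrix.GeneralLinearGroup.det k)⁻¹) ?_
    have h4 : algebraMap (Zq p f) (Qq p f) (Matrix.GeneralLinearGroup.det k : (Zq p f)ˣ) *
        (p : Qq p f) ^ (n * 2) = 1 := by
      refine mul_left_cancel₀ natCast_p_ne_zero_Qq (Eq.trans ?_ (h2.symm.trans (mul_one _).symm))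
      simp [zpow_mul, sq]
    have h5 : algebraMap (Zq p f) (Qq p f) (Matrix.GeneralLinearGroup.det k : (Zq p f)ˣ) *
        algebraMap (Zq p f) (Qq p f) ((Matrix.GeneralLinearGroup.det k)⁻¹ : (Zq p f)ˣ) = 1 := by
      rw [← map_mul, Units.mul_inv, map_one]
    exact mul_left_cancel₀ (left_ne_zero_of_mul_eq_one h5) (h4.trans h5.symm)
  have hn : n = 0 := by omega
  subst hn
  refine (heckeRep_inj z x k ?_).symm
  rw [zpow_zero, mul_one] at e
  ext i j : 1
  have := congrArg (fun g : G p f => (g : Matrix (Fin 2) (Fin 2) (Qq p f)) i j) e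
  refine IsFractionRing.injective (Zq p f) (Qq p f) (this.trans ?_)
  simp [Matrix.mul_apply, heckeG, toG, inclK]

/-! ### Functions supported on one coset -/

section Br

variable {R M : Type*} [CommRing R] [AddCommGroup M] [Module R M] [Module R[K p f] M]
  [IsScalarTower R R[K p f] M]

open Classical in
/-- The value at `h` of the function supported on `KZ` with value `v` at `1`. -/
def kzExt (v : M) (h : G p f) : M :=
  if H : ∃ (k : K p f) (n : ℤ), h = inclK k * scalarP p f ^ n then
    MonoidAlgebra.of R (K p f) H.choose • v else 0

theorem kzExt_of_eq {h : G p f} {k : K p f} {n : ℤ} (e : h = inclK k * scalarP p f ^ n) (v : M) :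
    kzExt (R := R) v h = MonoidAlgebra.of R (K p f) k • v := by
  have H : ∃ (k : K p f) (n : ℤ), h = inclK k * scalarP p f ^ n := ⟨k, n, e⟩
  rw [kzExt, dif_pos H]
  obtain ⟨n', hn'⟩ := H.choose_spec
  rw [(inclK_mul_scalarP_inj (hn'.symm.trans e)).1]

theorem kzExt_of_notMem {h : G p f} (e : h ∉ KZ p f) (v : M) : kzExt (R := R) v h = 0 := by
  rw [kzExt, dif_neg]
  rwa [mem_KZ_iff] at e

/-- The function `[g, v]` in `ind_{KZ}^G M`, supported on `KZ g⁻¹` with value `v` at `g⁻¹`. -/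
def br (g : G p f) : M →ₗ[R] cInd (p := p) (f := f) R M where
  toFun v := ⟨fun h => kzExt (R := R) v (h * g), fun k h => by
    change kzExt (R := R) v (inclK k * h * g) = _ • kzExt (R := R) v (h * g)
    by_cases e : h * g ∈ KZ p f
    · obtain ⟨l, n, e'⟩ := (mem_KZ_iff _).1 e
      rw [kzExt_of_eq e', mul_assoc, e', ← mul_assoc, ← map_mul, kzExt_of_eq rfl, map_mul, mul_smul]
    · rw [kzExt_of_notMem e, mul_assoc, kzExt_of_notMem, smul_zero]
      rwa [Subgroup.mul_mem_cancel_left _ (inclK_mem_KZ k)], fun h => by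
    change kzExt (R := R) v (scalarP p f * h * g) = kzExt (R := R) v (h * g)
    by_cases e : h * g ∈ KZ p f
    · obtain ⟨l, n, e'⟩ := (mem_KZ_iff _).1 e
      rw [kzExt_of_eq e', kzExt_of_eq (k := l) (n := n + 1)]
      rw [mul_assoc, e', zpow_add_one, scalarP_comm, mul_assoc]
    · rw [kzExt_of_notMem e, mul_assoc, kzExt_of_notMem]
      have := scalarP_zpow_mem_KZ (p := p) (f := f) 1
      rw [zpow_one] at this
      rwa [Subgroup.mul_mem_cancel_left _ this], {g⁻¹}, fun h hh => by
    refine ⟨g⁻¹, Finset.mem_singleton_self _, ?_⟩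
    rw [inv_inv]
    by_contra e
    exact hh (kzExt_of_notMem e v)⟩
  map_add' v w := by
    refine Subtype.ext (funext fun h => ?_)
    change kzExt (R := R) (v + w) (h * g) = kzExt (R := R) v (h * g) + kzExt (R := R) w (h * g)
    by_cases e : h * g ∈ KZ p f
    · obtain ⟨l, n, e'⟩ := (mem_KZ_iff _).1 e
      simp only [kzExt_of_eq e', smul_add]
    · simp only [kzExt_of_notMem e, add_zero]
  map_smul' c v := by
    refine Subtype.ext (funext fun h => ?_)
    change kzExt (R := R) (c • v) (h * g) = c • kzExt (R := R) v (h * g)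
    by_cases e : h * g ∈ KZ p f
    · obtain ⟨l, n, e'⟩ := (mem_KZ_iff _).1 e
      simp only [kzExt_of_eq e']
      exact smul_comm _ _ _
    · simp only [kzExt_of_notMem e, smul_zero]

theorem br_apply_of_eq {g h : G p f} {k : K p f} {n : ℤ}
    (e : h * g = inclK k * scalarP p f ^ n) (v : M) :
    (br (R := R) g v).1 h = MonoidAlgebra.of R (K p f) k • v := kzExt_of_eq e v

theorem br_apply_of_notMem {g h : G p f} (e : h * g ∉ KZ p f) (v : M) :
    (br (R := R) g v).1 h = 0 := kzExt_of_notMem e v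

theorem br_smul (g : G p f) (k : K p f) (v : M) :
    br (R := R) g (MonoidAlgebra.of R (K p f) k • v) = br (g * inclK k) v := by
  refine Subtype.ext (funext fun h => ?_)
  by_cases e : h * g ∈ KZ p f
  · obtain ⟨l, n, e'⟩ := (mem_KZ_iff _).1 e
    rw [br_apply_of_eq e', br_apply_of_eq (k := l * k) (n := n), map_mul, mul_smul]
    rw [← mul_assoc, e', map_mul, mul_assoc, mul_assoc, scalarP_zpow_comm]
  · rw [br_apply_of_notMem e, br_apply_of_notMem]
    rwa [← mul_assoc, Subgroup.mul_mem_cancel_right _ (inclK_mem_KZ k)]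

theorem cInd_apply_of_eq (F : cInd (p := p) (f := f) R M) {h g : G p f} {k : K p f} {n : ℤ}
    (e : h = inclK k * scalarP p f ^ n * g) : F.1 h = MonoidAlgebra.of R (K p f) k • F.1 g := by
  have key : ∀ (n : ℕ) (g : G p f), F.1 (scalarP p f ^ n * g) = F.1 g := by
    intro n g
    induction n with
    | zero => rw [pow_zero, one_mul]
    | succ n ih => rw [pow_succ', mul_assoc, F.2.2.1, ih]
  rw [e, mul_assoc, F.2.1]
  congr 1
  obtain ⟨m, rfl | rfl⟩ := n.eq_nat_or_neg
  · rw [zpow_natCast, key]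
  · rw [← key m (scalarP p f ^ (-(m : ℤ)) * g), ← mul_assoc, ← zpow_natCast, ← zpow_add,
      add_neg_cancel, zpow_zero, one_mul]

/-- An additive subgroup of `ind_{KZ}^G M` which contains `[h⁻¹, F h]` for all `h` contains `F`. -/
theorem cInd_mem_of_br_mem (P : AddSubgroup (cInd (p := p) (f := f) R M))
    (F : cInd (p := p) (f := f) R M) (hF : ∀ h, br h⁻¹ (F.1 h) ∈ P) : F ∈ P := by
  classical
  obtain ⟨S, hS⟩ := F.2.2.2
  induction S using Finset.induction_on generalizing F with
  | empty =>
    have : F = 0 := Subtype.ext (funext fun g => by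
      by_contra h
      obtain ⟨s, hs, -⟩ := hS g h
      exact absurd hs (Finset.notMem_empty s))
    rw [this]
    exact P.zero_mem
  | insert s S _ ih =>
    have h1 : ∀ h, h * s⁻¹ ∈ KZ p f → (F - br s⁻¹ (F.1 s)).1 h = 0 := by
      intro h hh
      obtain ⟨k, n, e⟩ := (mem_KZ_iff _).1 hh
      change F.1 h - (br (R := R) s⁻¹ (F.1 s)).1 h = 0
      rw [br_apply_of_eq e, cInd_apply_of_eq F (mul_inv_eq_iff_eq_mul.1 e), sub_self]
    have h2 : ∀ h, h * s⁻¹ ∉ KZ p f → (F - br s⁻¹ (F.1 s)).1 h = F.1 h := by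
      intro h hh
      change F.1 h - (br (R := R) s⁻¹ (F.1 s)).1 h = F.1 h
      rw [br_apply_of_notMem hh, sub_zero]
    have h3 : F - br s⁻¹ (F.1 s) ∈ P := by
      refine ih _ (fun h => ?_) fun g hg => ?_
      · by_cases hh : h * s⁻¹ ∈ KZ p f
        · rw [h1 h hh, map_zero]
          exact P.zero_mem
        · rw [h2 h hh]
          exact hF h
      · by_cases hh : g * s⁻¹ ∈ KZ p f
        · exact absurd (h1 g hh) hg
        · rw [h2 g hh] at hg
          obtain ⟨t, ht, ht'⟩ := hS g hg
          rcases Finset.mem_insert.1 ht with rfl | ht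
          · exact absurd ht' hh
          · exact ⟨t, ht, ht'⟩
    simpa using P.add_mem h3 (hF s)

theorem cIndMap_br {N : Type*} [AddCommGroup N] [Module R N] [Module R[K p f] N]
    [IsScalarTower R R[K p f] N] (φ : M →ₗ[R[K p f]] N) (g : G p f) (v : M) :
    cIndMap φ (br g v) = br g (φ v) := by
  refine Subtype.ext (funext fun h => ?_)
  change φ ((br (R := R) g v).1 h) = (br (R := R) g (φ v)).1 h
  by_cases e : h * g ∈ KZ p f
  · obtain ⟨l, n, e'⟩ := (mem_KZ_iff _).1 e
    rw [br_apply_of_eq e', br_apply_of_eq e', map_smul]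
  · rw [br_apply_of_notMem e, br_apply_of_notMem e, map_zero]

theorem cIndMap_surjective {N : Type*} [AddCommGroup N] [Module R N] [Module R[K p f] N]
    [IsScalarTower R R[K p f] N] (φ : M →ₗ[R[K p f]] N) (hφ : Function.Surjective φ) :
    Function.Surjective (cIndMap (R := R) (p := p) (f := f) φ) := by
  intro F
  refine cInd_mem_of_br_mem (LinearMap.range (cIndMap (R := R) (p := p) (f := f) φ)).toAddSubgroup F
    fun h => ?_
  obtain ⟨v, hv⟩ := hφ (F.1 h)
  exact ⟨br h⁻¹ v, by rw [cIndMap_br, hv]⟩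

end Br

/-! ### Base change and the Hecke operator on the functions `[g, v]` -/

section BrSym

variable {R : Type*} [CommRing R]

theorem cIndBaseChange_br {R' : Type*} [CommRing R'] (φ : R →+* R') (ι : Zq p f →+* R)
    (r : Fin f → ℕ) (s : ℕ) (g : G p f) (v : SymMod ι r s) :
    cIndBaseChange φ ι r s (br g v) =
      br g ((symEquiv (φ.comp ι) r s).symm (symMap φ r (symEquiv ι r s v))) := by
  refine Subtype.ext (funext fun h => ?_)
  change (symEquiv (φ.comp ι) r s).symm (symMap φ r (symEquiv ι r s ((br (R := R) g v).1 h))) = _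
  by_cases e : h * g ∈ KZ p f
  · obtain ⟨l, n, e'⟩ := (mem_KZ_iff _).1 e
    rw [br_apply_of_eq e', br_apply_of_eq e', of_smul_symMod, of_smul_symMod]
    exact congrArg (symEquiv (φ.comp ι) r s).symm (symMap_symRep φ ι r s l _)
  · rw [br_apply_of_notMem e, br_apply_of_notMem e, map_zero, map_zero, map_zero]

theorem adjugate_mul_heckeRep (z : Option (Fq p f)) :
    (heckeRep z).adjugate * heckeRep z = !![(p : Zq p f), 0; 0, (p : Zq p f)] := by
  rw [Matrix.adjugate_mul, det_heckeRep]
  ext i j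
  fin_cases i <;> fin_cases j <;> simp

/-- The Hecke operator on the functions `[g, v]`. -/
theorem heckeT_br (ι : Zq p f →+* R) (r : Fin f → ℕ) (s : ℕ) (g : G p f) (v : SymMod ι r s) :
    heckeT ι r s (br g v) = ∑ z : Option (Fq p f),
      br (g * heckeG z) (symModAct ι r s (heckeRep z).adjugate v) := by
  refine Subtype.ext (funext fun h => ?_)
  rw [AddSubmonoidClass.coe_finsetSum, Finset.sum_apply]
  change ∑ x : Option (Fq p f), symModAct ι r s (heckeRep x)
    ((br (R := R) g v).1 ((heckeG x)⁻¹ * h)) = _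
  have single : ∀ (x : Option (Fq p f)) (k : K p f) (n : ℤ), (heckeG x)⁻¹ * h * g = inclK k * scalarP p f ^ n →
      ∑ x : Option (Fq p f), symModAct ι r s (heckeRep x)
        ((br (R := R) g v).1 ((heckeG x)⁻¹ * h)) =
      symModAct ι r s (heckeRep x) (MonoidAlgebra.of R (K p f) k • v) := by
    intro x k n e
    rw [Finset.sum_eq_single x, br_apply_of_eq e]
    · intro x' _ hx'
      rw [br_apply_of_notMem, map_zero]
      intro e'
      refine hx' (heckeG_inj ?_)
      have := mul_mem e' (inv_mem ((mem_KZ_iff _).2 ⟨k, n, e⟩))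
      simpa [mul_assoc] using this
    · simp
  by_cases H : ∃ z, h * (g * heckeG z) ∈ KZ p f
  · obtain ⟨z, hz⟩ := H
    obtain ⟨k', n, e⟩ := (mem_KZ_iff _).1 hz
    rw [Finset.sum_eq_single (M := SymMod ι r s) (f := fun c =>
      (br (R := R) (g * heckeG c) (symModAct ι r s (heckeRep c).adjugate v)).1 h) z,
      br_apply_of_eq e]
    -- As `adj(y) y = p`, a factorization `k' adj(y_z) = y_x k` gives `y_x k y_z = p k'`. This `x`
    -- indexes the only nonzero summand on the left at `h`, and the same factorization matches the
    -- two values.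
    · obtain ⟨x, k, hx⟩ := exists_decomp
        ((k' : Matrix (Fin 2) (Fin 2) (Zq p f)) * (heckeRep z).adjugate)
        (Matrix.GeneralLinearGroup.det k') (by
          rw [Matrix.det_mul, Matrix.det_adjugate, det_heckeRep, mul_comm]; simp)
      have e1 : (heckeG x)⁻¹ * h * g = inclK k * scalarP p f ^ (n - 1) := by
        have e2 : heckeG x * inclK k * heckeG z = inclK k' * scalarP p f := by
          have e3 : heckeRep x * (k : Matrix (Fin 2) (Fin 2) (Zq p f)) * heckeRep z =
              (k' : Matrix (Fin 2) (Fin 2) (Zq p f)) * !![(p : Zq p f), 0; 0, (p : Zq p f)] := by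
            rw [← hx, mul_assoc, adjugate_mul_heckeRep]
          refine Units.ext ?_
          have := congrArg (fun m => m.map (algebraMap (Zq p f) (Qq p f))) e3
          simp only [Matrix.map_mul] at this
          exact this
        rw [mul_assoc, inv_mul_eq_iff_eq_mul]
        refine mul_right_cancel (b := heckeG z) ?_
        calc h * g * heckeG z = inclK k' * scalarP p f ^ n := by rw [mul_assoc, e]
          _ = inclK k' * scalarP p f * scalarP p f ^ (n - 1) := by
            rw [mul_assoc, ← zpow_one_add, add_sub_cancel]
          _ = heckeG x * (inclK k * scalarP p f ^ (n - 1)) * heckeG z := by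
            rw [← e2]
            simp only [mul_assoc, scalarP_zpow_comm]
      rw [single x k _ e1]
      have hd : (k : Matrix (Fin 2) (Fin 2) (Zq p f)).det =
          (k' : Matrix (Fin 2) (Fin 2) (Zq p f)).det := by
        have := congrArg Matrix.det hx
        rw [Matrix.det_mul, Matrix.det_mul, Matrix.det_adjugate, det_heckeRep, det_heckeRep,
          mul_comm] at this
        exact (mul_left_cancel₀ natCast_p_ne_zero (by simpa using this)).symm
      rw [of_smul_symMod, of_smul_symMod]
      have key : ∀ v : symSpace R r, symAct ι r (heckeRep x) (symRep ι r s k v) =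
          symRep ι r s k' (symAct ι r (heckeRep z).adjugate v) := by
        intro v
        change symAct ι r (heckeRep x) (ι _ ^ s • symAct ι r k v) =
          ι _ ^ s • symAct ι r k' (symAct ι r (heckeRep z).adjugate v)
        rw [map_smul, ← symAct_mul, ← symAct_mul, hx, hd]
      exact key v
    · intro z' _ hz'
      rw [br_apply_of_notMem]
      intro e'
      refine hz' (heckeG_inj ?_)
      have := mul_mem (inv_mem e') hz
      simpa [mul_assoc] using this
    · simp
  · rw [Finset.sum_eq_zero, Finset.sum_eq_zero]
    · intro z _
      exact br_apply_of_notMem (fun e => H ⟨z, e⟩) _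
    · intro x _
      rw [br_apply_of_notMem, map_zero]
      intro e
      obtain ⟨z, hz⟩ := exists_support x _ e
      exact H ⟨z, by simpa [mul_assoc] using hz⟩

end BrSym

/-! ### Polynomials as functions on `𝔽_q²` -/

section Eval

variable {k : Type*} [Field k]

/-- The value at a point of `𝔽_q²` of a polynomial, for `X_i = x ^ (p ^ i)`, `Y_i = y ^ (p ^ i)`. -/
def evPt (φ : Fq p f →+* k) (P : Fin 2 → Fq p f) : MvPolynomial (Fin f × Fin 2) k →ₐ[k] k :=
  aeval fun z => φ (P z.2) ^ p ^ (z.1 : ℕ)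

theorem constantCoeff_frobenius_pow (n : ℕ) (a : Zq p f) :
    WittVector.constantCoeff (((WittVector.frobenius : Zq p f →+* Zq p f) ^ n) a) =
      WittVector.constantCoeff a ^ p ^ n := by
  induction n with
  | zero => simp
  | succ n ih =>
    rw [pow_succ', RingHom.mul_def, RingHom.comp_apply]
    change (WittVector.frobenius _).coeff 0 = _
    rw [WittVector.coeff_frobenius_charP, pow_succ p, pow_mul, ← ih]
    rfl

theorem charP_of_ringHom (φ : Fq p f →+* k) : CharP k p :=
  (RingHom.charP_iff φ φ.injective p).1 inferInstance

/-- In characteristic `p` the power map `a ↦ a ^ (p ^ i)` is additive, so the Frobenius twist on the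
`i`-th factor is what evaluation at `x ^ (p ^ i)` produces. The columns of the matrix give the new
variables, so the point is a row vector. -/
theorem evPt_subst {ι : Zq p f →+* k} {φ : Fq p f →+* k}
    (hφ : ∀ a, ι a = φ (WittVector.constantCoeff a)) (P : Fin 2 → Fq p f)
    (m : Matrix (Fin 2) (Fin 2) (Zq p f)) (v : MvPolynomial (Fin f × Fin 2) k) :
    evPt φ P (subst ι m v) =
      evPt φ (Matrix.vecMul P (m.map WittVector.constantCoeff)) v := by
  have := charP_of_ringHom φ
  suffices h : (evPt φ P).comp (subst ι m) =
      evPt φ (Matrix.vecMul P (m.map WittVector.constantCoeff)) by rw [← h]; rfl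
  refine MvPolynomial.algHom_ext fun x => ?_
  simp only [AlgHom.comp_apply, subst, evPt, aeval_X, map_mul, algHom_C, Fin.sum_univ_two,
    Matrix.vecMul, dotProduct, Matrix.map_apply, map_add, add_pow_char_pow, hφ,
    constantCoeff_frobenius_pow, map_pow, mul_pow, Algebra.algebraMap_self, RingHom.id_apply]
  ring

theorem pow_card_Fq [NeZero f] (x : Fq p f) : x ^ p ^ f = x := by
  have := FiniteField.pow_card x
  rwa [Fintype.card_eq_nat_card, GaloisField.card p f (NeZero.ne f)] at this

theorem card_Fq [NeZero f] : Fintype.card (Fq p f) = p ^ f := by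
  rw [Fintype.card_eq_nat_card, GaloisField.card p f (NeZero.ne f)]

/-- For `i = 0` the index `i - 1` wraps around to `f - 1`, and `x ^ q = x` is used. -/
theorem pow_pow_sub_one [NeZero f] (x : Fq p f) (i : Fin f) :
    (x ^ p ^ ((i - 1 : Fin f) : ℕ)) ^ p = x ^ p ^ (i : ℕ) := by
  rw [← pow_mul, ← pow_succ]
  by_cases h : i = 0
  · subst h
    have h1 : ((0 - 1 : Fin f) : ℕ) + 1 = f := by
      obtain ⟨n, rfl⟩ := Nat.exists_eq_succ_of_ne_zero (NeZero.ne f)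
      rw [zero_sub, Fin.coe_neg_one]
    rw [h1, pow_card_Fq]
    simp
  · rw [Fin.val_sub_one_of_ne_zero h, Nat.sub_add_cancel]
    exact Nat.one_le_iff_ne_zero.2 (fun h' => h (Fin.ext (by simpa using h')))

theorem evPt_thetaPoly [NeZero f] (φ : Fq p f →+* k) (P : Fin 2 → Fq p f) (i : Fin f) :
    evPt φ P (thetaPoly p f k i) = 0 := by
  simp only [thetaPoly, evPt, map_sub, map_mul, map_pow, aeval_X]
  simp only [← map_pow, pow_pow_sub_one]
  ring

theorem evPt_eq_zero_of_mem [NeZero f] (φ : Fq p f →+* k) (P : Fin 2 → Fq p f)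
    {v : MvPolynomial (Fin f × Fin 2) k} (hv : v ∈ Ideal.span (Set.range (thetaPoly p f k))) :
    evPt φ P v = 0 := by
  have : Ideal.span (Set.range (thetaPoly p f k)) ≤ RingHom.ker (evPt φ P) := by
    rw [Ideal.span_le]
    rintro _ ⟨i, rfl⟩
    exact evPt_thetaPoly φ P i
  exact this hv

/-- `∑ d(i, l) p ^ i`. -/
def wt (p : ℕ) {f : ℕ} (d : Fin f × Fin 2 →₀ ℕ) (l : Fin 2) : ℕ := ∑ i : Fin f, d (i, l) * p ^ (i : ℕ)

theorem evPt_monomial (φ : Fq p f →+* k) (P : Fin 2 → Fq p f) (d : Fin f × Fin 2 →₀ ℕ) (c : k) :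
    evPt φ P (monomial d c) = c * (φ (P 0) ^ wt p d 0 * φ (P 1) ^ wt p d 1) := by
  rw [evPt, aeval_monomial, Finsupp.prod_fintype _ _ (by simp), Fintype.prod_prod_type]
  simp only [Fin.prod_univ_two, Finset.prod_mul_distrib, ← pow_mul, Finset.prod_pow_eq_pow_sum, wt,
    mul_comm (p ^ _)]
  rfl

theorem mem_symSpace_iff {R : Type*} [CommRing R] (r : Fin f → ℕ)
    (v : MvPolynomial (Fin f × Fin 2) R) :
    v ∈ symSpace R r ↔ ∀ d ∈ v.support, ∀ i, d (i, 0) + d (i, 1) = r i := by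
  have key : ∀ d : Fin f × Fin 2 →₀ ℕ,
      Finsupp.weight (fun x : Fin f × Fin 2 => (Pi.single x.1 1 : Fin f → ℕ)) d = r ↔
        ∀ i, d (i, 0) + d (i, 1) = r i := by
    intro d
    rw [Finsupp.weight_apply, Finsupp.sum_fintype _ _ (by simp), Fintype.sum_prod_type, funext_iff]
    refine forall_congr' fun i => ?_
    rw [Finset.sum_apply, Finset.sum_eq_single i]
    · simp
    · intro j _ hj
      simp [hj.symm]
    · simp
  simp only [← key]
  constructor
  · intro h d hd
    exact h (mem_support_iff.1 hd)
  · intro h d hd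
    exact h d (mem_support_iff.2 hd)

theorem monomial_mem_symSpace {R : Type*} [CommRing R] {r : Fin f → ℕ} {d : Fin f × Fin 2 →₀ ℕ}
    (hd : ∀ i, d (i, 0) + d (i, 1) = r i) (c : R) : monomial d c ∈ symSpace R r := by
  rw [mem_symSpace_iff]
  intro d' hd'
  rw [Finset.mem_singleton.1 (support_monomial_subset hd')]
  exact hd

open Fin.NatCast in
/-- Exchange of `X_i Y_{i-1}^p` and `Y_i X_{i-1}^p`. -/
theorem exists_reduced [NeZero f] {r : Fin f → ℕ} (hr : ∀ i, p ≤ r i) (d : Fin f × Fin 2 →₀ ℕ)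
    (hd : ∀ i, d (i, 0) + d (i, 1) = r i) :
    ∃ d' : Fin f × Fin 2 →₀ ℕ, (∀ i, d' (i, 0) + d' (i, 1) = r i) ∧
      ((∀ i, d' (i, 1) < p) ∨ ∀ i, d' (i, 0) = 0) ∧
      (monomial d 1 - monomial d' 1 : MvPolynomial (Fin f × Fin 2) k) ∈
        Ideal.span (Set.range (thetaPoly p f k)) := by
  classical
  induction hn : ∑ i, d (i, 1) using Nat.strong_induction_on generalizing d with
  | _ n ih =>
  -- Each exchange replaces `X_i Y_{i-1}^p` by `Y_i X_{i-1}^p` and lowers the total degree in the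
  -- `Y`s by `p - 1 > 0`.
  by_cases H : ∃ i, p ≤ d (i - 1, 1) ∧ 1 ≤ d (i, 0)
  · obtain ⟨i, h1, h2⟩ := H
    let s : Fin f × Fin 2 →₀ ℕ := Finsupp.single (i, 0) 1 + Finsupp.single (i - 1, 1) p
    let t : Fin f × Fin 2 →₀ ℕ := Finsupp.single (i, 1) 1 + Finsupp.single (i - 1, 0) p
    have hs : s ≤ d := by
      intro z
      obtain ⟨z1, z2⟩ := z
      fin_cases z2 <;> simp [s, Finsupp.single_apply, Prod.ext_iff] <;> split_ifs with h <;>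
        simp_all
    obtain ⟨c, rfl⟩ := exists_add_of_le hs
    have e0 : ∀ j, (c + t) (j, 0) = c (j, 0) + if i - 1 = j then p else 0 := by
      intro j; simp [t, Finsupp.single_apply, Prod.ext_iff]
    have e1 : ∀ j, (c + t) (j, 1) = c (j, 1) + if i = j then 1 else 0 := by
      intro j; simp [t, Finsupp.single_apply, Prod.ext_iff]
    have e0' : ∀ j, (s + c) (j, 0) = c (j, 0) + if i = j then 1 else 0 := by
      intro j; simp [s, Finsupp.single_apply, Prod.ext_iff, add_comm]
    have e1' : ∀ j, (s + c) (j, 1) = c (j, 1) + if i - 1 = j then p else 0 := by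
      intro j; simp [s, Finsupp.single_apply, Prod.ext_iff, add_comm]
    have hp := (Fact.out : p.Prime).two_le
    obtain ⟨d', hd1, hd2, hd3⟩ := ih (∑ j, (c + t) (j, 1)) (by
      rw [← hn]
      simp only [e1, e1', Finset.sum_add_distrib, Finset.sum_ite_eq, Finset.mem_univ, if_true]
      omega) (c + t) (fun j => by
      have := hd j
      rw [e0', e1'] at this
      rw [e0, e1]
      omega) rfl
    refine ⟨d', hd1, hd2, ?_⟩
    have : (monomial (s + c) 1 - monomial d' 1 : MvPolynomial (Fin f × Fin 2) k) =
        monomial c 1 * thetaPoly p f k i + (monomial (c + t) 1 - monomial d' 1) := by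
      have es : (monomial s 1 : MvPolynomial (Fin f × Fin 2) k) = X (i, 0) * X (i - 1, 1) ^ p := by
        rw [X, X_pow_eq_monomial, monomial_mul, mul_one]
      have et : (monomial t 1 : MvPolynomial (Fin f × Fin 2) k) = X (i, 1) * X (i - 1, 0) ^ p := by
        rw [X, X_pow_eq_monomial, monomial_mul, mul_one]
      rw [thetaPoly, ← es, ← et, mul_sub, monomial_mul, monomial_mul, mul_one, add_comm s c]
      ring
    rw [this]
    exact add_mem (Ideal.mul_mem_left _ _ (Ideal.subset_span ⟨i, rfl⟩)) hd3
  · refine ⟨d, hd, ?_, by simp⟩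
    push Not at H
    by_cases h : ∀ i, d (i, 1) < p
    · exact Or.inl h
    · push Not at h
      obtain ⟨i₀, hi₀⟩ := h
      have step : ∀ i, p ≤ d (i - 1, 1) → d (i, 0) = 0 := fun i hi => by
        have := H i hi; omega
      -- When no exchange is possible, a large exponent of `Y_{i-1}` forces `X_i` to be absent. Then
      -- `Y_i` has exponent `r_i ≥ p`, and the condition propagates around the cycle.
      have all : ∀ n : ℕ, p ≤ d (i₀ + (n : Fin f), 1) := by
        intro n
        induction n with
        | zero => simpa using hi₀
        | succ n ih =>
          have h0 := step (i₀ + (n : Fin f) + 1) (by rwa [add_sub_cancel_right])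
          have h1 := hd (i₀ + (n : Fin f) + 1)
          have h2 := hr (i₀ + (n : Fin f) + 1)
          rw [Nat.cast_succ, ← add_assoc]
          omega
      refine Or.inr fun i => step i ?_
      have := all (i - 1 - i₀ : Fin f)
      rwa [Fin.cast_val_eq_self, add_sub_cancel] at this

/-- The exponent of the monomial of multidegree `r` in which `Y_i` has as exponent the `i`-th
digit of `n` in base `p`. -/
def rep (p : ℕ) {f : ℕ} (r : Fin f → ℕ) (n : ℕ) : Fin f × Fin 2 →₀ ℕ :=
  Finsupp.equivFunOnFinite.symm fun z =>
    if z.2 = 0 then r z.1 - n / p ^ (z.1 : ℕ) % p else n / p ^ (z.1 : ℕ) % p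

/-- The exponent of `∏ Y_i ^ r_i`. -/
def repTop {f : ℕ} (r : Fin f → ℕ) : Fin f × Fin 2 →₀ ℕ :=
  Finsupp.equivFunOnFinite.symm fun z => if z.2 = 0 then 0 else r z.1

@[simp] theorem rep_zero (r : Fin f → ℕ) (n : ℕ) (i : Fin f) :
    rep p r n (i, 0) = r i - n / p ^ (i : ℕ) % p := rfl

@[simp] theorem rep_one (r : Fin f → ℕ) (n : ℕ) (i : Fin f) :
    rep p r n (i, 1) = n / p ^ (i : ℕ) % p := rfl

@[simp] theorem repTop_zero (r : Fin f → ℕ) (i : Fin f) : repTop r (i, 0) = 0 := rfl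

@[simp] theorem repTop_one (r : Fin f → ℕ) (i : Fin f) : repTop r (i, 1) = r i := rfl

theorem digit_sum {j : Fin f → ℕ} (hj : ∀ i, j i < p) :
    ∑ i, j i * p ^ (i : ℕ) < p ^ f ∧
      ∀ i : Fin f, (∑ l, j l * p ^ (l : ℕ)) / p ^ (i : ℕ) % p = j i := by
  let j' : Fin f → Fin p := fun i => ⟨j i, hj i⟩
  have h1 : ((finFunctionFinEquiv j' : Fin (p ^ f)) : ℕ) = ∑ i, j i * p ^ (i : ℕ) := by
    rw [finFunctionFinEquiv_apply]
  refine ⟨h1 ▸ (finFunctionFinEquiv j').2, fun i => ?_⟩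
  have h2 := finFunctionFinEquiv_symm_apply_val (finFunctionFinEquiv j') i
  rw [Equiv.symm_apply_apply, h1] at h2
  exact h2.symm

theorem sum_digits {n : ℕ} (hn : n < p ^ f) :
    ∑ i : Fin f, n / p ^ (i : ℕ) % p * p ^ (i : ℕ) = n := by
  have h := finFunctionFinEquiv_apply (finFunctionFinEquiv.symm (⟨n, hn⟩ : Fin (p ^ f)))
  rw [Equiv.apply_symm_apply] at h
  simp only [finFunctionFinEquiv_symm_apply_val] at h
  exact h.symm

theorem eq_rep_of_lt {r : Fin f → ℕ} {d : Fin f × Fin 2 →₀ ℕ}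
    (hd : ∀ i, d (i, 0) + d (i, 1) = r i) (h : ∀ i, d (i, 1) < p) :
    d = rep p r (wt p d 1) ∧ wt p d 1 < p ^ f := by
  obtain ⟨h1, h2⟩ := digit_sum h
  refine ⟨?_, h1⟩
  ext ⟨i, l⟩
  have := hd i
  have h3 := h2 i
  fin_cases l
  · change d (i, 0) = r i - (∑ l, d (l, 1) * p ^ (l : ℕ)) / p ^ (i : ℕ) % p
    rw [h3]; omega
  · exact h3.symm

theorem eq_repTop {r : Fin f → ℕ} {d : Fin f × Fin 2 →₀ ℕ}
    (hd : ∀ i, d (i, 0) + d (i, 1) = r i) (h : ∀ i, d (i, 0) = 0) : d = repTop r := by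
  ext ⟨i, l⟩
  have := hd i
  have := h i
  fin_cases l
  · exact h i
  · change d (i, 1) = r i
    omega

theorem rep_add {r : Fin f → ℕ} (hr : ∀ i, p ≤ r i) (n : ℕ) (i : Fin f) :
    rep p r n (i, 0) + rep p r n (i, 1) = r i := by
  have := Nat.mod_lt (n / p ^ (i : ℕ)) (Fact.out : p.Prime).pos
  have := hr i
  rw [rep_zero, rep_one]
  omega

theorem wt_rep_one (r : Fin f → ℕ) {n : ℕ} (hn : n < p ^ f) : wt p (rep p r n) 1 = n := sum_digits hn

theorem wt_add {r : Fin f → ℕ} {d : Fin f × Fin 2 →₀ ℕ} (hd : ∀ i, d (i, 0) + d (i, 1) = r i) :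
    wt p d 0 + wt p d 1 = ∑ i, r i * p ^ (i : ℕ) := by
  rw [wt, wt, ← Finset.sum_add_distrib]
  exact Finset.sum_congr rfl fun i _ => by rw [← hd, add_mul]

theorem wt_rep_zero_pos [NeZero f] {r : Fin f → ℕ} (hr : ∀ i, p ≤ r i) (n : ℕ) :
    0 < wt p (rep p r n) 0 := by
  have hp := (Fact.out : p.Prime).pos
  refine Finset.sum_pos (fun i _ => ?_) ⟨0, Finset.mem_univ _⟩
  have := Nat.mod_lt (n / p ^ (i : ℕ)) hp
  have := hr i
  rw [rep_zero]
  exact Nat.mul_pos (by omega) (by positivity)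

/-- Every polynomial of multidegree `r` is, modulo the `θ_i`, a combination of the monomials in
which all `Y_i` have exponent less than `p`, and of `∏ Y_i ^ r_i`. -/
theorem exists_normal_form [NeZero f] {r : Fin f → ℕ} (hr : ∀ i, p ≤ r i)
    (v : MvPolynomial (Fin f × Fin 2) k) (hv : v ∈ symSpace k r) :
    ∃ (c : ℕ → k) (c' : k), v - (∑ n ∈ Finset.range (p ^ f), monomial (rep p r n) (c n) +
      monomial (repTop r) c') ∈ Ideal.span (Set.range (thetaPoly p f k)) := by
  classical
  rw [mem_symSpace_iff] at hv
  let Pr : MvPolynomial (Fin f × Fin 2) k → Prop := fun v => ∃ (c : ℕ → k) (c' : k),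
    v - (∑ n ∈ Finset.range (p ^ f), monomial (rep p r n) (c n) +
      monomial (repTop r) c') ∈ Ideal.span (Set.range (thetaPoly p f k))
  change Pr v
  rw [v.as_sum]
  refine Finset.sum_induction _ Pr ?_ ⟨0, 0, by simp⟩ fun d hd => ?_
  · rintro v w ⟨c, c', h⟩ ⟨e, e', h'⟩
    refine ⟨c + e, c' + e', ?_⟩
    convert add_mem h h' using 1
    simp only [Pi.add_apply, map_add, Finset.sum_add_distrib]
    ring
  · obtain ⟨d', h1, h2, h3⟩ := exists_reduced (k := k) hr d (hv d hd)
    have h4 : monomial d (coeff d v) - monomial d' (coeff d v) ∈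
        Ideal.span (Set.range (thetaPoly p f k)) := by
      have := Ideal.mul_mem_left _ (C (coeff d v)) h3
      rwa [mul_sub, C_mul_monomial, C_mul_monomial, mul_one] at this
    rcases h2 with h2 | h2
    · obtain ⟨h5, h6⟩ := eq_rep_of_lt h1 h2
      refine ⟨Pi.single (wt p d' 1) (coeff d v), 0, ?_⟩
      rw [Finset.sum_eq_single (wt p d' 1)]
      · rwa [Pi.single_eq_same, ← h5, map_zero, add_zero]
      · intro n _ hn
        rw [Pi.single_eq_of_ne hn, map_zero]
      · intro h
        exact absurd (Finset.mem_range.2 h6) h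
    · refine ⟨0, coeff d v, ?_⟩
      rw [← eq_repTop h1 h2]
      simpa using h4

/-- A polynomial of degree less than `q` with `q` distinct roots is zero. -/
theorem eq_zero_of_forall_sum [NeZero f] (φ : Fq p f →+* k) (c : ℕ → k)
    (h : ∀ y, ∑ n ∈ Finset.range (p ^ f), c n * φ y ^ n = 0) (n : ℕ) (hn : n < p ^ f) : c n = 0 := by
  let P : Polynomial k := ∑ n ∈ Finset.range (p ^ f), Polynomial.monomial n (c n)
  have hP : P = 0 := by
    refine Polynomial.eq_zero_of_natDegree_lt_card_of_eval_eq_zero P φ.injective (fun y => ?_) ?_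
    · rw [← h y]
      simp [P, Polynomial.eval_finsetSum]
    · rw [card_Fq]
      refine lt_of_le_of_lt (Polynomial.natDegree_sum_le_of_forall_le (n := p ^ f - 1) _ _
        fun i hi => (Polynomial.natDegree_monomial_le _).trans ?_) ?_
      · have := Finset.mem_range.1 hi
        omega
      · have := hn
        omega
  have : P.coeff n = c n := by
    simp [P, Polynomial.coeff_monomial, hn]
  rw [← this, hP, Polynomial.coeff_zero]

/-- The polynomials of multidegree `r` vanishing on `𝔽_q²` are in the ideal of the `θ_i`. -/
theorem mem_span_of_evPt_eq_zero [NeZero f] (φ : Fq p f →+* k) {r : Fin f → ℕ}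
    (hr : ∀ i, p ≤ r i) (v : MvPolynomial (Fin f × Fin 2) k) (hv : v ∈ symSpace k r)
    (h : ∀ P, evPt φ P v = 0) : v ∈ Ideal.span (Set.range (thetaPoly p f k)) := by
  obtain ⟨c, c', hc⟩ := exists_normal_form hr v hv
  have h1 : ∀ P : Fin 2 → Fq p f, ∑ n ∈ Finset.range (p ^ f), c n *
      (φ (P 0) ^ wt p (rep p r n) 0 * φ (P 1) ^ wt p (rep p r n) 1) +
      c' * (φ (P 0) ^ wt p (repTop r) 0 * φ (P 1) ^ wt p (repTop r) 1) = 0 := by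
    intro P
    have := evPt_eq_zero_of_mem φ P hc
    rw [map_sub, h, zero_sub, neg_eq_zero, map_add, map_sum, evPt_monomial] at this
    simpa only [evPt_monomial] using this
  have ht : wt p (repTop r) 0 = 0 := by simp [wt]
  -- At the point `(0, 1)` only `∏ Y_i ^ r_i` survives, since `r_i ≥ p` leaves a positive power of
  -- `x` in every other monomial of the normal form.
  have hc' : c' = 0 := by
    have := h1 ![0, 1]
    rw [Finset.sum_eq_zero] at this
    · simpa [ht] using this
    · intro n _
      simp [(wt_rep_zero_pos (p := p) hr n).ne']
  have hcn : ∀ n < p ^ f, c n = 0 := by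
    refine eq_zero_of_forall_sum φ c fun y => ?_
    have := h1 ![1, y]
    rw [hc', zero_mul, add_zero] at this
    rw [← this]
    refine Finset.sum_congr rfl fun n hn => ?_
    rw [wt_rep_one r (Finset.mem_range.1 hn)]
    simp
  rw [hc', map_zero, add_zero, Finset.sum_eq_zero, sub_zero] at hc
  · exact hc
  · intro n hn
    rw [hcn n (Finset.mem_range.1 hn), map_zero]

/-! ### Power sums and the pairing with binary forms -/

theorem sum_eq_sum_units {R : Type*} [AddCommMonoid R] [DecidableEq (Fq p f)] (g : Fq p f → R) (hg : g 0 = 0) :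
    ∑ x, g x = ∑ u : (Fq p f)ˣ, g u := by
  rw [← Finset.sum_image (s := Finset.univ) (g := Units.val) (f := g) (Units.val_injective.injOn)]
  refine (Finset.sum_subset (Finset.subset_univ _) fun x _ hx => ?_).symm
  by_contra h
  have hx0 : x ≠ 0 := by rintro rfl; exact h hg
  exact hx (Finset.mem_image.2 ⟨Units.mk0 x hx0, Finset.mem_univ _, rfl⟩)

/-- For `n = 0` the convention `0 ^ 0 = 1` gives the sum `q = 0`; hence the condition `0 < n`. -/
theorem sum_pow_Fq [NeZero f] (φ : Fq p f →+* k) (n : ℕ) :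
    ∑ x : Fq p f, φ x ^ n = if 0 < n ∧ p ^ f - 1 ∣ n then -1 else 0 := by
  classical
  rcases Nat.eq_zero_or_pos n with rfl | hn
  · have := charP_of_ringHom φ
    simp [card_Fq, NeZero.ne f]
  · have h1 : ∑ x : Fq p f, φ x ^ n = φ (∑ x : (Fq p f)ˣ, (x : Fq p f) ^ n) := by
      rw [sum_eq_sum_units _ (by rw [map_zero, zero_pow hn.ne']), map_sum]
      simp
    have h2 := FiniteField.sum_pow_units (Fq p f) n
    rw [h1, h2, card_Fq]
    simp only [hn, true_and]
    split_ifs <;> simp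

/-- The pairing of a function on `𝔽_q²` with the form `x ^ (N - w) y ^ w`. -/
def pairing (φ : Fq p f →+* k) (N w : ℕ) : ((Fin 2 → Fq p f) → k) →ₗ[k] k where
  toFun F := ∑ P, φ (P 0) ^ (N - w) * φ (P 1) ^ w * F P
  map_add' F F' := by simp only [Pi.add_apply, mul_add, Finset.sum_add_distrib]
  map_smul' c F := by
    simp only [Pi.smul_apply, smul_eq_mul, Finset.mul_sum, RingHom.id_apply]
    exact Finset.sum_congr rfl fun P _ => by ring

/-- The function `x ^ a y ^ b` on `𝔽_q²`. -/
def mono (φ : Fq p f →+* k) (a b : ℕ) : (Fin 2 → Fq p f) → k := fun P => φ (P 0) ^ a * φ (P 1) ^ b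

theorem pairing_mono (φ : Fq p f →+* k) (N w a b : ℕ) :
    pairing φ N w (mono φ a b) = (∑ x, φ x ^ (N - w + a)) * ∑ y, φ y ^ (w + b) := by
  have := Finset.prod_univ_sum (fun _ : Fin 2 => (Finset.univ : Finset (Fq p f)))
    (fun (l : Fin 2) (x : Fq p f) => if l = 0 then φ x ^ (N - w + a) else φ x ^ (w + b))
  simp only [Fin.prod_univ_two, Fintype.piFinset_univ, if_true, one_ne_zero, if_false] at this
  rw [this]
  refine Finset.sum_congr rfl fun P _ => ?_
  simp only [mono]
  ring

/-- The functions orthogonal to all binary forms of degree `N`. -/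
def Ann (φ : Fq p f →+* k) (N : ℕ) : Submodule k ((Fin 2 → Fq p f) → k) :=
  ⨅ w ∈ Finset.range (N + 1), LinearMap.ker (pairing φ N w)

theorem mem_Ann (φ : Fq p f →+* k) (N : ℕ) (F : (Fin 2 → Fq p f) → k) :
    F ∈ Ann φ N ↔ ∀ w ≤ N, pairing φ N w F = 0 := by
  simp [Ann]

theorem binary_expand {R : Type*} [CommRing R] (a b c d x y : R) (i j : ℕ) :
    (a * x + c * y) ^ i * (b * x + d * y) ^ j =
      ∑ s ∈ Finset.range (i + 1), ∑ t ∈ Finset.range (j + 1),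
        ((i.choose s * j.choose t : ℕ) * (a ^ (i - s) * c ^ s * b ^ (j - t) * d ^ t)) *
          (x ^ (i + j - (s + t)) * y ^ (s + t)) := by
  rw [add_comm (a * x), add_comm (b * x), add_pow, add_pow, Finset.sum_mul_sum]
  refine Finset.sum_congr rfl fun s hs => Finset.sum_congr rfl fun t ht => ?_
  have hs' := Finset.mem_range.1 hs
  have ht' := Finset.mem_range.1 ht
  have : i + j - (s + t) = (i - s) + (j - t) := by omega
  rw [this, pow_add, pow_add, mul_pow, mul_pow, mul_pow, mul_pow]
  push_cast
  ring

/-- The action of a matrix on functions on `𝔽_q²`. -/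
def fnAct (k : Type*) [Field k] (m : Matrix (Fin 2) (Fin 2) (Fq p f)) :
    ((Fin 2 → Fq p f) → k) →ₗ[k] ((Fin 2 → Fq p f) → k) :=
  LinearMap.funLeft k k fun P => Matrix.vecMul P m

theorem fnAct_mono (φ : Fq p f →+* k) (m : Matrix (Fin 2) (Fin 2) (Fq p f)) (i j : ℕ) :
    fnAct k m (mono φ i j) = ∑ s ∈ Finset.range (i + 1), ∑ t ∈ Finset.range (j + 1),
        ((i.choose s * j.choose t : ℕ) * (φ (m 0 0) ^ (i - s) * φ (m 1 0) ^ s *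
          φ (m 0 1) ^ (j - t) * φ (m 1 1) ^ t)) • mono φ (i + j - (s + t)) (s + t) := by
  funext P
  simp only [fnAct, LinearMap.funLeft_apply, mono, Finset.sum_apply, Pi.smul_apply, smul_eq_mul]
  rw [← binary_expand]
  simp [Matrix.vecMul, dotProduct, Fin.sum_univ_two, mul_comm]

/-- The change of variable `P ↦ P m` moves the action onto the form, with the inverse matrix, and a
linear substitution preserves the forms of degree `N`. -/
theorem fnAct_mem_Ann (φ : Fq p f →+* k) (N : ℕ) (m : GL (Fin 2) (Fq p f))
    {F : (Fin 2 → Fq p f) → k} (hF : F ∈ Ann φ N) :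
    fnAct k (m : Matrix (Fin 2) (Fin 2) (Fq p f)) F ∈ Ann φ N := by
  rw [mem_Ann] at hF ⊢
  intro w hw
  let e : (Fin 2 → Fq p f) ≃ (Fin 2 → Fq p f) :=
    { toFun P := Matrix.vecMul P (m : Matrix (Fin 2) (Fin 2) (Fq p f))
      invFun P := Matrix.vecMul P ((m⁻¹ : GL (Fin 2) (Fq p f)) : Matrix (Fin 2) (Fin 2) (Fq p f))
      left_inv P := by
        beta_reduce
        rw [Matrix.vecMul_vecMul, ← Units.val_mul, mul_inv_cancel, Units.val_one, Matrix.vecMul_one]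
      right_inv P := by
        beta_reduce
        rw [Matrix.vecMul_vecMul, ← Units.val_mul, inv_mul_cancel, Units.val_one, Matrix.vecMul_one] }
  have h1 : pairing φ N w (fnAct k (m : Matrix (Fin 2) (Fin 2) (Fq p f)) F) =
      ∑ P, fnAct k ((m⁻¹ : GL (Fin 2) (Fq p f)) : Matrix (Fin 2) (Fin 2) (Fq p f))
        (mono φ (N - w) w) P * F P := by
    rw [← Equiv.sum_comp e]
    refine Finset.sum_congr rfl fun P _ => ?_
    change mono φ (N - w) w P * F (e P) = mono φ (N - w) w (e.symm (e P)) * F (e P)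
    rw [Equiv.symm_apply_apply]
  rw [h1, fnAct_mono]
  have h2 : ∀ s ≤ N - w, ∀ t ≤ w, ∀ c : k,
      ∑ P, (c • mono φ (N - w + w - (s + t)) (s + t)) P * F P = 0 := by
    intro s hs t ht c
    have := hF (s + t) (by omega)
    simp only [Pi.smul_apply, smul_eq_mul, mul_assoc]
    rw [← Finset.mul_sum, Nat.sub_add_cancel hw]
    exact mul_eq_zero_of_right c this
  simp only [Finset.sum_apply, Finset.sum_mul]
  rw [Finset.sum_comm]
  refine Finset.sum_eq_zero fun s hs => ?_
  rw [Finset.sum_comm]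
  refine Finset.sum_eq_zero fun t ht => ?_
  exact h2 s (Nat.lt_succ_iff.1 (Finset.mem_range.1 hs)) t (Nat.lt_succ_iff.1 (Finset.mem_range.1 ht)) _

/-! ### `Q` as a quotient of the space of functions -/

/-- The map from polynomials of multidegree `r` to functions on `𝔽_q²`. -/
def evFn (φ : Fq p f →+* k) (ι : Zq p f →+* k) (r : Fin f → ℕ) (s : ℕ) :
    SymMod ι r s →ₗ[k] ((Fin 2 → Fq p f) → k) where
  toFun v P := evPt φ P (symEquiv ι r s v : MvPolynomial (Fin f × Fin 2) k)
  map_add' v w := by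
    funext P
    simp
  map_smul' c v := by
    funext P
    simp

/-- The reduction of an element of `K`. -/
def redK : K p f →* GL (Fin 2) (Fq p f) := Matrix.GeneralLinearGroup.map WittVector.constantCoeff

theorem evFn_of_smul {φ : Fq p f →+* k} {ι : Zq p f →+* k}
    (hφ : ∀ a, ι a = φ (WittVector.constantCoeff a)) (r : Fin f → ℕ) (g : K p f)
    (v : SymMod ι r 0) :
    evFn φ ι r 0 (MonoidAlgebra.of k (K p f) g • v) = fnAct k (redK g).1 (evFn φ ι r 0 v) := by
  funext P
  rw [of_smul_symMod]
  have : (symRep ι r 0 g (symEquiv ι r 0 v)).1 = subst ι g (symEquiv ι r 0 v).1 := by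
    change (ι _ ^ 0 • symAct ι r g (symEquiv ι r 0 v)).1 = _
    rw [pow_zero, one_smul]
    rfl
  change evPt φ P (symRep ι r 0 g (symEquiv ι r 0 v)).1 = _
  rw [this, evPt_subst hφ]
  rfl

/-- A `k`-subspace stable under `K`, as a `k[K]`-submodule. -/
def submoduleOfStable {Γ M : Type*} [Group Γ] [AddCommGroup M] [Module k M] [Module k[Γ] M]
    [IsScalarTower k k[Γ] M] (S : Submodule k M)
    (hS : ∀ g : Γ, ∀ v ∈ S, MonoidAlgebra.of k Γ g • v ∈ S) : Submodule k[Γ] M where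
  toAddSubmonoid := S.toAddSubmonoid
  smul_mem' a v hv := by
    induction a using MonoidAlgebra.induction_on with
    | of g => exact hS g v hv
    | add a b ha hb => rw [add_smul]; exact S.add_mem ha hb
    | smul c a ha => rw [smul_assoc]; exact S.smul_mem c ha

/-- The exponents of `x` and `y` in the pairing add up to `q - 1`, so they cannot both be positive
multiples of `q - 1`, and one of the two power sums vanishes. -/
theorem mono_mem_Ann [NeZero f] (φ : Fq p f →+* k) {a₀ a b : ℕ} (ha₁ : 1 ≤ a₀)
    (hab : a + b = a₀) (haq : a₀ < p ^ f - 1) : mono φ a b ∈ Ann φ (p ^ f - 1 - a₀) := by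
  rw [mem_Ann]
  intro w hw
  rw [pairing_mono, sum_pow_Fq, sum_pow_Fq]
  by_contra h
  have h1 := left_ne_zero_of_mul h
  have h2 := right_ne_zero_of_mul h
  simp only [ne_eq, ite_eq_right_iff, Classical.not_imp] at h1 h2
  have := Nat.le_of_dvd h1.1.1 h1.1.2
  have := Nat.le_of_dvd h2.1.1 h2.1.2
  omega

theorem evFn_apply_of_eq_monomial {φ : Fq p f →+* k} {ι : Zq p f →+* k} {r : Fin f → ℕ} {s : ℕ}
    {v : SymMod ι r s} {d : Fin f × Fin 2 →₀ ℕ} {c : k}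
    (h : (symEquiv ι r s v : MvPolynomial (Fin f × Fin 2) k) = monomial d c) :
    evFn φ ι r s v = c • mono φ (wt p d 0) (wt p d 1) := by
  funext P
  change evPt φ P _ = _
  rw [h, evPt_monomial]
  rfl

/-- The exponents only matter modulo `q - 1`, as long as they are positive. -/
theorem pow_congr [NeZero f] {x : Fq p f} {a b : ℕ} (ha : 0 < a) (hb : 0 < b)
    (h : a ≡ b [MOD p ^ f - 1]) : x ^ a = x ^ b := by
  by_cases hx : x = 0
  · rw [hx, zero_pow ha.ne', zero_pow hb.ne']
  · have h1 : x ^ (p ^ f - 1) = 1 := by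
      have := FiniteField.pow_card_sub_one_eq_one x hx
      rwa [card_Fq] at this
    rw [← Nat.div_add_mod a (p ^ f - 1), ← Nat.div_add_mod b (p ^ f - 1), pow_add, pow_add,
      pow_mul, pow_mul, h1, one_pow, one_pow, h]

theorem mono_congr [NeZero f] (φ : Fq p f →+* k) {a b a' b' : ℕ}
    (ha : a = a' ∨ 0 < a ∧ 0 < a' ∧ a ≡ a' [MOD p ^ f - 1])
    (hb : b = b' ∨ 0 < b ∧ 0 < b' ∧ b ≡ b' [MOD p ^ f - 1]) :
    mono φ a b = mono φ a' b' := by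
  funext P
  have h : ∀ {a a' : ℕ}, (a = a' ∨ 0 < a ∧ 0 < a' ∧ a ≡ a' [MOD p ^ f - 1]) →
      ∀ x : Fq p f, φ x ^ a = φ x ^ a' := by
    rintro a a' (rfl | ⟨h1, h2, h3⟩) x
    · rfl
    · rw [← map_pow, pow_congr h1 h2 h3, map_pow]
  rw [mono, mono, h ha, h hb]

end Eval

/-! ### The submodule `V_r^* + X_r` in terms of functions -/

section Quot

variable {k : Type*} [Field k]

/-- A monomial of multidegree `r`, as an element of `⨂ Sym^{r_i}`. -/
def symMono {R : Type*} [CommRing R] (ι : Zq p f →+* R) {r : Fin f → ℕ} (s : ℕ)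
    {d : Fin f × Fin 2 →₀ ℕ} (hd : ∀ i, d (i, 0) + d (i, 1) = r i) (c : R) : SymMod ι r s :=
  (symEquiv ι r s).symm ⟨monomial d c, monomial_mem_symSpace hd c⟩

theorem eq_sum_symMono {R : Type*} [CommRing R] {ι : Zq p f →+* R} {r : Fin f → ℕ} {s : ℕ}
    (v : SymMod ι r s) :
    v = ∑ d ∈ (symEquiv ι r s v).1.support.attach,
      symMono ι s ((mem_symSpace_iff _ _).1 (symEquiv ι r s v).2 d.1 d.2)
        (coeff d.1 (symEquiv ι r s v).1) := by
  refine (symEquiv ι _ s).injective (Subtype.ext ?_)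
  rw [map_sum, AddSubmonoidClass.coe_finsetSum]
  conv_lhs => rw [(symEquiv ι _ s v).1.as_sum, ← Finset.sum_attach]
  rfl

theorem evFn_symMono (φ : Fq p f →+* k) (ι : Zq p f →+* k) {r : Fin f → ℕ} (s : ℕ)
    {d : Fin f × Fin 2 →₀ ℕ} (hd : ∀ i, d (i, 0) + d (i, 1) = r i) (c : k) :
    evFn φ ι r s (symMono ι s hd c) = c • mono φ (wt p d 0) (wt p d 1) :=
  evFn_apply_of_eq_monomial rfl

theorem mem_Vstar_of_evFn_eq_zero [NeZero f] (φ : Fq p f →+* k) (ι : Zq p f →+* k)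
    {r : Fin f → ℕ} (hr : ∀ i, p ≤ r i) {v : SymMod ι r 0} (hv : evFn φ ι r 0 v = 0) :
    v ∈ Vstar ι r :=
  Submodule.subset_span (mem_span_of_evPt_eq_zero φ hr _ (symEquiv ι r 0 v).2
    fun P => congrFun hv P)

/-- The exponent of `∏ X_i ^ r_i`. -/
def repBot {f : ℕ} (r : Fin f → ℕ) : Fin f × Fin 2 →₀ ℕ :=
  Finsupp.equivFunOnFinite.symm fun z => if z.2 = 0 then r z.1 else 0

@[simp] theorem repBot_zero (r : Fin f → ℕ) (i : Fin f) : repBot r (i, 0) = r i := rfl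

@[simp] theorem repBot_one (r : Fin f → ℕ) (i : Fin f) : repBot r (i, 1) = 0 := rfl

theorem repBot_add (r : Fin f → ℕ) (i : Fin f) : repBot r (i, 0) + repBot r (i, 1) = r i := rfl

theorem repTop_add (r : Fin f → ℕ) (i : Fin f) : repTop r (i, 0) + repTop r (i, 1) = r i :=
  Nat.zero_add _

theorem monomial_eq_prod {R : Type*} [CommRing R] (d : Fin f × Fin 2 →₀ ℕ) :
    (monomial d 1 : MvPolynomial (Fin f × Fin 2) R) =
      ∏ i, X (i, 0) ^ d (i, 0) * X (i, 1) ^ d (i, 1) := by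
  rw [monomial_eq, C_1, one_mul, Finsupp.prod_fintype _ _ (by simp), Fintype.prod_prod_type]
  simp only [Fin.prod_univ_two]

theorem monomial_repBot {R : Type*} [CommRing R] (r : Fin f → ℕ) :
    (monomial (repBot r) 1 : MvPolynomial (Fin f × Fin 2) R) = ∏ i, X (i, 0) ^ r i := by
  simp [monomial_eq_prod]

theorem monomial_repTop {R : Type*} [CommRing R] (r : Fin f → ℕ) :
    (monomial (repTop r) 1 : MvPolynomial (Fin f × Fin 2) R) = ∏ i, X (i, 1) ^ r i := by
  simp [monomial_eq_prod]

theorem symMono_repBot_mem_Xsub (ι : Zq p f →+* k) (r : Fin f → ℕ) :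
    symMono ι 0 (repBot_add r) 1 ∈ Xsub ι r :=
  Submodule.subset_span (monomial_repBot r)

variable (p f) in
/-- The lower unipotent matrix of `K`. -/
def lowerK (c : Zq p f) : K p f := Matrix.GeneralLinearGroup.mk'' !![1, 0; c, 1] (by simp)

variable (p f) in
/-- The upper unipotent matrix of `K`. -/
def upperK (c : Zq p f) : K p f := Matrix.GeneralLinearGroup.mk'' !![1, c; 0, 1] (by simp)

variable (p f) in
/-- The diagonal matrix `(1 0; 0 u)` of `K`. -/
def diagK (u : (Zq p f)ˣ) : K p f := Matrix.GeneralLinearGroup.mk'' !![1, 0; 0, (u : Zq p f)] (by simp)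

theorem redK_lowerK (c : Zq p f) :
    (redK (lowerK p f c)).1 = !![1, 0; WittVector.constantCoeff c, 1] := by
  change Matrix.map !![1, 0; c, 1] _ = _
  ext i j
  fin_cases i <;> fin_cases j <;> simp

theorem redK_upperK (c : Zq p f) :
    (redK (upperK p f c)).1 = !![1, WittVector.constantCoeff c; 0, 1] := by
  change Matrix.map !![1, c; 0, 1] _ = _
  ext i j
  fin_cases i <;> fin_cases j <;> simp

theorem redK_diagK (u : (Zq p f)ˣ) :
    (redK (diagK p f u)).1 = !![1, 0; 0, WittVector.constantCoeff (u : Zq p f)] := by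
  change Matrix.map !![1, 0; 0, (u : Zq p f)] _ = _
  ext i j
  fin_cases i <;> fin_cases j <;> simp

theorem constantCoeff_teichmuller (l : Fq p f) :
    WittVector.constantCoeff (WittVector.teichmuller p l) = l :=
  WittVector.teichmuller_coeff_zero p l

theorem fnAct_mono_apply (φ : Fq p f →+* k) (m : Matrix (Fin 2) (Fin 2) (Fq p f)) (a b : ℕ)
    (P : Fin 2 → Fq p f) : fnAct k m (mono φ a b) P =
      (φ (P 0) * φ (m 0 0) + φ (P 1) * φ (m 1 0)) ^ a *
        (φ (P 0) * φ (m 0 1) + φ (P 1) * φ (m 1 1)) ^ b := by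
  simp [fnAct, LinearMap.funLeft_apply, mono, Matrix.vecMul, dotProduct, Fin.sum_univ_two]

theorem p_lt_card (hp : 2 < p) (hf : 2 ≤ f) : 2 * p < p ^ f - 1 := by
  have : p ^ 2 ≤ p ^ f := Nat.pow_le_pow_right (by omega) hf
  have : 3 * p ≤ p ^ 2 := by nlinarith
  omega

theorem not_dvd_choose {n m : ℕ} (hn : n < p) (hm : m ≤ n) : ¬ p ∣ n.choose m := by
  intro h
  have h1 : p ∣ n.factorial := by
    rw [← Nat.choose_mul_factorial_mul_factorial hm, mul_assoc]
    exact h.mul_right _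
  exact absurd ((Fact.out : p.Prime).dvd_factorial.1 h1) (not_le.2 hn)

theorem modEq_sub_one {q n n' : ℕ} (h : n = n' + q) : n ≡ n' [MOD q] := by
  rw [h]; simp [Nat.ModEq]

variable [NeZero f] {φ : Fq p f →+* k} {ι : Zq p f →+* k} {r : Fin f → ℕ} {a₀ : ℕ}

/-- The lower unipotent of parameter `l` sends `x ^ a₀` to `(x + l y) ^ a₀`. Summing against `l ^ (q
- 1 - n)` extracts the coefficient of `l ^ n`, which is `-C(a₀, n) x ^ (a₀ - n) y ^ n` with `C(a₀,
n)` invertible as `a₀ < p`. -/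
theorem exists_mem_Xsub (hφ : ∀ a, ι a = φ (WittVector.constantCoeff a)) (hp : 2 < p) (hf : 2 ≤ f)
    (hr : ∀ i, p ^ f ≤ r i) (ha₁ : 1 ≤ a₀) (ha₂ : a₀ ≤ p - 1)
    (hra : ∑ i : Fin f, r i * p ^ (i : ℕ) ≡ a₀ [MOD p ^ f - 1]) {n : ℕ} (hn : n ≤ a₀) :
    ∃ u ∈ Xsub ι r, evFn φ ι r 0 u = mono φ (a₀ - n) n := by
  have hq := p_lt_card hp hf
  have := charP_of_ringHom φ
  have he : 0 < ∑ i : Fin f, r i * p ^ (i : ℕ) := by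
    refine Finset.sum_pos (fun i _ => ?_) ⟨0, Finset.mem_univ _⟩
    have := hr i
    exact Nat.mul_pos (by omega) (pow_pos (by omega) _)
  have hbot : evFn φ ι r 0 (symMono ι 0 (repBot_add r) 1) = mono φ a₀ 0 := by
    rw [evFn_symMono, one_smul]
    refine mono_congr φ (Or.inr ⟨he, ha₁, hra⟩) (Or.inl ?_)
    simp [wt]
  rcases Nat.eq_zero_or_pos n with rfl | hn0
  · exact ⟨_, symMono_repBot_mem_Xsub ι r, hbot⟩
  · have hc : ((a₀.choose n : ℕ) : k) ≠ 0 := by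
      rw [Ne, CharP.cast_eq_zero_iff k p]
      exact not_dvd_choose (by omega) hn
    refine ⟨-(a₀.choose n : k)⁻¹ • ∑ l : Fq p f, φ l ^ (p ^ f - 1 - n) •
      (MonoidAlgebra.of k (K p f) (lowerK p f (WittVector.teichmuller p l)) •
        symMono ι 0 (repBot_add r) 1), ?_, ?_⟩
    · refine Submodule.smul_of_tower_mem _ _ (Submodule.sum_mem _ fun l _ =>
        Submodule.smul_of_tower_mem _ _ (Submodule.smul_mem _ _ (symMono_repBot_mem_Xsub ι r)))
    · rw [map_smul, map_sum]
      simp only [map_smul, evFn_of_smul hφ, hbot]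
      funext P
      simp only [Pi.smul_apply, Finset.sum_apply, smul_eq_mul]
      have h1 : ∀ l : Fq p f, fnAct k (redK (lowerK p f (WittVector.teichmuller p l))).1
          (mono φ a₀ 0) P = ∑ s ∈ Finset.range (a₀ + 1),
            φ l ^ s * (a₀.choose s * (φ (P 0) ^ (a₀ - s) * φ (P 1) ^ s)) := by
        intro l
        have : fnAct k (redK (lowerK p f (WittVector.teichmuller p l))).1 (mono φ a₀ 0) P =
            (φ l * φ (P 1) + φ (P 0)) ^ a₀ := by
          rw [redK_lowerK, constantCoeff_teichmuller]
          rw [fnAct_mono_apply]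
          simp
          ring
        rw [this, add_pow]
        exact Finset.sum_congr rfl fun s _ => by ring
      simp only [h1, Finset.mul_sum]
      rw [Finset.sum_comm, Finset.sum_eq_single n]
      · simp only [← mul_assoc, ← pow_add, ← Finset.sum_mul]
        rw [← Finset.mul_sum, sum_pow_Fq, if_pos ⟨by omega, by
          rw [Nat.sub_add_cancel (by omega)]⟩, mono]
        field_simp
      · intro s hs hsn
        have hs' := Finset.mem_range.1 hs
        simp only [← mul_assoc, ← pow_add, ← Finset.sum_mul]
        rw [← Finset.mul_sum, sum_pow_Fq, if_neg, mul_zero, zero_mul, zero_mul, zero_mul]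
        rintro ⟨-, c, hc⟩
        rcases Nat.lt_or_ge c 2 with h | h
        · interval_cases c <;> omega
        · have : (p ^ f - 1) * 2 ≤ (p ^ f - 1) * c := Nat.mul_le_mul_left _ h
          omega
      · intro h
        exact absurd (Finset.mem_range.2 (by omega)) h

/-- The `y`-exponent `q - 1 - n₀ + n` lies below `2 (q - 1)`, so it is a positive multiple of `q -
1` only if `n = n₀`. In that case the `x`-exponent is such a multiple as well and both power sums
are `-1`. The forms of degree `q - 1 - a₀` are thus dual to the monomials with `a₀ ≤ n ≤ q - 1`. -/
theorem pairing_mono_eq (φ : Fq p f →+* k) (ha₁ : 1 ≤ a₀) (hq : a₀ < p ^ f - 1) {a n n₀ : ℕ}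
    (ha : 0 < a) (han : a + n ≡ a₀ [MOD p ^ f - 1]) (hn : n < p ^ f) (hn₀ : a₀ ≤ n₀)
    (hn₀' : n₀ ≤ p ^ f - 1) :
    pairing φ (p ^ f - 1 - a₀) (p ^ f - 1 - n₀) (mono φ a n) = if n = n₀ then 1 else 0 := by
  have e1 : p ^ f - 1 - a₀ - (p ^ f - 1 - n₀) = n₀ - a₀ := by omega
  rw [pairing_mono, sum_pow_Fq, sum_pow_Fq, e1]
  by_cases h : n = n₀
  · subst h
    have h1 : p ^ f - 1 ∣ n - a₀ + a := by
      rw [← Nat.modEq_zero_iff_dvd]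
      refine Nat.ModEq.add_right_cancel' a₀ ?_
      rw [zero_add]
      convert han using 1
      omega
    rw [if_pos ⟨by omega, h1⟩, if_pos ⟨by omega, by rw [Nat.sub_add_cancel hn₀']⟩, if_pos rfl]
    ring
  · rw [if_neg h]
    refine mul_eq_zero_of_right _ (if_neg ?_)
    rintro ⟨h0, c, hc⟩
    rcases Nat.lt_or_ge c 2 with h' | h'
    · interval_cases c <;> omega
    · have : (p ^ f - 1) * 2 ≤ (p ^ f - 1) * c := Nat.mul_le_mul_left _ h'
      omega

theorem evFn_of_mem_Vstar (hφ : ∀ a, ι a = φ (WittVector.constantCoeff a)) {v : SymMod ι r 0}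
    (hv : v ∈ Vstar ι r) : evFn φ ι r 0 v = 0 := by
  have : Vstar ι r ≤ submoduleOfStable (LinearMap.ker (evFn φ ι r 0)) fun g v hv => by
      rw [LinearMap.mem_ker] at hv ⊢
      rw [evFn_of_smul hφ, hv, map_zero] :=
    Submodule.span_le.2 fun v hv => funext fun P => evPt_eq_zero_of_mem φ P hv
  exact this hv

/-- In the normal form of a vector, the monomials with `n < a₀` and `∏ Y_i ^ r_i` evaluate to forms
of degree `a₀`, which come from `X_r`. The remaining coefficients are read off by the dual basis
`pairing_mono_eq`, so orthogonality forces them to vanish. -/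
theorem mem_sup_iff (hφ : ∀ a, ι a = φ (WittVector.constantCoeff a)) (hp : 2 < p) (hf : 2 ≤ f)
    (hr : ∀ i, p ^ f ≤ r i) (ha₁ : 1 ≤ a₀) (ha₂ : a₀ ≤ p - 1)
    (hra : ∑ i : Fin f, r i * p ^ (i : ℕ) ≡ a₀ [MOD p ^ f - 1]) (v : SymMod ι r 0) :
    v ∈ Vstar ι r ⊔ Xsub ι r ↔ evFn φ ι r 0 v ∈ Ann φ (p ^ f - 1 - a₀) := by
  have hq := p_lt_card hp hf
  have hr' : ∀ i, p ≤ r i := fun i => by have := hr i; omega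
  have he : 0 < ∑ i : Fin f, r i * p ^ (i : ℕ) := by
    refine Finset.sum_pos (fun i _ => ?_) ⟨0, Finset.mem_univ _⟩
    have := hr i
    exact Nat.mul_pos (by omega) (pow_pos (by omega) _)
  have hsum : ∀ {n}, n < p ^ f → wt p (rep p r n) 0 + n = ∑ i : Fin f, r i * p ^ (i : ℕ) := by
    intro n hn
    have := wt_add (p := p) (rep_add hr' n)
    rwa [wt_rep_one r hn] at this
  constructor
  · have : Vstar ι r ⊔ Xsub ι r ≤
        submoduleOfStable ((Ann φ (p ^ f - 1 - a₀)).comap (evFn φ ι r 0)) fun g v hv => by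
          rw [Submodule.mem_comap] at hv ⊢
          rw [evFn_of_smul hφ]
          exact fnAct_mem_Ann φ _ _ hv := by
      refine sup_le ?_ (Submodule.span_le.2 fun v hv => ?_)
      · intro v hv
        change evFn φ ι r 0 v ∈ Ann φ (p ^ f - 1 - a₀)
        rw [evFn_of_mem_Vstar hφ hv]
        exact Submodule.zero_mem _
      · change evFn φ ι r 0 v ∈ Ann φ (p ^ f - 1 - a₀)
        rw [evFn_apply_of_eq_monomial (d := repBot r) (c := 1) (by
          rw [monomial_repBot]; exact hv), one_smul,
          mono_congr φ (a := wt p (repBot r) 0) (a' := a₀) (b' := 0) (Or.inr ⟨he, ha₁, hra⟩)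
            (Or.inl (by simp [wt]))]
        exact mono_mem_Ann φ ha₁ rfl (by omega)
    exact fun hv => this hv
  · intro hv
    have hmem : ∀ (u : SymMod ι r 0) (c : k) (n : ℕ), n ≤ a₀ →
        evFn φ ι r 0 u = c • mono φ (a₀ - n) n → u ∈ Vstar ι r ⊔ Xsub ι r := by
      intro u c n hn hu
      obtain ⟨w, hw, hw'⟩ := exists_mem_Xsub hφ hp hf hr ha₁ ha₂ hra hn
      have h1 : u - c • w ∈ Vstar ι r :=
        mem_Vstar_of_evFn_eq_zero φ ι hr' (by rw [map_sub, map_smul, hw', hu, sub_self])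
      rw [← sub_add_cancel u (c • w)]
      exact Submodule.add_mem_sup h1 (Submodule.smul_of_tower_mem _ _ hw)
    obtain ⟨c, c', hc⟩ := exists_normal_form hr' (symEquiv ι r 0 v).1 (symEquiv ι r 0 v).2
    let w : SymMod ι r 0 := ∑ n ∈ Finset.range (p ^ f), symMono ι 0 (rep_add hr' n) (c n) +
      symMono ι 0 (repTop_add r) c'
    have hvw : v - w ∈ Vstar ι r := by
      refine Submodule.subset_span ?_
      convert hc using 1
      simp [w, symMono]
    have hrn : ∀ n < p ^ f, evFn φ ι r 0 (symMono ι 0 (rep_add hr' n) (c n)) =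
        c n • mono φ (wt p (rep p r n) 0) n := by
      intro n hn
      rw [evFn_symMono, wt_rep_one r hn]
    have htop : evFn φ ι r 0 (symMono ι 0 (repTop_add r) c') = c' • mono φ (a₀ - a₀) a₀ := by
      rw [evFn_symMono]
      congr 1
      exact mono_congr φ (Or.inl (by simp [wt])) (Or.inr ⟨by simpa [wt] using he, ha₁,
        by simpa [wt] using hra⟩)
    have hw : evFn φ ι r 0 w ∈ Ann φ (p ^ f - 1 - a₀) := by
      have := evFn_of_mem_Vstar hφ hvw
      rw [map_sub, sub_eq_zero] at this
      rwa [← this]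
    rw [← sub_add_cancel v w]
    refine Submodule.add_mem _ (Submodule.mem_sup_left hvw) (Submodule.add_mem _
      (Submodule.sum_mem _ fun n hn => ?_) (hmem _ c' a₀ le_rfl htop))
    have hn' := Finset.mem_range.1 hn
    rcases Nat.lt_or_ge n a₀ with h | h
    · refine hmem _ (c n) n h.le ?_
      rw [hrn n hn']
      congr 1
      refine mono_congr φ (Or.inr ⟨wt_rep_zero_pos hr' n, by omega, ?_⟩) (Or.inl rfl)
      refine Nat.ModEq.add_right_cancel' n ?_
      rwa [hsum hn', Nat.sub_add_cancel h.le]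
    · have hcn : c n = 0 := by
        have h1 := (mem_Ann φ _ _).1 hw (p ^ f - 1 - n) (by omega)
        rw [map_add, map_sum, map_add, map_sum, htop, map_smul,
          (mem_Ann φ _ _).1 (mono_mem_Ann φ ha₁ (Nat.sub_add_cancel le_rfl) (by omega)) _ (by omega),
          smul_zero, add_zero, Finset.sum_eq_single n, hrn n hn', map_smul,
          pairing_mono_eq φ ha₁ (by omega) (wt_rep_zero_pos hr' n) (by rwa [hsum hn']) hn' h (by omega),
          if_pos rfl] at h1
        · simpa using h1
        · intro m hm hmn
          have hm' := Finset.mem_range.1 hm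
          rw [hrn m hm', map_smul, pairing_mono_eq φ ha₁ (by omega) (wt_rep_zero_pos hr' m)
            (by rwa [hsum hm']) hm' h (by omega), if_neg hmn, smul_zero]
        · exact fun h => absurd hn h
      rw [hcn]
      convert Submodule.zero_mem _ using 1
      simp [symMono]

/-- A surjection from the space of functions on `𝔽_q²` whose kernel is the annihilator of the
forms of degree `q - 1 - a₀`. -/
structure IsQuot (φ : Fq p f →+* k) (a₀ : ℕ) {M : Type*} [AddCommGroup M] [Module k M]
    [Module k[K p f] M] (Λ : ((Fin 2 → Fq p f) → k) →ₗ[k] M) : Prop where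
  surj : Function.Surjective Λ
  ker : ∀ F, Λ F = 0 ↔ F ∈ Ann φ (p ^ f - 1 - a₀)
  equiv : ∀ (g : K p f) (F : (Fin 2 → Fq p f) → k),
    Λ (fnAct k (redK g).1 F) = MonoidAlgebra.of k (K p f) g • Λ F

theorem exists_linearMap_comp_eq {R A B C : Type*} [Ring R] [AddCommGroup A] [Module R A]
    [AddCommGroup B] [Module R B] [AddCommGroup C] [Module R C] (σ : A →ₗ[R] B) (g : A →ₗ[R] C)
    (hσ : Function.Surjective σ) (h : ∀ a, σ a = 0 → g a = 0) :
    ∃ Φ : B →ₗ[R] C, ∀ a, Φ (σ a) = g a := by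
  refine ⟨(LinearMap.ker σ).liftQ g (fun a ha => h a ha) ∘ₗ
    (σ.quotKerEquivOfSurjective hσ).symm.toLinearMap, fun a => ?_⟩
  have : (σ.quotKerEquivOfSurjective hσ).symm (σ a) = Submodule.Quotient.mk a := by
    rw [LinearEquiv.symm_apply_eq]
    rfl
  rw [LinearMap.comp_apply, LinearEquiv.coe_coe, this]
  rfl

/-- Evaluation need not be onto all functions, but it is onto modulo the annihilator:
`pairing_mono_eq` allows a polynomial with prescribed pairings to be written down. With
`mem_sup_iff`, functions modulo the annihilator then become `Q`. -/
theorem exists_isQuot (hφ : ∀ a, ι a = φ (WittVector.constantCoeff a)) (hp : 2 < p) (hf : 2 ≤ f)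
    (hr : ∀ i, p ^ f ≤ r i) (ha₁ : 1 ≤ a₀) (ha₂ : a₀ ≤ p - 1)
    (hra : ∑ i : Fin f, r i * p ^ (i : ℕ) ≡ a₀ [MOD p ^ f - 1]) :
    ∃ Λ : ((Fin 2 → Fq p f) → k) →ₗ[k] Qmod ι r, IsQuot φ a₀ Λ ∧
      ∀ v : SymMod ι r 0, Λ (evFn φ ι r 0 v) = Submodule.Quotient.mk v := by
  have hq := p_lt_card hp hf
  have hr' : ∀ i, p ≤ r i := fun i => by have := hr i; omega
  have hsum : ∀ {n}, n < p ^ f → wt p (rep p r n) 0 + n = ∑ i : Fin f, r i * p ^ (i : ℕ) := by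
    intro n hn
    have := wt_add (p := p) (rep_add hr' n)
    rwa [wt_rep_one r hn] at this
  have hsurj : ∀ F, ∃ v, F - evFn φ ι r 0 v ∈ Ann φ (p ^ f - 1 - a₀) := by
    intro F
    refine ⟨∑ n ∈ Finset.Icc a₀ (p ^ f - 1), symMono ι 0 (rep_add hr' n)
      (pairing φ (p ^ f - 1 - a₀) (p ^ f - 1 - n) F), ?_⟩
    rw [mem_Ann]
    intro w hw
    obtain ⟨m, hm1, hm2, rfl⟩ : ∃ m, a₀ ≤ m ∧ m ≤ p ^ f - 1 ∧ w = p ^ f - 1 - m :=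
      ⟨p ^ f - 1 - w, by omega, by omega, by omega⟩
    have hpair : ∀ n ∈ Finset.Icc a₀ (p ^ f - 1), pairing φ (p ^ f - 1 - a₀) (p ^ f - 1 - m)
        (evFn φ ι r 0 (symMono ι 0 (rep_add hr' n)
          (pairing φ (p ^ f - 1 - a₀) (p ^ f - 1 - n) F))) =
        if n = m then pairing φ (p ^ f - 1 - a₀) (p ^ f - 1 - n) F else 0 := by
      intro n hn
      have hn' := Finset.mem_Icc.1 hn
      rw [evFn_symMono, wt_rep_one r (by omega), map_smul, pairing_mono_eq φ ha₁ (by omega)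
        (wt_rep_zero_pos hr' n) (by rwa [hsum (by omega)]) (by omega) hm1 hm2]
      split_ifs <;> simp
    rw [map_sub, map_sum, map_sum, Finset.sum_congr rfl hpair, Finset.sum_ite_eq',
      if_pos (Finset.mem_Icc.2 ⟨hm1, hm2⟩), sub_self]
  have hsup := fun v => mem_sup_iff (v := v) hφ hp hf hr ha₁ ha₂ hra
  obtain ⟨Φ, hΦ⟩ := exists_linearMap_comp_eq
    ((Ann φ (p ^ f - 1 - a₀)).mkQ ∘ₗ evFn φ ι r 0)
    ((Vstar ι r ⊔ Xsub ι r).mkQ.restrictScalars k) (fun y => by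
      obtain ⟨F, rfl⟩ := Submodule.mkQ_surjective _ y
      obtain ⟨v, hv⟩ := hsurj F
      exact ⟨v, ((Submodule.Quotient.eq _).2 hv).symm⟩) (fun v hv => by
      refine (Submodule.Quotient.mk_eq_zero _).2 ((hsup v).2 ?_)
      exact (Submodule.Quotient.mk_eq_zero _).1 hv)
  have hΛ : ∀ v : SymMod ι r 0, (Φ ∘ₗ (Ann φ (p ^ f - 1 - a₀)).mkQ) (evFn φ ι r 0 v) =
      Submodule.Quotient.mk v := hΦ
  have hΛ' : ∀ F v, F - evFn φ ι r 0 v ∈ Ann φ (p ^ f - 1 - a₀) →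
      (Φ ∘ₗ (Ann φ (p ^ f - 1 - a₀)).mkQ) F = Submodule.Quotient.mk v := by
    intro F v hv
    rw [← hΛ, ← sub_eq_zero, ← map_sub, LinearMap.comp_apply, Submodule.mkQ_apply,
      (Submodule.Quotient.mk_eq_zero _).2 hv, map_zero]
  refine ⟨Φ ∘ₗ (Ann φ (p ^ f - 1 - a₀)).mkQ, ⟨fun x => ?_, fun F => ?_, fun g F => ?_⟩, hΛ⟩
  · obtain ⟨v, rfl⟩ := Submodule.Quotient.mk_surjective _ x
    exact ⟨_, hΛ v⟩
  · obtain ⟨v, hv⟩ := hsurj F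
    rw [hΛ' F v hv, Submodule.Quotient.mk_eq_zero, hsup]
    constructor
    · intro h
      simpa using add_mem hv h
    · intro h
      simpa using sub_mem h hv
  · obtain ⟨v, hv⟩ := hsurj F
    rw [hΛ' F v hv, hΛ' _ (MonoidAlgebra.of k (K p f) g • v)]
    · rfl
    · rw [evFn_of_smul hφ, ← map_sub]
      exact fnAct_mem_Ann φ _ _ hv

end Quot

/-! ### Binomial coefficients modulo `p` -/

/-- Lucas, grouped into the lowest `m` digits and the rest: the expansions for `n` and for `n % p ^
m` have the same digit factors. -/
theorem choose_modEq_pow (n t m : ℕ) :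
    (n.choose t : ℤ) ≡ ((n / p ^ m).choose (t / p ^ m) : ℤ) *
      ((n % p ^ m).choose (t % p ^ m) : ℤ) [ZMOD p] := by
  have h1 := Choose.choose_modEq_choose_mul_prod_range_choose (n := n) (k := t) (p := p) m
  have h2 := Choose.choose_modEq_choose_mul_prod_range_choose (n := n % p ^ m) (k := t % p ^ m)
    (p := p) m
  have hp : 0 < p ^ m := pow_pos (Fact.out : p.Prime).pos _
  rw [Nat.div_eq_of_lt (Nat.mod_lt _ hp), Nat.div_eq_of_lt (Nat.mod_lt _ hp), Nat.choose_self,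
    Nat.cast_one, one_mul] at h2
  refine h1.trans ((Int.ModEq.mul_left _ ?_))
  refine Int.ModEq.trans ?_ h2.symm
  refine congrArg (· % (p : ℤ)) ?_
  push_cast
  refine Finset.prod_congr rfl fun i hi => ?_
  have hi' := Finset.mem_range.1 hi
  have key : ∀ n : ℕ, n % p ^ m / p ^ i % p = n / p ^ i % p := by
    intro n
    have : p ^ m = p ^ i * p ^ (m - i) := by rw [← pow_add, Nat.add_sub_of_le hi'.le]
    rw [this, Nat.mod_mul_right_div_self, Nat.mod_mod_of_dvd _ (dvd_pow_self p (by omega))]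
  rw [key, key]

theorem dvd_choose_iff (n t m : ℕ) :
    p ∣ n.choose t ↔ p ∣ (n / p ^ m).choose (t / p ^ m) ∨ p ∣ (n % p ^ m).choose (t % p ^ m) := by
  rw [← (Fact.out : p.Prime).dvd_mul]
  have := (choose_modEq_pow (p := p) n t m).dvd_iff
  exact_mod_cast this

theorem mod_le_of_not_dvd_choose {n t : ℕ} (m : ℕ) (h : ¬ p ∣ n.choose t) :
    t % p ^ m ≤ n % p ^ m := by
  by_contra h'
  refine h ((dvd_choose_iff n t m).2 (Or.inr ?_))
  rw [Nat.choose_eq_zero_of_lt (not_le.1 h')]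
  exact dvd_zero p

/-- Consecutive entries of row `p ^ j - 1` add up to an inner entry of row `p ^ j`, which `p`
divides. Non-divisibility therefore propagates from `C(p ^ j - 1, 0) = 1`. -/
theorem not_dvd_choose_pow_sub_one (j : ℕ) {l : ℕ} (hl : l ≤ p ^ j - 1) :
    ¬ p ∣ (p ^ j - 1).choose l := by
  have hp : 0 < p ^ j := pow_pos (Fact.out : p.Prime).pos _
  induction l with
  | zero => simpa using (Fact.out : p.Prime).one_lt.ne'
  | succ l ih =>
    intro h
    refine ih (by omega) ?_
    have h1 : p ∣ (p ^ j).choose (l + 1) :=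
      (Fact.out : p.Prime).dvd_choose_pow (by omega) (by omega)
    have h2 : (p ^ j).choose (l + 1) = (p ^ j - 1).choose l + (p ^ j - 1).choose (l + 1) := by
      rw [← Nat.choose_succ_succ, Nat.succ_eq_add_one, Nat.sub_add_cancel hp]
    rw [h2] at h1
    exact (Nat.dvd_add_left h).1 h1

/-! ### The filtration on `Q` -/

/-- The smallest element of `{n | a₀ ≤ n, n % p ^ m < a₀}`. -/
def layerMin (p a₀ m : ℕ) : ℕ := if m = 0 then a₀ else p ^ m

/-- For `m > 0`, `C(n, p ^ m)` is congruent to `n / p ^ m`, and the hypotheses say that the digit of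
`n` at `p ^ m` is nonzero. For `m = 0` only the last digit of `n` matters, and it is at least `a₀`.
-/
theorem not_dvd_choose_layerMin {a₀ m n : ℕ} (h : n % p ^ m < a₀)
    (h' : a₀ ≤ n % p ^ (m + 1)) : ¬ p ∣ n.choose (layerMin p a₀ m) := by
  have hp := (Fact.out : p.Prime)
  rw [layerMin]
  split_ifs with hm
  · subst hm
    rw [zero_add, pow_one] at h'
    have h2 := Nat.mod_lt n hp.pos
    rw [dvd_choose_iff _ _ 1, pow_one, Nat.div_eq_of_lt (by omega : a₀ < p),
      Nat.mod_eq_of_lt (by omega : a₀ < p), Nat.choose_zero_right]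
    rintro (h | h)
    · exact hp.one_lt.ne' (Nat.dvd_one.1 h)
    · exact not_dvd_choose h2 h' h
  · have h0 : 0 < p ^ m := pow_pos hp.pos _
    rw [dvd_choose_iff _ _ m, Nat.div_self h0, Nat.mod_self, Nat.choose_zero_right,
      Nat.choose_one_right]
    rintro (h2 | h2)
    · rw [pow_succ, Nat.mod_mul, Nat.mod_eq_zero_of_dvd h2] at h'
      omega
    · exact hp.one_lt.ne' (Nat.dvd_one.1 h2)

theorem layerMin_le {a₀ m n : ℕ} (hn : a₀ ≤ n) (h : n % p ^ m < a₀) : layerMin p a₀ m ≤ n := by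
  rw [layerMin]
  split_ifs with hm
  · exact hn
  · by_contra h'
    rw [Nat.mod_eq_of_lt (not_le.1 h')] at h
    omega

theorem le_layerMin {a₀ m : ℕ} (ha₂ : a₀ ≤ p - 1) : a₀ ≤ layerMin p a₀ m := by
  rw [layerMin]
  split_ifs with hm
  · exact le_rfl
  · have := Nat.le_self_pow hm p
    omega

theorem layerMin_lt {a₀ m : ℕ} (ha₁ : 1 ≤ a₀) (ha₂ : a₀ ≤ p - 1) : layerMin p a₀ m < p ^ (m + 1) := by
  rw [layerMin]
  split_ifs with hm
  · subst hm
    rw [zero_add, pow_one]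
    omega
  · exact Nat.pow_lt_pow_right (Fact.out : p.Prime).one_lt (by omega)

theorem layerMin_mod {a₀ m : ℕ} (ha₁ : 1 ≤ a₀) : layerMin p a₀ m % p ^ m < a₀ := by
  rw [layerMin]
  split_ifs with hm
  · subst hm
    rw [pow_zero, Nat.mod_one]
    omega
  · rw [Nat.mod_self]
    omega

/-- For `m > 0` the number `q - 1 + a₀ - p ^ m` has residue `a₀ - 1` modulo `p ^ m` and all higher
digits equal to `p - 1`. The high part is handled by `not_dvd_choose_pow_sub_one`; the low part is
`C(a₀ - 1, n % p ^ m)` with `n % p ^ m ≤ a₀ - 1 < p`. -/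
theorem not_dvd_choose_sub_layerMin {a₀ m n : ℕ} (ha₁ : 1 ≤ a₀) (ha₂ : a₀ ≤ p - 1) (hm : m < f)
    (hn : a₀ ≤ n) (hn' : n ≤ p ^ f - 1) (h : n % p ^ m < a₀) :
    ¬ p ∣ (p ^ f - 1 + a₀ - layerMin p a₀ m).choose (n - layerMin p a₀ m) := by
  have hp := (Fact.out : p.Prime)
  have hle := layerMin_le hn h
  rw [layerMin] at hle ⊢
  split_ifs with hm0
  · rw [Nat.add_sub_cancel]
    exact not_dvd_choose_pow_sub_one f (by omega)
  · rw [if_neg hm0] at hle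
    have h0 : 0 < p ^ m := pow_pos hp.pos _
    have h1 : p ≤ p ^ m := Nat.le_self_pow hm0 p
    have e : p ^ f = p ^ m * p ^ (f - m) := by rw [← pow_add]; congr 1; omega
    have h2 : 0 < p ^ (f - m) := pow_pos hp.pos _
    have e1 : p ^ f - 1 + a₀ - p ^ m = (a₀ - 1) + p ^ m * (p ^ (f - m) - 1) := by
      have : p ^ m * 1 ≤ p ^ m * p ^ (f - m) := Nat.mul_le_mul_left _ h2
      rw [e, Nat.mul_sub, mul_one]
      omega
    rw [dvd_choose_iff _ _ m, e1, Nat.add_mul_div_left _ _ h0, Nat.add_mul_mod_self_left,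
      Nat.div_eq_of_lt (by omega : a₀ - 1 < p ^ m), Nat.mod_eq_of_lt (by omega : a₀ - 1 < p ^ m),
      zero_add]
    rintro (h3 | h3)
    · refine not_dvd_choose_pow_sub_one (f - m) ?_ h3
      have : n / p ^ m < p ^ (f - m) := by
        rw [Nat.div_lt_iff_lt_mul h0, mul_comm, ← e]
        omega
      have := Nat.div_le_div_right (c := p ^ m) (Nat.sub_le n (p ^ m))
      omega
    · refine not_dvd_choose (by omega) ?_ h3
      have : (n - p ^ m) % p ^ m = n % p ^ m := (Nat.mod_eq_sub_mod hle).symm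
      omega

section Filtration

variable {k : Type*} [Field k] [NeZero f]

/-- The coefficient of `x ^ (q - 1 + a₀ - n) y ^ n` of a function. -/
abbrev cf (φ : Fq p f →+* k) (a₀ n : ℕ) : ((Fin 2 → Fq p f) → k) →ₗ[k] k :=
  pairing φ (p ^ f - 1 - a₀) (p ^ f - 1 - n)

/-- The function `x ^ (q - 1 + a₀ - n) y ^ n`. -/
abbrev mn (φ : Fq p f →+* k) (a₀ n : ℕ) : (Fin 2 → Fq p f) → k := mono φ (p ^ f - 1 + a₀ - n) n

/-- Outside `a₀ ≤ n ≤ q - 1` one exponent can be lowered by `q - 1` and stay positive, which turns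
the function into a form of degree `a₀`. -/
theorem mn_mem_Ann (φ : Fq p f →+* k) {a₀ n : ℕ} (ha₁ : 1 ≤ a₀) (hq : a₀ < p ^ f - 1)
    (hn : n ≤ p ^ f - 1 + a₀) (h : n < a₀ ∨ p ^ f - 1 < n) :
    mn φ a₀ n ∈ Ann φ (p ^ f - 1 - a₀) := by
  rcases h with h | h
  · rw [mn, mono_congr φ (a' := a₀ - n) (b' := n)
      (Or.inr ⟨by omega, by omega, modEq_sub_one (by omega)⟩) (Or.inl rfl)]
    exact mono_mem_Ann φ ha₁ (by omega) hq
  · rw [mn, mono_congr φ (a' := p ^ f - 1 + a₀ - n) (b' := n - (p ^ f - 1))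
      (Or.inl rfl) (Or.inr ⟨by omega, by omega, modEq_sub_one (by omega)⟩)]
    exact mono_mem_Ann φ ha₁ (by omega) hq

theorem cf_mn (φ : Fq p f →+* k) {a₀ n n₀ : ℕ} (ha₁ : 1 ≤ a₀) (hq : a₀ < p ^ f - 1)
    (hn : n ≤ p ^ f - 1 + a₀) (hn₀ : a₀ ≤ n₀) (hn₀' : n₀ ≤ p ^ f - 1) :
    cf φ a₀ n₀ (mn φ a₀ n) = if n = n₀ then 1 else 0 := by
  by_cases h : p ^ f - 1 < n
  · rw [if_neg (by omega)]
    exact (mem_Ann φ _ _).1 (mn_mem_Ann φ ha₁ hq hn (Or.inr h)) _ (by omega)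
  · refine pairing_mono_eq φ ha₁ hq (by omega) ?_ (by omega) hn₀ hn₀'
    exact modEq_sub_one (by omega)

theorem sub_sum_mem_Ann (φ : Fq p f →+* k) {a₀ : ℕ} (ha₁ : 1 ≤ a₀) (hq : a₀ < p ^ f - 1)
    (F : (Fin 2 → Fq p f) → k) :
    F - ∑ n ∈ Finset.Icc a₀ (p ^ f - 1), cf φ a₀ n F • mn φ a₀ n ∈ Ann φ (p ^ f - 1 - a₀) := by
  rw [mem_Ann]
  intro w hw
  obtain ⟨m, hm1, hm2, rfl⟩ : ∃ m, a₀ ≤ m ∧ m ≤ p ^ f - 1 ∧ w = p ^ f - 1 - m :=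
    ⟨p ^ f - 1 - w, by omega, by omega, by omega⟩
  have hpair : ∀ n ∈ Finset.Icc a₀ (p ^ f - 1), cf φ a₀ m (cf φ a₀ n F • mn φ a₀ n) =
      if n = m then cf φ a₀ n F else 0 := by
    intro n hn
    have hn' := Finset.mem_Icc.1 hn
    rw [map_smul, cf_mn φ ha₁ hq (by omega) hm1 hm2]
    split_ifs <;> simp
  rw [map_sub, map_sum, Finset.sum_congr rfl hpair, Finset.sum_ite_eq',
    if_pos (Finset.mem_Icc.2 ⟨hm1, hm2⟩), sub_self]

/-- The functions whose coefficients are concentrated on `{n | n % p ^ m < a₀}`. -/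
def fnFil (φ : Fq p f →+* k) (a₀ m : ℕ) : Submodule k ((Fin 2 → Fq p f) → k) :=
  ⨅ n ∈ {n | n ∈ Finset.Icc a₀ (p ^ f - 1) ∧ a₀ ≤ n % p ^ m}, LinearMap.ker (cf φ a₀ n)

theorem mem_fnFil (φ : Fq p f →+* k) (a₀ m : ℕ) (F : (Fin 2 → Fq p f) → k) :
    F ∈ fnFil φ a₀ m ↔
      ∀ n ∈ Finset.Icc a₀ (p ^ f - 1), a₀ ≤ n % p ^ m → cf φ a₀ n F = 0 := by
  simp only [fnFil, Submodule.mem_iInf, Set.mem_ofPred_eq, LinearMap.mem_ker, and_imp]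

theorem Ann_le_fnFil (φ : Fq p f →+* k) (a₀ m : ℕ) :
    Ann φ (p ^ f - 1 - a₀) ≤ fnFil φ a₀ m := by
  intro F hF
  rw [mem_fnFil]
  intro n hn _
  have := Finset.mem_Icc.1 hn
  exact (mem_Ann φ _ _).1 hF _ (by omega)

theorem mn_mem_fnFil (φ : Fq p f →+* k) {a₀ n m : ℕ} (ha₁ : 1 ≤ a₀) (hq : a₀ < p ^ f - 1)
    (hn : n ≤ p ^ f - 1 + a₀) (h : n % p ^ m < a₀) : mn φ a₀ n ∈ fnFil φ a₀ m := by
  rw [mem_fnFil]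
  intro n₀ hn₀ h'
  have := Finset.mem_Icc.1 hn₀
  rw [cf_mn φ ha₁ hq hn this.1 this.2, if_neg]
  rintro rfl
  omega

/-- A substitution turns the monomial of index `n` into terms of index `s + t` with coefficients
`C(q - 1 + a₀ - n, s) C(n, t)`. By Lucas a nonzero coefficient forces the residues of `s` and `t`
modulo `p ^ m` to be at most `a₀ - 1 - n % p ^ m` and `n % p ^ m`, so `s + t` has residue at most
`a₀ - 1`. -/
theorem fnAct_mem_fnFil (φ : Fq p f →+* k) {a₀ m : ℕ} (ha₁ : 1 ≤ a₀) (ha₂ : a₀ ≤ p - 1)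
    (hq : a₀ < p ^ f - 1) (hm : m ≤ f) (g : GL (Fin 2) (Fq p f)) {F : (Fin 2 → Fq p f) → k}
    (hF : F ∈ fnFil φ a₀ m) : fnAct k g.1 F ∈ fnFil φ a₀ m := by
  have := charP_of_ringHom φ
  have h1 := Ann_le_fnFil φ a₀ m (fnAct_mem_Ann φ _ g (sub_sum_mem_Ann φ ha₁ hq F))
  rw [map_sub] at h1
  refine (Submodule.sub_mem_iff_left _ ?_).1 h1
  rw [map_sum]
  refine Submodule.sum_mem _ fun n hn => ?_
  have hn' := Finset.mem_Icc.1 hn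
  rw [map_smul]
  rcases Nat.lt_or_ge (n % p ^ m) a₀ with h | h
  · refine Submodule.smul_mem _ _ ?_
    rw [mn, fnAct_mono]
    refine Submodule.sum_mem _ fun s hs => Submodule.sum_mem _ fun t ht => ?_
    have hs' := Finset.mem_range.1 hs
    have ht' := Finset.mem_range.1 ht
    by_cases hc : p ∣ (p ^ f - 1 + a₀ - n).choose s * n.choose t
    · rw [(CharP.cast_eq_zero_iff k p _).2 hc, zero_mul, zero_smul]
      exact Submodule.zero_mem _
    · refine Submodule.smul_mem _ _ ?_
      rw [show p ^ f - 1 + a₀ - n + n - (s + t) = p ^ f - 1 + a₀ - (s + t) by omega]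
      refine mn_mem_fnFil φ ha₁ hq (by omega) ?_
      by_contra hc'
      have h2 := mod_le_of_not_dvd_choose m (fun h => hc (h.mul_right _))
      have h3 := mod_le_of_not_dvd_choose m (fun h => hc (h.mul_left _))
      -- Here `p ^ m ∣ q`, and there is no borrow since `n % p ^ m ≤ a₀ - 1`. The case `m = 0` is
      -- void because every residue is then `0 < a₀`.
      have h4 : (p ^ f - 1 + a₀ - n) % p ^ m = a₀ - 1 - n % p ^ m := by
        have hm0 : m ≠ 0 := fun h0 => hc' (by
          rw [h0, pow_zero, Nat.mod_one]
          omega)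
        have h0 : 0 < p ^ m := pow_pos (Fact.out : p.Prime).pos _
        have e : p ^ f = p ^ m * p ^ (f - m) := by rw [← pow_add, Nat.add_sub_of_le hm]
        have e1 : n / p ^ m ≤ p ^ (f - m) := by
          rw [Nat.div_le_iff_le_mul h0, mul_comm, ← e]
          omega
        have e2 := Nat.div_add_mod n (p ^ m)
        have e3 := Nat.mul_le_mul_left (p ^ m) e1
        have e4 : p ^ f - 1 + a₀ - n =
            (a₀ - 1 - n % p ^ m) + p ^ m * (p ^ (f - m) - n / p ^ m) := by
          rw [Nat.mul_sub, ← e]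
          omega
        have := Nat.le_self_pow hm0 p
        rw [e4, Nat.add_mul_mod_self_left,
          Nat.mod_eq_of_lt ((Nat.sub_le _ _).trans_lt (by omega))]
      have h5 := Nat.add_mod s t (p ^ m)
      have h6 := Nat.mod_le (s % p ^ m + t % p ^ m) (p ^ m)
      omega
  · rw [(mem_fnFil φ _ _ _).1 hF n hn h, zero_smul]
    exact Submodule.zero_mem _

variable {φ : Fq p f →+* k} {a₀ : ℕ} {M : Type*} [AddCommGroup M] [Module k M]
  [Module k[K p f] M] [IsScalarTower k k[K p f] M] {Λ : ((Fin 2 → Fq p f) → k) →ₗ[k] M}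

theorem IsQuot.eq_sum (hΛ : IsQuot φ a₀ Λ) (ha₁ : 1 ≤ a₀) (hq : a₀ < p ^ f - 1)
    (F : (Fin 2 → Fq p f) → k) :
    Λ F = ∑ n ∈ Finset.Icc a₀ (p ^ f - 1), cf φ a₀ n F • Λ (mn φ a₀ n) := by
  have := (hΛ.ker _).2 (sub_sum_mem_Ann φ ha₁ hq F)
  rw [map_sub, sub_eq_zero, map_sum] at this
  simpa only [map_smul] using this

/-- The image of `fnFil`, as a submodule. -/
def IsQuot.fil (hΛ : IsQuot φ a₀ Λ) (ha₁ : 1 ≤ a₀) (ha₂ : a₀ ≤ p - 1) (hq : a₀ < p ^ f - 1)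
    (m : ℕ) (hm : m ≤ f) : Submodule k[K p f] M :=
  submoduleOfStable ((fnFil φ a₀ m).map Λ) fun g v hv => by
    obtain ⟨F, hF, rfl⟩ := hv
    exact ⟨_, fnAct_mem_fnFil φ ha₁ ha₂ hq hm (redK g) hF, hΛ.equiv g F⟩

theorem IsQuot.mem_fil (hΛ : IsQuot φ a₀ Λ) (ha₁ : 1 ≤ a₀) (ha₂ : a₀ ≤ p - 1)
    (hq : a₀ < p ^ f - 1) {m : ℕ} (hm : m ≤ f) (F : (Fin 2 → Fq p f) → k) :
    Λ F ∈ hΛ.fil ha₁ ha₂ hq m hm ↔ F ∈ fnFil φ a₀ m := by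
  constructor
  · rintro ⟨F', hF', h⟩
    have h1 : F' - F ∈ Ann φ (p ^ f - 1 - a₀) := by
      rw [← hΛ.ker, map_sub, h, sub_self]
    exact (Submodule.sub_mem_iff_right _ hF').1 (Ann_le_fnFil φ a₀ m h1)
  · exact fun h => ⟨F, h, rfl⟩

variable (p f) in
/-- The diagonal matrix `(1 0; 0 [u])`. -/
def torK (u : (Fq p f)ˣ) : K p f := diagK p f (Units.map (WittVector.teichmuller p) u)

open Classical in
/-- The projector to the part of a representation on which `(1 0; 0 [u])` acts by `u ^ n`. -/
def torPr (φ : Fq p f →+* k) (n : ℕ) : k[K p f] :=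
  -∑ u : (Fq p f)ˣ, φ u ^ (p ^ f - 1 - n) • MonoidAlgebra.of k (K p f) (torK p f u)

/-- Orthogonality of the characters of `𝔽_q^×`; the sum over units is `-1` when the characters
match, whence the sign in `torPr`. -/
theorem torPr_smul (φ : Fq p f →+* k) {n m : ℕ} (hm : 0 < m)
    {v : M}
    (hv : ∀ u : (Fq p f)ˣ, MonoidAlgebra.of k (K p f) (torK p f u) • v = φ u ^ m • v) :
    torPr φ n • v = if p ^ f - 1 ∣ p ^ f - 1 - n + m then v else 0 := by
  classical
  have h1 : ∑ u : (Fq p f)ˣ, φ u ^ (p ^ f - 1 - n) * φ u ^ m =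
      if p ^ f - 1 ∣ p ^ f - 1 - n + m then (-1 : k) else 0 := by
    have h2 := sum_pow_Fq φ (p ^ f - 1 - n + m)
    rw [sum_eq_sum_units _ (by rw [map_zero, zero_pow (by omega)])] at h2
    simp only [pow_add] at h2
    rw [h2]
    simp [hm]
  have h3 : torPr φ n • v = -∑ u : (Fq p f)ˣ, (φ u ^ (p ^ f - 1 - n) * φ u ^ m) • v := by
    rw [torPr, neg_smul, Finset.sum_smul]
    congr 1
    refine Finset.sum_congr (by congr!) fun u _ => ?_
    rw [smul_assoc, hv, smul_smul]
  rw [h3, ← Finset.sum_smul, h1]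
  split_ifs <;> simp

theorem IsQuot.torK_smul (hΛ : IsQuot φ a₀ Λ) (u : (Fq p f)ˣ) (m : ℕ) :
    MonoidAlgebra.of k (K p f) (torK p f u) • Λ (mn φ a₀ m) = φ u ^ m • Λ (mn φ a₀ m) := by
  rw [← hΛ.equiv, ← map_smul]
  congr 1
  funext P
  rw [fnAct_mono_apply, torK, redK_diagK]
  simp [mono, WittVector.teichmuller_coeff_zero, mul_pow]
  ring

/-- The torus separates the monomials. -/
theorem IsQuot.torPr_smul (hΛ : IsQuot φ a₀ Λ) (ha₁ : 1 ≤ a₀) (hq : a₀ < p ^ f - 1)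
    (F : (Fin 2 → Fq p f) → k) {n : ℕ} (hn : n ∈ Finset.Icc a₀ (p ^ f - 1)) :
    torPr φ n • Λ F = cf φ a₀ n F • Λ (mn φ a₀ n) := by
  have hn' := Finset.mem_Icc.1 hn
  rw [hΛ.eq_sum ha₁ hq F, Finset.smul_sum, Finset.sum_eq_single n]
  · have : p ^ f - 1 ∣ p ^ f - 1 - n + n := by rw [Nat.sub_add_cancel hn'.2]
    rw [smul_comm, HeckeRed.torPr_smul φ (by omega) fun u => hΛ.torK_smul u n,
      if_pos this]
  · intro m hm hmn
    have hm' := Finset.mem_Icc.1 hm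
    rw [smul_comm, HeckeRed.torPr_smul φ (by omega) fun u => hΛ.torK_smul u m,
      if_neg, smul_zero]
    rintro ⟨c, hc⟩
    rcases Nat.lt_or_ge c 2 with h | h
    · interval_cases c <;> omega
    · have : (p ^ f - 1) * 2 ≤ (p ^ f - 1) * c := Nat.mul_le_mul_left _ h
      omega
  · exact fun h => absurd hn h

theorem IsQuot.smul_mem (hΛ : IsQuot φ a₀ Λ) (ha₁ : 1 ≤ a₀) (hq : a₀ < p ^ f - 1)
    (S : Submodule k[K p f] M) {F : (Fin 2 → Fq p f) → k} (hF : Λ F ∈ S) {n : ℕ}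
    (hn : n ∈ Finset.Icc a₀ (p ^ f - 1)) : cf φ a₀ n F • Λ (mn φ a₀ n) ∈ S := by
  rw [← hΛ.torPr_smul ha₁ hq F hn]
  exact S.smul_mem _ hF

/-- The upper unipotent replaces `y` by `x + y`, so index `n₀` appears with coefficient `C(n, n₀)`,
and the torus projector isolates it. -/
theorem IsQuot.mn_mem_of_down (hΛ : IsQuot φ a₀ Λ) (ha₁ : 1 ≤ a₀) (hq : a₀ < p ^ f - 1)
    (S : Submodule k[K p f] M) {n n₀ : ℕ} (hn : n ≤ p ^ f - 1) (hS : Λ (mn φ a₀ n) ∈ S)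
    (hn₀ : a₀ ≤ n₀) (hle : n₀ ≤ n) (hc : ¬ p ∣ n.choose n₀) : Λ (mn φ a₀ n₀) ∈ S := by
  have := charP_of_ringHom φ
  have h1 := S.smul_mem (MonoidAlgebra.of k (K p f) (upperK p f 1)) hS
  rw [← hΛ.equiv] at h1
  have h2 := hΛ.smul_mem ha₁ hq S h1 (Finset.mem_Icc.2 ⟨hn₀, hle.trans hn⟩)
  have h3 : fnAct k (redK (upperK p f 1)).1 (mn φ a₀ n) =
      ∑ t ∈ Finset.range (n + 1), (n.choose t : k) • mn φ a₀ t := by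
    funext P
    rw [fnAct_mono_apply, redK_upperK]
    simp only [Finset.sum_apply, Pi.smul_apply, mono, smul_eq_mul]
    simp
    rw [add_comm (φ (P 0)), add_pow, Finset.mul_sum]
    refine Finset.sum_congr rfl fun t ht => ?_
    have ht' := Finset.mem_range.1 ht
    have : p ^ f - 1 + a₀ - t = (p ^ f - 1 + a₀ - n) + (n - t) := by omega
    rw [this, pow_add]
    ring
  rw [h3, map_sum, Finset.sum_eq_single n₀, map_smul, cf_mn φ ha₁ hq (by omega) hn₀ (by omega),
    if_pos rfl, smul_eq_mul, mul_one] at h2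
  · have h4 : (n.choose n₀ : k) ≠ 0 := by rwa [Ne, CharP.cast_eq_zero_iff k p]
    have := Submodule.smul_of_tower_mem S (n.choose n₀ : k)⁻¹ h2
    rwa [smul_smul, inv_mul_cancel₀ h4, one_smul] at this
  · intro t ht htn
    have ht' := Finset.mem_range.1 ht
    rw [map_smul, cf_mn φ ha₁ hq (by omega) hn₀ (by omega), if_neg htn, smul_zero]
  · intro h
    exact absurd (Finset.mem_range.2 (by omega)) h

/-- The lower unipotent replaces `x` by `x + y`; index `n₀` appears with coefficient `C(q - 1 + a₀ -
n, n₀ - n)` and is isolated by the torus. -/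
theorem IsQuot.mn_mem_of_up (hΛ : IsQuot φ a₀ Λ) (ha₁ : 1 ≤ a₀) (hq : a₀ < p ^ f - 1)
    (S : Submodule k[K p f] M) {n n₀ : ℕ} (hn : a₀ ≤ n) (hS : Λ (mn φ a₀ n) ∈ S)
    (hn₀ : n₀ ≤ p ^ f - 1) (hle : n ≤ n₀) (hc : ¬ p ∣ (p ^ f - 1 + a₀ - n).choose (n₀ - n)) :
    Λ (mn φ a₀ n₀) ∈ S := by
  have := charP_of_ringHom φ
  have h1 := S.smul_mem (MonoidAlgebra.of k (K p f) (lowerK p f 1)) hS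
  rw [← hΛ.equiv] at h1
  have h2 := hΛ.smul_mem ha₁ hq S h1 (Finset.mem_Icc.2 ⟨hn.trans hle, hn₀⟩)
  have h3 : fnAct k (redK (lowerK p f 1)).1 (mn φ a₀ n) =
      ∑ t ∈ Finset.range (p ^ f - 1 + a₀ - n + 1),
        ((p ^ f - 1 + a₀ - n).choose t : k) • mn φ a₀ (n + t) := by
    funext P
    rw [fnAct_mono_apply, redK_lowerK]
    simp only [Finset.sum_apply, Pi.smul_apply, mono, smul_eq_mul]
    simp
    rw [add_comm (φ (P 0)), add_pow, Finset.sum_mul]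
    refine Finset.sum_congr rfl fun t ht => ?_
    have ht' := Finset.mem_range.1 ht
    have : p ^ f - 1 + a₀ - n - t = p ^ f - 1 + a₀ - (n + t) := by omega
    rw [this, pow_add]
    ring
  rw [h3, map_sum, Finset.sum_eq_single (n₀ - n), map_smul, Nat.add_sub_of_le hle,
    cf_mn φ ha₁ hq (by omega) (by omega) hn₀, if_pos rfl, smul_eq_mul, mul_one] at h2
  · have h4 : ((p ^ f - 1 + a₀ - n).choose (n₀ - n) : k) ≠ 0 := by
      rwa [Ne, CharP.cast_eq_zero_iff k p]
    have := Submodule.smul_of_tower_mem S ((p ^ f - 1 + a₀ - n).choose (n₀ - n) : k)⁻¹ h2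
    rwa [smul_smul, inv_mul_cancel₀ h4, one_smul] at this
  · intro t ht htn
    have ht' := Finset.mem_range.1 ht
    rw [map_smul, cf_mn φ ha₁ hq (by omega) (by omega) hn₀, if_neg (by omega), smul_zero]
  · intro h
    exact absurd (Finset.mem_range.2 (by omega)) h

/-- This is the uniseriality of `M`. An element outside step `m + 1` yields a basis vector of some
index `n` in `S`. The upper unipotent leads from it down to the lowest index of its layer, and the
lower unipotent leads from there up to every index of step `m`. -/
theorem IsQuot.fil_le (hΛ : IsQuot φ a₀ Λ) (ha₁ : 1 ≤ a₀) (ha₂ : a₀ ≤ p - 1)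
    (hq : a₀ < p ^ f - 1) (S : Submodule k[K p f] M) {m : ℕ} (hm : m + 1 ≤ f) {x : M} (hx : x ∈ S)
    (hx' : x ∉ hΛ.fil ha₁ ha₂ hq (m + 1) hm) :
    hΛ.fil ha₁ ha₂ hq m (Nat.le_of_succ_le hm) ≤ S := by
  obtain ⟨F, rfl⟩ := hΛ.surj x
  rw [hΛ.mem_fil, mem_fnFil] at hx'
  push Not at hx'
  obtain ⟨n, hn, h1, h2⟩ := hx'
  have hn' := Finset.mem_Icc.1 hn
  have h3 : Λ (mn φ a₀ n) ∈ S := by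
    have := Submodule.smul_of_tower_mem S (cf φ a₀ n F)⁻¹ (hΛ.smul_mem ha₁ hq S hx hn)
    rwa [smul_smul, inv_mul_cancel₀ h2, one_smul] at this
  classical
  have hex : ∃ i, a₀ ≤ n % p ^ i := ⟨m + 1, h1⟩
  -- The layer of `n`: the last level before `n % p ^ i` first reaches `a₀`. It may be smaller than
  -- `m`, which only makes the resulting step larger.
  obtain ⟨i, hi, hi1, hi2⟩ : ∃ i ≤ m, n % p ^ i < a₀ ∧ a₀ ≤ n % p ^ (i + 1) := by
    have h4 := Nat.find_spec hex
    have h5 := Nat.find_min' hex h1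
    have h6 : Nat.find hex ≠ 0 := by
      intro h
      rw [h, pow_zero, Nat.mod_one] at h4
      omega
    refine ⟨Nat.find hex - 1, by omega, not_le.1 (Nat.find_min hex (by omega)), ?_⟩
    rwa [Nat.sub_add_cancel (by omega)]
  have h4 : Λ (mn φ a₀ (layerMin p a₀ i)) ∈ S :=
    hΛ.mn_mem_of_down ha₁ hq S hn'.2 h3 (le_layerMin ha₂) (layerMin_le hn'.1 hi1)
      (not_dvd_choose_layerMin hi1 hi2)
  rintro _ ⟨F', hF', rfl⟩
  rw [hΛ.eq_sum ha₁ hq]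
  refine Submodule.sum_mem _ fun t ht => ?_
  have ht' := Finset.mem_Icc.1 ht
  rcases Nat.lt_or_ge (t % p ^ m) a₀ with h | h
  · have h5 : t % p ^ i < a₀ := by
      rw [← Nat.mod_mod_of_dvd t (pow_dvd_pow p hi)]
      exact (Nat.mod_le _ _).trans_lt h
    exact Submodule.smul_of_tower_mem _ _ (hΛ.mn_mem_of_up ha₁ hq S (le_layerMin ha₂) h4 ht'.2
      (layerMin_le ht'.1 h5) (not_dvd_choose_sub_layerMin ha₁ ha₂ (by omega) ht'.1 ht'.2 h5))
  · rw [(mem_fnFil φ _ _ _).1 hF' t ht h, zero_smul]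
    exact Submodule.zero_mem _

/-- The steps decrease because `n % p ^ m ≤ n % p ^ (m + 1)`; the index `layerMin p a₀ m` witnesses
strictness. -/
theorem IsQuot.fil_lt (hΛ : IsQuot φ a₀ Λ) (ha₁ : 1 ≤ a₀) (ha₂ : a₀ ≤ p - 1)
    (hq : a₀ < p ^ f - 1) {m : ℕ} (hm : m + 1 ≤ f) :
    hΛ.fil ha₁ ha₂ hq (m + 1) hm < hΛ.fil ha₁ ha₂ hq m (Nat.le_of_succ_le hm) := by
  have hlt := layerMin_lt (m := m) ha₁ ha₂
  have hle : p ^ (m + 1) ≤ p ^ f := Nat.pow_le_pow_right (Fact.out : p.Prime).pos hm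
  refine lt_of_le_of_ne ?_ fun h => ?_
  · rintro _ ⟨F, hF, rfl⟩
    refine ⟨F, ?_, rfl⟩
    rw [SetLike.mem_coe] at hF ⊢
    rw [mem_fnFil] at hF ⊢
    intro n hn h
    refine hF n hn (h.trans ?_)
    rw [← Nat.mod_mod_of_dvd n (pow_dvd_pow p (Nat.le_succ m))]
    exact Nat.mod_le _ _
  · have h1 : Λ (mn φ a₀ (layerMin p a₀ m)) ∈ hΛ.fil ha₁ ha₂ hq m (Nat.le_of_succ_le hm) :=
      (hΛ.mem_fil ha₁ ha₂ hq _ _).2 (mn_mem_fnFil φ ha₁ hq (by omega) (layerMin_mod ha₁))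
    rw [← h, hΛ.mem_fil, mem_fnFil] at h1
    have h2 := h1 (layerMin p a₀ m) (Finset.mem_Icc.2 ⟨le_layerMin ha₂, by omega⟩) (by
      rw [Nat.mod_eq_of_lt hlt]
      exact le_layerMin ha₂)
    rw [cf_mn φ ha₁ hq (by omega) (le_layerMin ha₂) (by omega), if_pos rfl] at h2
    exact one_ne_zero h2

theorem IsQuot.fil_top (hΛ : IsQuot φ a₀ Λ) (ha₁ : 1 ≤ a₀) (ha₂ : a₀ ≤ p - 1)
    (hq : a₀ < p ^ f - 1) : hΛ.fil ha₁ ha₂ hq f le_rfl = ⊥ := by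
  rw [eq_bot_iff]
  rintro _ ⟨F, hF, rfl⟩
  change Λ F = 0
  rw [hΛ.eq_sum ha₁ hq]
  refine Finset.sum_eq_zero fun n hn => ?_
  have hn' := Finset.mem_Icc.1 hn
  rw [(mem_fnFil φ _ _ _).1 hF n hn (by rw [Nat.mod_eq_of_lt (by omega)]; exact hn'.1), zero_smul]

end Filtration

/-! ### Socle filtration of a uniserial module -/

section Socle

variable {A M : Type*} [Ring A] [AddCommGroup M] [Module A M]

/-- Every nonzero submodule of `M / N` contains `N' / N`, which is therefore the only simple
submodule. -/
theorem socle_eq_map {N N' : Submodule A M} (hlt : N < N')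
    (h : ∀ (S : Submodule A M) (x : M), x ∈ S → x ∉ N → N' ≤ S) :
    socle A (M ⧸ N) = N'.map N.mkQ := by
  have key : ∀ B : Submodule A (M ⧸ N), B ≠ ⊥ → N'.map N.mkQ ≤ B := by
    intro B hB
    obtain ⟨y, hy, hy0⟩ := (Submodule.ne_bot_iff B).1 hB
    obtain ⟨x, rfl⟩ := N.mkQ_surjective y
    rw [Submodule.map_le_iff_le_comap]
    refine h _ x hy fun hx => hy0 ?_
    rwa [Submodule.mkQ_apply, Submodule.Quotient.mk_eq_zero]
  have hne : N'.map N.mkQ ≠ ⊥ := by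
    obtain ⟨x, hx, hx'⟩ := SetLike.exists_of_lt hlt
    refine (Submodule.ne_bot_iff _).2 ⟨N.mkQ x, ⟨x, hx, rfl⟩, ?_⟩
    rwa [Submodule.mkQ_apply, Ne, Submodule.Quotient.mk_eq_zero]
  have hatom : IsAtom (N'.map N.mkQ) := by
    refine ⟨hne, fun B hB => ?_⟩
    by_contra h0
    exact absurd (key B h0) (not_le_of_gt hB)
  refine le_antisymm (sSup_le fun B hB => ?_) (le_sSup ?_)
  · have hB' : IsAtom B := isSimpleModule_iff_isAtom.1 hB
    rcases hB'.le_iff.1 (key B hB'.1) with h0 | h0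
    · exact absurd h0 hne
    · exact h0.ge
  · exact isSimpleModule_iff_isAtom.2 hatom

/-- The chain `N` descends while the socle filtration ascends, hence the reversed index. -/
theorem socleFil_eq (N : ℕ → Submodule A M) (f : ℕ) (hbot : N f = ⊥)
    (hlt : ∀ m < f, N (m + 1) < N m)
    (h : ∀ m < f, ∀ (S : Submodule A M) (x : M), x ∈ S → x ∉ N (m + 1) → N m ≤ S) {j : ℕ}
    (hj : j ≤ f) : socleFil A M j = N (f - j) := by
  induction j with
  | zero => rw [Nat.sub_zero, hbot]; rfl
  | succ j ih =>
    change (socle A (M ⧸ socleFil A M j)).comap (socleFil A M j).mkQ = _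
    have e : f - j = f - (j + 1) + 1 := by omega
    rw [ih (by omega), e, socle_eq_map (hlt _ (by omega)) (h _ (by omega)),
      Submodule.comap_map_mkQ, sup_eq_right]
    exact (hlt _ (by omega)).le

end Socle

/-! ### The second layer and its covering by a symmetric power -/

section SecondLayer

variable {k : Type*} [Field k] [NeZero f]

/-- The tuple `(a₀ - 1, p, p - 1, …, p - 1)`. -/
def coverWeight (p f : ℕ) [NeZero f] (a₀ : ℕ) (i : Fin f) : ℕ :=
  if i = 0 then a₀ - 1 else if i = 1 then p else p - 1

theorem one_ne_zero_Fin (hf : 2 ≤ f) : (1 : Fin f) ≠ 0 := by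
  obtain ⟨n, rfl⟩ : ∃ n, f = n + 2 := ⟨f - 2, by omega⟩
  exact one_ne_zero

theorem val_one_Fin (hf : 2 ≤ f) : ((1 : Fin f) : ℕ) = 1 := by
  obtain ⟨n, rfl⟩ : ∃ n, f = n + 2 := ⟨f - 2, by omega⟩
  rfl

theorem exists_wt_eq (hf : 2 ≤ f) (d : Fin f × Fin 2 →₀ ℕ) (l : Fin 2) :
    ∃ c, wt p d l = d (0, l) + p * (d (1, l) + p * c) := by
  obtain ⟨n, rfl⟩ : ∃ n, f = n + 2 := ⟨f - 2, by omega⟩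
  refine ⟨∑ i : Fin n, d (i.succ.succ, l) * p ^ (i : ℕ), ?_⟩
  have h : ∑ i : Fin n, d (i.succ.succ, l) * p ^ (i.succ.succ : ℕ) =
      p * (p * ∑ i : Fin n, d (i.succ.succ, l) * p ^ (i : ℕ)) := by
    rw [← mul_assoc, Finset.mul_sum]
    refine Finset.sum_congr rfl fun i _ => ?_
    simp only [Fin.val_succ, pow_succ]
    ring
  rw [wt, Fin.sum_univ_succ, Fin.sum_univ_succ, h, mul_add]
  simp [mul_comm]

theorem sum_pred_mul_pow : ∑ i : Fin f, (p - 1) * p ^ (i : ℕ) = p ^ f - 1 := by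
  have hp : 1 ≤ p := (Fact.out : p.Prime).pos
  have h := geom_sum_mul_add (p - 1) f
  rw [Nat.sub_add_cancel hp] at h
  rw [← Finset.mul_sum, Fin.sum_univ_eq_sum_range (fun i => p ^ i) f, mul_comm, ← h,
    Nat.add_sub_cancel]

/-- Relative to the digits of `q - 1`, the zeroth term changes by `a₀ - p` and the first by `p`.
With this total weight, evaluation sends monomials of the cover to the functions `mn φ a₀ n`. -/
theorem sum_coverWeight (hf : 2 ≤ f) {a₀ : ℕ} (ha₁ : 1 ≤ a₀) :
    ∑ i, coverWeight p f a₀ i * p ^ (i : ℕ) = p ^ f - 1 + a₀ := by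
  have hp : 1 ≤ p := (Fact.out : p.Prime).pos
  have h2 : ∑ i : Fin f, (coverWeight p f a₀ i * p ^ (i : ℕ) +
      if i = 0 then p - 1 else 0) =
      ∑ i : Fin f, ((p - 1) * p ^ (i : ℕ) + ((if i = 0 then a₀ - 1 else 0) + if i = 1 then p else 0)) := by
    refine Finset.sum_congr rfl fun i _ => ?_
    by_cases h0 : i = 0
    · subst h0
      simp [coverWeight, (one_ne_zero_Fin hf).symm]
      omega
    · by_cases h1 : i = 1
      · subst h1
        rw [coverWeight, val_one_Fin hf, if_neg h0, if_pos rfl, if_neg h0, if_neg h0, if_pos rfl,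
          pow_one]
        nlinarith [Nat.sub_add_cancel hp]
      · simp [coverWeight, h0, h1]
  simp only [Finset.sum_add_distrib, Finset.sum_ite_eq', Finset.mem_univ, if_true, sum_pred_mul_pow] at h2
  have : 1 ≤ p ^ f := Nat.one_le_pow _ _ hp
  omega

theorem pderiv_subst {R : Type*} [CommRing R] (ι : Zq p f →+* R)
    (m : Matrix (Fin 2) (Fin 2) (Zq p f)) (i : Fin f) (j : Fin 2)
    (F : MvPolynomial (Fin f × Fin 2) R) :
    pderiv (i, j) (subst ι m F) = ∑ l : Fin 2,
      C (ι (((WittVector.frobenius : Zq p f →+* Zq p f) ^ (i : ℕ)) (m j l))) *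
        subst ι m (pderiv (i, l) F) := by
  classical
  induction F using MvPolynomial.induction_on with
  | C a => simp [subst, algebraMap_eq]
  | add F G hF hG =>
    rw [map_add, map_add, hF, hG, ← Finset.sum_add_distrib]
    exact Finset.sum_congr rfl fun l _ => by rw [map_add, map_add, mul_add]
  | mul_X F z h =>
    obtain ⟨i', l'⟩ := z
    have hX : pderiv (i, j) (subst ι m (X (i', l'))) = ∑ l : Fin 2,
        C (ι (((WittVector.frobenius : Zq p f →+* Zq p f) ^ (i : ℕ)) (m j l))) *
          subst ι m (pderiv (i, l) (X (i', l'))) := by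
      by_cases hi : i' = i
      · subst hi
        fin_cases l' <;> fin_cases j <;>
          simp [subst, pderiv_X, Fin.sum_univ_two, Pi.single_apply]
      · simp [subst, pderiv_X, Fin.sum_univ_two, hi]
    rw [map_mul, pderiv_mul, h, hX]
    simp only [Finset.mul_sum, Finset.sum_mul, ← Finset.sum_add_distrib]
    refine Finset.sum_congr rfl fun l _ => ?_
    rw [pderiv_mul, map_add, map_mul, map_mul]
    ring

/-- The exponent of `X_1 Y_1`. -/
def exp₁ (f : ℕ) [NeZero f] : Fin f × Fin 2 →₀ ℕ :=
  Finsupp.single (1, 0) 1 + Finsupp.single (1, 1) 1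

/-- The map `F ↦ X_1⁻¹ ∂F/∂Y_1`. -/
def lower (k : Type*) [Field k] : MvPolynomial (Fin f × Fin 2) k →ₗ[k] MvPolynomial (Fin f × Fin 2) k where
  toFun F := (pderiv (1, 1) F).divMonomial (Finsupp.single (1, 0) 1)
  map_add' F G := by rw [map_add, add_divMonomial]
  map_smul' c F := by
    ext d
    simp [coeff_divMonomial]

theorem coeff_lower (F : MvPolynomial (Fin f × Fin 2) k) (d : Fin f × Fin 2 →₀ ℕ) :
    coeff d (lower k F) = (d (1, 1) + 1) *
      coeff (d + exp₁ f) F := by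
  change coeff d ((pderiv (1, 1) F).divMonomial (Finsupp.single (1, 0) 1)) = _
  rw [coeff_divMonomial, coeff_pderiv]
  have : Finsupp.single (1, 0) 1 + d + Finsupp.single (1, 1) 1 =
      d + exp₁ f := by
    rw [add_comm _ d, add_assoc, exp₁]
  rw [this]
  simp [mul_comm]

/-- Euler's identity in degree `p = 0` reads `X_1 ∂F/∂X_1 + Y_1 ∂F/∂Y_1 = 0`, so `X_1` divides
`∂F/∂Y_1`. The quotient is symmetric in the two variables up to sign, which is the source of its
equivariance. -/
theorem X_mul_lower [CharP k p] {b : Fin f → ℕ} (hb : b 1 = p) {F : MvPolynomial (Fin f × Fin 2) k}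
    (hF : F ∈ symSpace k b) : pderiv (1, 1) F = X (1, 0) * lower k F ∧
      pderiv (1, 0) F = -(X (1, 1) * lower k F) := by
  have euler : X (1, 0) * pderiv (1, 0) F + X (1, 1) * pderiv (1, 1) F = 0 := by
    rw [F.as_sum]
    simp only [map_sum, Finset.mul_sum, X_mul_pderiv_monomial, ← Finset.sum_add_distrib]
    refine Finset.sum_eq_zero fun d hd => ?_
    rw [← add_smul, (mem_symSpace_iff b F).1 hF d hd 1, hb, ← Nat.cast_smul_eq_nsmul k,
      CharP.cast_eq_zero, zero_smul]
  have hdvd : X (1, 0) ∣ pderiv (1, 1) F := by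
    have h1 : (X (1, 0) : MvPolynomial (Fin f × Fin 2) k) ∣ X (1, 1) * pderiv (1, 1) F :=
      ⟨-pderiv (1, 0) F, by linear_combination euler⟩
    refine (X_prime.dvd_or_dvd h1).resolve_left fun h2 => ?_
    simpa [Prod.ext_iff] using X_dvd_X.1 h2
  obtain ⟨H, hH⟩ := hdvd
  have h3 : lower k F = H := by
    change (pderiv (1, 1) F).divMonomial (Finsupp.single (1, 0) 1) = _
    rw [hH, X_mul_divMonomial]
  rw [h3]
  refine ⟨hH, ?_⟩
  refine mul_left_cancel₀ (X_ne_zero ((1 : Fin f), (0 : Fin 2))) ?_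
  rw [hH] at euler
  linear_combination euler

/-- The chain rule combined with both formulas of `X_mul_lower` makes the determinant of the matrix
acting on `X_1, Y_1` appear. Its entries are Frobenius twists, hence the `p`-th power and the twist
`D^p` of the weight. -/
theorem lower_subst [CharP k p] {ι : Zq p f →+* k} {φ : Fq p f →+* k}
    (hφ : ∀ a, ι a = φ (WittVector.constantCoeff a)) (hf : 2 ≤ f) {b : Fin f → ℕ} (hb : b 1 = p)
    (m : Matrix (Fin 2) (Fin 2) (Zq p f)) {F : MvPolynomial (Fin f × Fin 2) k}
    (hF : F ∈ symSpace k b) : lower k (subst ι m F) = C (ι m.det ^ p) * subst ι m (lower k F) := by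
  refine mul_left_cancel₀ (X_ne_zero ((1 : Fin f), (0 : Fin 2))) ?_
  rw [← (X_mul_lower hb (subst_mem ι m b F hF)).1, pderiv_subst, Fin.sum_univ_two,
    (X_mul_lower hb hF).1, (X_mul_lower hb hF).2]
  have h1 : ∀ l, subst ι m (X (1, l)) = C (φ (WittVector.constantCoeff (m 0 l)) ^ p) * X (1, 0) +
      C (φ (WittVector.constantCoeff (m 1 l)) ^ p) * X (1, 1) := by
    intro l
    simp only [subst, aeval_X, Fin.sum_univ_two, hφ, constantCoeff_frobenius_pow]
    simp only [val_one_Fin hf, pow_one, map_pow]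
  simp only [map_neg, map_mul, h1, hφ, constantCoeff_frobenius_pow]
  simp only [val_one_Fin hf, pow_one, map_pow, map_mul, Matrix.det_fin_two, map_sub]
  rw [sub_pow_char, mul_pow, mul_pow]
  ring

theorem lower_monomial (d : Fin f × Fin 2 →₀ ℕ) (c : k) :
    lower k (monomial (d + exp₁ f) c) =
      monomial d ((d (1, 1) + 1) * c) := by
  classical
  ext d'
  rw [coeff_lower, coeff_monomial, coeff_monomial]
  by_cases h : d = d'
  · subst h
    simp
  · rw [if_neg h, if_neg (by simpa using h), mul_zero]

theorem add_singles_apply (d : Fin f × Fin 2 →₀ ℕ) (i : Fin f) (l : Fin 2) :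
    (d + exp₁ f) (i, l) =
      d (i, l) + if i = 1 then 1 else 0 := by
  by_cases hi : i = 1
  · subst hi
    fin_cases l <;> simp [exp₁]
  · simp [exp₁, hi]

theorem add_singles_mem_iff (hp : 2 < p) (hf : 2 ≤ f) {a₀ : ℕ} (d : Fin f × Fin 2 →₀ ℕ) :
    (∀ i, (d + exp₁ f) (i, 0) +
      (d + exp₁ f) (i, 1) = coverWeight p f a₀ i) ↔
    ∀ i, d (i, 0) + d (i, 1) = secondWeight p f a₀ i := by
  refine forall_congr' fun i => ?_
  rw [add_singles_apply, add_singles_apply]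
  have := one_ne_zero_Fin hf
  by_cases h0 : i = 0
  · subst h0
    simp [coverWeight, secondWeight, this.symm]
  · by_cases h1 : i = 1
    · subst h1
      simp only [coverWeight, secondWeight, if_neg h0, if_true]
      omega
    · simp [coverWeight, secondWeight, h0, h1]

theorem lower_mem (hp : 2 < p) (hf : 2 ≤ f) {a₀ : ℕ} {F : MvPolynomial (Fin f × Fin 2) k}
    (hF : F ∈ symSpace k (coverWeight p f a₀)) : lower k F ∈ symSpace k (secondWeight p f a₀) := by
  rw [mem_symSpace_iff] at hF ⊢
  intro d hd
  rw [mem_support_iff, coeff_lower] at hd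
  exact (add_singles_mem_iff hp hf d).1 (hF _ (mem_support_iff.2 (right_ne_zero_of_mul hd)))

theorem coverWeight_one (hf : 2 ≤ f) (a₀ : ℕ) : coverWeight p f a₀ 1 = p := by
  rw [coverWeight, if_neg (one_ne_zero_Fin hf), if_pos rfl]

theorem of_smul_val {R : Type*} [CommRing R] (ι : Zq p f →+* R) (r : Fin f → ℕ) (s : ℕ)
    (g : K p f) (v : SymMod ι r s) :
    (symEquiv ι r s (MonoidAlgebra.of R (K p f) g • v) : MvPolynomial (Fin f × Fin 2) R) =
      C (ι (g : Matrix (Fin 2) (Fin 2) (Zq p f)).det ^ s) * subst ι g (symEquiv ι r s v).1 := by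
  rw [of_smul_symMod, ← smul_eq_C_mul]
  rfl

/-- `F ↦ X_1⁻¹ ∂F/∂Y_1` as a map of representations. -/
def lowerMap [CharP k p] {ι : Zq p f →+* k} {φ : Fq p f →+* k}
    (hφ : ∀ a, ι a = φ (WittVector.constantCoeff a)) (hp : 2 < p) (hf : 2 ≤ f) (a₀ : ℕ) :
    SymMod ι (coverWeight p f a₀) 0 →ₗ[k[K p f]] SymMod ι (secondWeight p f a₀) p :=
  MonoidAlgebra.equivariantOfLinearOfComm
    ((symEquiv ι _ p).symm.toLinearMap ∘ₗ ((lower k).restrict fun _ hF => lower_mem hp hf hF) ∘ₗ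
      (symEquiv ι _ 0).toLinearMap) fun g v => by
    refine (symEquiv ι _ p).injective (Subtype.ext ?_)
    change lower k (symEquiv ι _ 0 (MonoidAlgebra.of k (K p f) g • v)).1 =
      (symEquiv ι _ p (MonoidAlgebra.of k (K p f) g • _)).1
    rw [of_smul_val, of_smul_val, pow_zero, C_1, one_mul,
      lower_subst hφ hf (coverWeight_one hf a₀) _ (symEquiv ι _ 0 v).2]
    rfl

theorem lowerMap_val [CharP k p] {ι : Zq p f →+* k} {φ : Fq p f →+* k}
    (hφ : ∀ a, ι a = φ (WittVector.constantCoeff a)) (hp : 2 < p) (hf : 2 ≤ f) (a₀ : ℕ)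
    (v : SymMod ι (coverWeight p f a₀) 0) :
    (symEquiv ι _ p (lowerMap hφ hp hf a₀ v)).1 = lower k (symEquiv ι _ 0 v).1 := rfl

theorem coverWeight_le {a₀ : ℕ} (ha₂ : a₀ ≤ p - 1) {i : Fin f} (hi : i ≠ 1) :
    coverWeight p f a₀ i ≤ p - 1 := by
  rw [coverWeight]
  split_ifs
  · omega
  · exact le_rfl

theorem lowerMap_surjective [CharP k p] {ι : Zq p f →+* k} {φ : Fq p f →+* k}
    (hφ : ∀ a, ι a = φ (WittVector.constantCoeff a)) (hp : 2 < p) (hf : 2 ≤ f) (a₀ : ℕ) :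
    Function.Surjective (lowerMap hφ hp hf a₀) := by
  intro w
  have hw : (symEquiv ι _ p w).1 ∈ (symSpace k (coverWeight p f a₀)).map (lower k) := by
    have h2 := (mem_symSpace_iff _ _).1 (symEquiv ι _ p w).2
    rw [(symEquiv ι _ p w).1.as_sum]
    refine Submodule.sum_mem _ fun d hd => ?_
    have hd2 := h2 d hd
    have hd1 := (mem_support_iff.1 hd)
    refine ⟨_, monomial_mem_symSpace ((add_singles_mem_iff hp hf d).2 hd2)
      -- The differentiated exponent `d (1, 1) + 1` is at most `p - 1`, as the target has degree `p
      -- - 2` in index `1`, so it is invertible in `k`.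
      (((d (1, 1) : k) + 1)⁻¹ * coeff d (symEquiv ι _ p w).1), ?_⟩
    rw [lower_monomial, mul_inv_cancel_left₀]
    have h3 := hd2 1
    rw [secondWeight, if_neg (one_ne_zero_Fin hf), if_pos rfl] at h3
    rw [← Nat.cast_succ, Ne, CharP.cast_eq_zero_iff k p]
    exact fun h => absurd (Nat.le_of_dvd (Nat.succ_pos _) h) (by omega)
  obtain ⟨F, hF, hFw⟩ := hw
  exact ⟨(symEquiv ι _ 0).symm ⟨F, hF⟩, (symEquiv ι _ p).injective (Subtype.ext hFw)⟩

theorem wt_coverWeight_add (hf : 2 ≤ f) {a₀ : ℕ} (ha₁ : 1 ≤ a₀) {d : Fin f × Fin 2 →₀ ℕ}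
    (hd : ∀ i, d (i, 0) + d (i, 1) = coverWeight p f a₀ i) :
    wt p d 0 + wt p d 1 = p ^ f - 1 + a₀ := by
  rw [wt_add hd, sum_coverWeight hf ha₁]

theorem evFn_eq_sum {ι : Zq p f →+* k} (φ : Fq p f →+* k) (hf : 2 ≤ f) {a₀ : ℕ} (ha₁ : 1 ≤ a₀)
    (v : SymMod ι (coverWeight p f a₀) 0) :
    evFn φ ι _ 0 v = ∑ d ∈ (symEquiv ι _ 0 v).1.support,
      coeff d (symEquiv ι _ 0 v).1 • mn φ a₀ (wt p d 1) := by
  conv_lhs => rw [eq_sum_symMono v, map_sum]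
  rw [← Finset.sum_attach (symEquiv ι _ 0 v).1.support]
  refine Finset.sum_congr rfl fun d _ => ?_
  have h := wt_coverWeight_add hf ha₁ ((mem_symSpace_iff _ _).1 (symEquiv ι _ 0 v).2 d.1 d.2)
  rw [evFn_symMono, mn, show p ^ f - 1 + a₀ - wt p d.1 1 = wt p d.1 0 by omega]

/-- Modulo `p` the `y`-weight of a monomial is its exponent of `Y_0`, at most `a₀ - 1`. -/
theorem evFn_mem_fnFil_one {ι : Zq p f →+* k} (φ : Fq p f →+* k) (hf : 2 ≤ f) {a₀ : ℕ}
    (ha₁ : 1 ≤ a₀) (ha₂ : a₀ ≤ p - 1) (hq : a₀ < p ^ f - 1)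
    (v : SymMod ι (coverWeight p f a₀) 0) : evFn φ ι _ 0 v ∈ fnFil φ a₀ 1 := by
  rw [evFn_eq_sum φ hf ha₁]
  refine Submodule.sum_mem _ fun d hd => Submodule.smul_mem _ _ ?_
  have hd' := (mem_symSpace_iff _ _).1 (symEquiv ι _ 0 v).2 d hd
  have h := wt_coverWeight_add hf ha₁ hd'
  refine mn_mem_fnFil φ ha₁ hq (by omega) ?_
  obtain ⟨c, hc⟩ := exists_wt_eq (p := p) hf d 1
  have h0 := hd' 0
  rw [coverWeight, if_pos rfl] at h0
  rw [hc, pow_one, Nat.add_mul_mod_self_left, Nat.mod_eq_of_lt (by omega)]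
  omega

/-- Monomials whose exponent of `Y_1` is `0` or `p` have `y`-weight below `a₀` modulo `p ^ 2`, and
`lower` kills exactly these. The others have a nonzero digit at `p`, hence residue at least `p`, and
their weights are pairwise distinct, so no cancellation can put a combination of them into step `2`.
-/
theorem evFn_mem_fnFil_two_iff [CharP k p] {ι : Zq p f →+* k} (φ : Fq p f →+* k) (hp : 2 < p)
    (hf : 2 ≤ f) {a₀ : ℕ} (ha₁ : 1 ≤ a₀) (ha₂ : a₀ ≤ p - 1) (hq : a₀ < p ^ f - 1)
    (v : SymMod ι (coverWeight p f a₀) 0) :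
    evFn φ ι _ 0 v ∈ fnFil φ a₀ 2 ↔ lower k (symEquiv ι _ 0 v).1 = 0 := by
  have hv := (mem_symSpace_iff _ _).1 (symEquiv ι _ 0 v).2
  have hpp : p < p ^ 2 := by nlinarith
  have hmod : ∀ d : Fin f × Fin 2 →₀ ℕ, (∀ i, d (i, 0) + d (i, 1) = coverWeight p f a₀ i) →
      d (0, 1) < a₀ ∧ d (1, 1) ≤ p ∧
      wt p d 1 % p ^ 2 = if d (1, 1) = p then d (0, 1) else d (0, 1) + p * d (1, 1) := by
    intro d hd
    obtain ⟨c, hc⟩ := exists_wt_eq (p := p) hf d 1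
    have h0 := hd 0
    have h1 := hd 1
    rw [coverWeight, if_pos rfl] at h0
    rw [coverWeight_one hf] at h1
    refine ⟨by omega, by omega, ?_⟩
    split_ifs with h
    · rw [hc, h, show d (0, 1) + p * (p + p * c) = d (0, 1) + p ^ 2 * (1 + c) by ring,
        Nat.add_mul_mod_self_left, Nat.mod_eq_of_lt (by omega)]
    · have h2 : d (1, 1) + 1 ≤ p := by omega
      have h3 := Nat.mul_le_mul_left p h2
      rw [hc, show d (0, 1) + p * (d (1, 1) + p * c) = d (0, 1) + p * d (1, 1) + p ^ 2 * c by ring,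
        Nat.add_mul_mod_self_left, Nat.mod_eq_of_lt (by rw [pow_two]; linarith [show d (0, 1) < p by omega])]
  constructor
  · intro h
    ext d
    rw [coeff_lower, coeff_zero]
    set e := d + exp₁ f with he
    have he1 : e (1, 1) = d (1, 1) + 1 := by rw [he, add_singles_apply, if_pos rfl]
    by_cases hd : coeff e (symEquiv ι _ 0 v).1 = 0
    · rw [hd, mul_zero]
    have hes := hv e (mem_support_iff.2 hd)
    obtain ⟨h0, h1, hm⟩ := hmod e hes
    -- If the exponent of `Y_1` is `p`, the derivative carries the factor `p = 0`. Otherwise all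
    -- exponents of the `Y_i` are base-`p` digits and the weight determines `e`, so its coefficient
    -- can be read off.
    by_cases hep : e (1, 1) = p
    · rw [← Nat.cast_succ, ← Nat.add_one, ← he1, hep, CharP.cast_eq_zero, zero_mul]
    have hlt : ∀ i, e (i, 1) < p := by
      intro i
      by_cases hi : i = 1
      · subst hi
        omega
      · have := coverWeight_le (p := p) ha₂ hi
        have := hes i
        omega
    obtain ⟨e2, e3⟩ := eq_rep_of_lt hes hlt
    rw [if_neg hep] at hm
    have hge : p ≤ p * e (1, 1) := Nat.le_mul_of_pos_right _ (by omega)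
    have hle := Nat.mod_le (wt p e 1) (p ^ 2)
    have h4 := (mem_fnFil φ _ _ _).1 h (wt p e 1) (Finset.mem_Icc.2 ⟨by omega, by omega⟩) (by omega)
    rw [evFn_eq_sum φ hf ha₁, map_sum, Finset.sum_eq_single e] at h4
    · rw [map_smul, cf_mn φ ha₁ hq (by omega) (by omega) (by omega), if_pos rfl] at h4
      exact absurd (by simpa using h4) hd
    · intro d' hd' hne
      have hds := hv d' hd'
      have hw := wt_coverWeight_add hf ha₁ hds
      rw [map_smul, cf_mn φ ha₁ hq (by omega) (by omega) (by omega), if_neg, smul_zero]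
      intro heq
      refine hne ?_
      obtain ⟨h0', h1', hm'⟩ := hmod d' hds
      have hd'p : d' (1, 1) ≠ p := by
        intro hd'p
        rw [heq, hm, if_pos hd'p] at hm'
        omega
      rw [e2, ← heq]
      refine (eq_rep_of_lt hds fun i => ?_).1
      by_cases hi : i = 1
      · subst hi
        omega
      · have := coverWeight_le (p := p) ha₂ hi
        have := hds i
        omega
    · intro h5
      rw [notMem_support_iff.1 h5, zero_smul, map_zero]
  · intro h
    rw [evFn_eq_sum φ hf ha₁]
    refine Submodule.sum_mem _ fun d hd => Submodule.smul_mem _ _ ?_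
    have hds := hv d hd
    have hw := wt_coverWeight_add hf ha₁ hds
    obtain ⟨h0, h1, hm⟩ := hmod d hds
    refine mn_mem_fnFil φ ha₁ hq (by omega) ?_
    rw [hm]
    split_ifs with hdp
    · exact h0
    · by_cases hd0 : d (1, 1) = 0
      · rw [hd0, mul_zero]
        exact h0
      exfalso
      have h1' := hds 1
      rw [coverWeight_one hf] at h1'
      have hle : exp₁ f ≤ d := by
        rintro ⟨i, l⟩
        have := add_singles_apply (f := f) 0 i l
        rw [zero_add] at this
        rw [this]
        split_ifs with hi
        · subst hi
          fin_cases l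
          · change 0 + 1 ≤ d (1, 0)
            omega
          · change 0 + 1 ≤ d (1, 1)
            omega
        · simp
      have h2 := coeff_lower (symEquiv ι _ 0 v).1 (d - exp₁ f)
      have h3 := add_singles_apply (d - exp₁ f) 1 1
      rw [tsub_add_cancel_of_le hle] at h2 h3
      rw [if_pos rfl] at h3
      rw [h, coeff_zero, ← Nat.cast_succ, ← Nat.add_one, ← h3] at h2
      rcases mul_eq_zero.1 h2.symm with h4 | h4
      · rw [CharP.cast_eq_zero_iff k p] at h4
        exact absurd (Nat.le_of_dvd (Nat.pos_of_ne_zero hd0) h4) (by omega)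
      · exact mem_support_iff.1 hd h4

variable {φ : Fq p f →+* k} {a₀ : ℕ} {M : Type*} [AddCommGroup M] [Module k M]
  [Module k[K p f] M] [IsScalarTower k k[K p f] M] {Λ : ((Fin 2 → Fq p f) → k) →ₗ[k] M}

/-- Evaluation and `lowerMap` present the layer and the weight as quotients of the same
representation, and their kernels agree by `evFn_mem_fnFil_two_iff`. -/
theorem IsQuot.nonempty_equiv {ι : Zq p f →+* k}
    (hφ : ∀ a, ι a = φ (WittVector.constantCoeff a)) (hΛ : IsQuot φ a₀ Λ) (hp : 2 < p)
    (hf : 2 ≤ f) (ha₁ : 1 ≤ a₀) (ha₂ : a₀ ≤ p - 1) (hq : a₀ < p ^ f - 1) :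
    Nonempty ((hΛ.fil ha₁ ha₂ hq 1 (Nat.le_of_succ_le hf) ⧸ (hΛ.fil ha₁ ha₂ hq 2 hf).submoduleOf
      (hΛ.fil ha₁ ha₂ hq 1 (Nat.le_of_succ_le hf))) ≃ₗ[k[K p f]] SymMod ι (secondWeight p f a₀) p) := by
  have := charP_of_ringHom φ
  let a : SymMod ι (coverWeight p f a₀) 0 →ₗ[k[K p f]] M :=
    MonoidAlgebra.equivariantOfLinearOfComm (Λ ∘ₗ evFn φ ι _ 0) fun g v => by
      change Λ (evFn φ ι _ 0 (MonoidAlgebra.of k (K p f) g • v)) = _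
      rw [evFn_of_smul hφ]
      exact hΛ.equiv g _
  have ha : ∀ v, a v = Λ (evFn φ ι _ 0 v) := fun v => rfl
  have ha1 : ∀ v, a v ∈ hΛ.fil ha₁ ha₂ hq 1 (Nat.le_of_succ_le hf) := fun v =>
    (hΛ.mem_fil ha₁ ha₂ hq _ _).2 (evFn_mem_fnFil_one φ hf ha₁ ha₂ hq v)
  have ha2 : ∀ v, a v ∈ hΛ.fil ha₁ ha₂ hq 2 hf ↔ lowerMap hφ hp hf a₀ v = 0 := by
    intro v
    rw [ha, hΛ.mem_fil, evFn_mem_fnFil_two_iff φ hp hf ha₁ ha₂ hq, ← lowerMap_val hφ hp hf,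
      ZeroMemClass.coe_eq_zero, LinearEquiv.map_eq_zero_iff]
  have hsurj := lowerMap_surjective (ι := ι) hφ hp hf a₀
  have hrange : hΛ.fil ha₁ ha₂ hq 1 (Nat.le_of_succ_le hf) ≤ LinearMap.range a := by
    -- A vector with nonzero image under `lowerMap` evaluates outside step `2`, so by uniseriality
    -- the range contains all of step `1`.
    obtain ⟨v, hv⟩ := hsurj (symMono ι p (repBot_add _) 1)
    refine hΛ.fil_le ha₁ ha₂ hq _ hf ⟨v, rfl⟩ ?_
    rw [ha2, hv]
    intro h
    have h' := congrArg (fun w => (symEquiv ι (secondWeight p f a₀) p w).1) h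
    exact one_ne_zero ((monomial_eq_zero (R := k)).1 h')
  let a' := ((hΛ.fil ha₁ ha₂ hq 2 hf).submoduleOf (hΛ.fil ha₁ ha₂ hq 1 (Nat.le_of_succ_le hf))).mkQ ∘ₗ
    a.codRestrict _ ha1
  have ha' : Function.Surjective a' := by
    intro x
    obtain ⟨⟨y, hy⟩, rfl⟩ := Submodule.Quotient.mk_surjective _ x
    obtain ⟨v, hv⟩ := hrange hy
    exact ⟨v, congrArg Submodule.Quotient.mk (Subtype.ext hv)⟩
  have hker : LinearMap.ker a' = LinearMap.ker (lowerMap hφ hp hf a₀) := by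
    ext v
    rw [LinearMap.mem_ker, LinearMap.mem_ker, ← ha2]
    exact (Submodule.Quotient.mk_eq_zero _)
  exact ⟨(a'.quotKerEquivOfSurjective ha').symm ≪≫ₗ Submodule.quotEquivOfEq _ _ hker ≪≫ₗ
    (lowerMap hφ hp hf a₀).quotKerEquivOfSurjective hsurj⟩

theorem IsQuot.isSimpleModule (hΛ : IsQuot φ a₀ Λ) (ha₁ : 1 ≤ a₀) (ha₂ : a₀ ≤ p - 1)
    (hq : a₀ < p ^ f - 1) {m : ℕ} (hm : m + 1 ≤ f) :
    IsSimpleModule k[K p f] (hΛ.fil ha₁ ha₂ hq m (Nat.le_of_succ_le hm) ⧸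
      (hΛ.fil ha₁ ha₂ hq (m + 1) hm).submoduleOf
        (hΛ.fil ha₁ ha₂ hq m (Nat.le_of_succ_le hm))) := by
  have hlt := hΛ.fil_lt ha₁ ha₂ hq hm
  refine (covBy_iff_quot_is_simple hlt.le).1 ⟨hlt, fun S h1 h2 => ?_⟩
  obtain ⟨x, hx, hx'⟩ := SetLike.exists_of_lt h1
  exact absurd (hΛ.fil_le ha₁ ha₂ hq S hm hx hx') h2.not_ge

theorem IsQuot.socleFil_eq (hΛ : IsQuot φ a₀ Λ) (ha₁ : 1 ≤ a₀) (ha₂ : a₀ ≤ p - 1)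
    (hq : a₀ < p ^ f - 1) {m : ℕ} (hm : m ≤ f) :
    socleFil k[K p f] M (f - m) = hΛ.fil ha₁ ha₂ hq m hm := by
  have := HeckeRed.socleFil_eq (fun m => if h : m ≤ f then hΛ.fil ha₁ ha₂ hq m h else ⊥) f
    (by simpa using hΛ.fil_top ha₁ ha₂ hq) (fun m hm => ?_) (fun m hm S x hx hx' => ?_)
    (Nat.sub_le f m)
  · rw [this, Nat.sub_sub_self hm, dif_pos hm]
  · rw [dif_pos (Nat.succ_le_of_lt hm), dif_pos hm.le]
    exact hΛ.fil_lt ha₁ ha₂ hq hm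
  · rw [dif_pos (Nat.succ_le_of_lt hm)] at hx'
    rw [dif_pos hm.le]
    exact hΛ.fil_le ha₁ ha₂ hq S hm hx hx'

end SecondLayer

/-! ### Power sums of Teichmüller representatives -/

section Teichmuller

theorem frobenius_pow_teichmuller (n : ℕ) (l : Fq p f) :
    ((WittVector.frobenius : Zq p f →+* Zq p f) ^ n) (WittVector.teichmuller p l) =
      WittVector.teichmuller p l ^ p ^ n := by
  induction n with
  | zero => simp
  | succ n ih =>
    rw [pow_succ', RingHom.coe_mul, Function.comp_apply, ih, map_pow,
      WittVector.frobenius_eq_map_frobenius, WittVector.map_teichmuller, frobenius_def, map_pow,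
      ← pow_mul, ← pow_succ']

variable [NeZero f]

theorem exists_unit_pow_ne_one {n : ℕ} (hn : ¬ p ^ f - 1 ∣ n) : ∃ u : (Fq p f)ˣ, u ^ n ≠ 1 := by
  classical
  by_contra! h
  obtain ⟨u, hu⟩ := IsCyclic.exists_ofOrder_eq_natCard (α := (Fq p f)ˣ)
  refine hn ?_
  have := orderOf_dvd_of_pow_eq_one (h u)
  rwa [hu, Nat.card_eq_fintype_card, Fintype.card_units, card_Fq] at this

/-- Multiplying `l` by a unit `u` with `u ^ n ≠ 1` permutes the terms and scales the sum by `[u] ^ n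
≠ 1`. The vanishing is exact, as is needed for divisibility by `p ^ 2`. -/
theorem sum_teichmuller_pow {n : ℕ} (hn : ¬ p ^ f - 1 ∣ n) :
    ∑ l : Fq p f, WittVector.teichmuller p l ^ n = (0 : Zq p f) := by
  obtain ⟨u, hu⟩ := exists_unit_pow_ne_one hn
  have h1 : WittVector.teichmuller p (u : Fq p f) ^ n *
      ∑ l : Fq p f, WittVector.teichmuller p l ^ n = ∑ l : Fq p f, WittVector.teichmuller p l ^ n := by
    rw [Finset.mul_sum]
    conv_rhs => rw [← Equiv.sum_comp (Equiv.mulLeft₀ (u : Fq p f) u.ne_zero)]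
    refine Finset.sum_congr rfl fun l _ => ?_
    rw [← mul_pow, ← map_mul]
    rfl
  have h2 : WittVector.teichmuller p (u : Fq p f) ^ n ≠ (1 : Zq p f) := by
    intro h
    have h3 := congrArg WittVector.constantCoeff h
    rw [map_pow, constantCoeff_teichmuller, map_one] at h3
    exact hu (Units.ext h3)
  exact (mul_left_eq_self₀.1 h1).resolve_left h2

end Teichmuller

/-! ### First-order expansions modulo `ε ^ 2` -/

section Divisibility

theorem sq_dvd_pow_sub {S : Type*} [CommRing S] (ε a b : S) (n : ℕ) :
    ε ^ 2 ∣ (a + ε * b) ^ n - (a ^ n + ε * (n * a ^ (n - 1) * b)) := by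
  induction n with
  | zero => simp
  | succ n ih =>
    obtain ⟨c, hc⟩ := ih
    have h : (a + ε * b) ^ n = a ^ n + ε * (n * a ^ (n - 1) * b) + ε ^ 2 * c := by
      linear_combination hc
    have h' : (n : S) * (a ^ (n - 1) * a) = n * a ^ n := by
      cases n with
      | zero => simp
      | succ n => rw [Nat.add_sub_cancel, ← pow_succ]
    refine ⟨n * a ^ (n - 1) * b * b + c * (a + ε * b), ?_⟩
    rw [pow_succ, h, Nat.add_sub_cancel]
    push_cast
    linear_combination ε * b * h'

theorem sq_dvd_prod_sub {S α : Type*} [CommRing S] [DecidableEq α] (ε : S) (a b : α → S) (r : α → ℕ)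
    (s : Finset α) : ε ^ 2 ∣ ∏ i ∈ s, (a i + ε * b i) ^ r i - (∏ i ∈ s, a i ^ r i +
      ε * ∑ i ∈ s, r i * (a i ^ (r i - 1) * b i * ∏ j ∈ s.erase i, a j ^ r j)) := by
  induction s using Finset.induction_on with
  | empty => simp
  | insert x s hx ih =>
    obtain ⟨c, hc⟩ := ih
    obtain ⟨d, hd⟩ := sq_dvd_pow_sub ε (a x) (b x) (r x)
    rw [sub_eq_iff_eq_add] at hc hd
    have h1 : ∀ i ∈ s, (r i : S) * (a i ^ (r i - 1) * b i * ∏ j ∈ (insert x s).erase i, a j ^ r j) =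
        a x ^ r x * (r i * (a i ^ (r i - 1) * b i * ∏ j ∈ s.erase i, a j ^ r j)) := by
      intro i hi
      have hne : x ≠ i := fun h => hx (h ▸ hi)
      rw [Finset.erase_insert_of_ne hne, Finset.prod_insert (fun h => hx (Finset.mem_of_mem_erase h))]
      ring
    rw [Finset.prod_insert hx, Finset.prod_insert hx, Finset.sum_insert hx,
      Finset.erase_insert hx, Finset.sum_congr rfl h1, ← Finset.mul_sum, hc, hd]
    refine ⟨d * ∏ i ∈ s, (a i + ε * b i) ^ r i + c * (a x ^ r x + ε * (r x * a x ^ (r x - 1) * b x)) +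
      r x * a x ^ (r x - 1) * b x *
        ∑ i ∈ s, r i * (a i ^ (r i - 1) * b i * ∏ j ∈ s.erase i, a j ^ r j), ?_⟩
    rw [hc]
    ring

end Divisibility

/-! ### The Hecke substitutions modulo `p` -/

section HeckeRep

variable {R : Type*} [CommRing R] (ι : Zq p f →+* R)

/-- The image of the Teichmüller lift. -/
def tch (l : Fq p f) : R := ι (WittVector.teichmuller p l)

theorem subst_some_zero (l : Fq p f) (i : Fin f) :
    subst ι (heckeRep (some l)).adjugate (X (i, 0)) = X (i, 0) := by
  simp [subst, heckeRep, Matrix.adjugate_fin_two_of, Fin.sum_univ_two]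

theorem subst_some_one (l : Fq p f) (i : Fin f) :
    subst ι (heckeRep (some l)).adjugate (X (i, 1)) =
      -(C (tch ι l) ^ p ^ (i : ℕ)) * X (i, 0) + C (p : R) * X (i, 1) := by
  simp [subst, heckeRep, Matrix.adjugate_fin_two_of, Fin.sum_univ_two, frobenius_pow_teichmuller,
    tch, -RingHom.coe_pow]

theorem subst_none_zero (i : Fin f) :
    subst ι (heckeRep (none : Option (Fq p f))).adjugate (X (i, 0)) = C (p : R) * X (i, 0) := by
  simp [-RingHom.coe_pow, subst, heckeRep, Matrix.adjugate_fin_two_of, Fin.sum_univ_two]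

theorem subst_none_one (i : Fin f) :
    subst ι (heckeRep (none : Option (Fq p f))).adjugate (X (i, 1)) = X (i, 1) := by
  simp [subst, heckeRep, Matrix.adjugate_fin_two_of, Fin.sum_univ_two]

theorem symModAct_val (r : Fin f → ℕ) (s : ℕ) (m : Matrix (Fin 2) (Fin 2) (Zq p f))
    (v : SymMod ι r s) : (symEquiv ι r s (symModAct ι r s m v)).1 = subst ι m (symEquiv ι r s v).1 :=
  rfl

theorem symMono_val {r : Fin f → ℕ} (s : ℕ) {d : Fin f × Fin 2 →₀ ℕ}
    (hd : ∀ i, d (i, 0) + d (i, 1) = r i) (c : R) :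
    (symEquiv ι r s (symMono ι s hd c)).1 = monomial d c := rfl

/-- Over a domain, dividing by a nonzero constant does not change the support, so the quotient keeps
its multidegree. -/
theorem exists_eq_smul_of_dvd [IsDomain R] {r : Fin f → ℕ} {s : ℕ} {c : R} (hc : c ≠ 0)
    (v : SymMod ι r s) (h : C c ∣ (symEquiv ι r s v).1) : ∃ w : SymMod ι r s, v = c • w := by
  obtain ⟨W, hW⟩ := h
  have hW' : W ∈ symSpace R r := by
    rw [mem_symSpace_iff]
    intro d hd
    refine (mem_symSpace_iff _ _).1 (symEquiv ι r s v).2 d ?_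
    rw [mem_support_iff, hW, coeff_C_mul]
    exact mul_ne_zero hc (mem_support_iff.1 hd)
  refine ⟨(symEquiv ι r s).symm ⟨W, hW'⟩, (symEquiv ι r s).injective (Subtype.ext ?_)⟩
  rw [hW, ← smul_eq_C_mul]
  rfl

variable [NeZero f]

theorem tch_pow_sub_one {l : Fq p f} (hl : l ≠ 0) : tch ι l ^ (p ^ f - 1) = 1 := by
  rw [tch, ← map_pow, ← map_pow, ← card_Fq (p := p) (f := f), FiniteField.pow_card_sub_one_eq_one l hl,
    map_one, map_one]

theorem tch_zero : tch ι (0 : Fq p f) = 0 := by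
  rw [tch, WittVector.teichmuller_zero, map_zero]

theorem sum_tch_pow {n : ℕ} (hn : ¬ p ^ f - 1 ∣ n) : ∑ l : Fq p f, tch ι l ^ n = 0 := by
  have := congrArg ι (sum_teichmuller_pow (p := p) (f := f) hn)
  simp only [map_sum, map_pow, map_zero] at this
  exact this

/-- The exponent of `∏ X_i^{p-1} Y_i^{r_i-p+1}`. -/
def subTop (p : ℕ) {f : ℕ} (r : Fin f → ℕ) : Fin f × Fin 2 →₀ ℕ :=
  Finsupp.equivFunOnFinite.symm fun x => if x.2 = 0 then p - 1 else r x.1 - (p - 1)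

theorem subTop_zero (r : Fin f → ℕ) (i : Fin f) : subTop p r (i, 0) = p - 1 := rfl

theorem subTop_one (r : Fin f → ℕ) (i : Fin f) : subTop p r (i, 1) = r i - (p - 1) := rfl

theorem subTop_add {r : Fin f → ℕ} (hr : ∀ i, p ≤ r i) (i : Fin f) :
    subTop p r (i, 0) + subTop p r (i, 1) = r i := by
  rw [subTop_zero, subTop_one]
  have := hr i
  omega

/-- Modulo `p` the substitution sends `Y_i` to `-[l] ^ (p ^ i) X_i`. For `l ≠ 0` the two monomials
have images differing by the factor `∏ (-[l] ^ (p ^ i)) ^ (p - 1) = [l] ^ (q - 1) = 1`, the sign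
being even; for `l = 0` both images vanish. -/
theorem dvd_subst_some (hp : 2 < p) {r : Fin f → ℕ} (hr : ∀ i, p ≤ r i) (l : Fq p f) :
    C (p : R) ∣ subst ι (heckeRep (some l)).adjugate (monomial (repTop r) 1 - monomial (subTop p r) 1) := by
  rw [← Ideal.Quotient.eq_zero_iff_dvd, map_sub, map_sub, monomial_repTop, monomial_eq_prod]
  have h0 : Ideal.Quotient.mk (Ideal.span {(C (p : R) : MvPolynomial (Fin f × Fin 2) R)}) (C (p : R)) = 0 :=
    Ideal.Quotient.eq_zero_iff_dvd _ _ |>.2 dvd_rfl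
  simp only [map_prod, map_mul, map_pow, subst_some_zero, subst_some_one, map_add, map_neg, h0,
    zero_mul, add_zero, subTop_zero, subTop_one]
  by_cases hl : l = 0
  · subst hl
    have hpos : ∀ i : Fin f, p ^ (i : ℕ) ≠ 0 := fun i => pow_ne_zero _ (Fact.out : p.Prime).ne_zero
    simp only [tch_zero, map_zero, zero_pow (hpos _), neg_zero, zero_mul]
    rw [Finset.prod_eq_zero (Finset.mem_univ (0 : Fin f)) (zero_pow (by have := hr 0; omega)),
      Finset.prod_eq_zero (Finset.mem_univ (0 : Fin f)), sub_zero]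
    rw [zero_pow (by have := hr 0; omega), mul_zero]
  · have heven : Even (p - 1) := (Fact.out : p.Prime).even_sub_one (by omega)
    generalize hψ : Ideal.Quotient.mk (Ideal.span {(C (p : R) : MvPolynomial (Fin f × Fin 2) R)}) = ψ
    have h1 : ∏ i : Fin f, (ψ (C (tch ι l)) ^ p ^ (i : ℕ)) ^ (p - 1) = 1 := by
      simp only [← pow_mul]
      rw [Finset.prod_pow_eq_pow_sum]
      simp only [mul_comm _ (p - 1)]
      rw [sum_pred_mul_pow, ← map_pow, ← map_pow, tch_pow_sub_one ι hl, map_one, map_one]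
    rw [sub_eq_zero]
    conv_rhs => rw [← one_mul (∏ i : Fin f, _), ← h1, ← Finset.prod_mul_distrib]
    refine Finset.prod_congr rfl fun i _ => ?_
    have hri : r i = p - 1 + (r i - (p - 1)) := by have := hr i; omega
    conv_lhs => rw [hri, pow_add, mul_pow, heven.neg_pow]
    ring

/-- Here `X_i ↦ p X_i` and `Y_i` is fixed, so modulo `p` only `∏ Y_i ^ r_i` remains. -/
theorem dvd_subst_none (hp : 2 < p) (r : Fin f → ℕ) :
    C (p : R) ∣ subst ι (heckeRep (none : Option (Fq p f))).adjugate
      (monomial (repTop r) 1 - monomial (subTop p r) 1) - monomial (repTop r) 1 := by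
  rw [map_sub, monomial_repTop, monomial_eq_prod]
  simp only [map_prod, map_mul, map_pow, subst_none_zero, subst_none_one, subTop_zero, subTop_one]
  rw [sub_sub_cancel_left, dvd_neg]
  refine Dvd.dvd.trans ?_ (Finset.dvd_prod_of_mem _ (Finset.mem_univ (0 : Fin f)))
  exact ((dvd_mul_right _ _).trans (dvd_pow_self _ (by omega))).mul_right _

end HeckeRep

/-! ### The test vector and its image under `T` modulo `p ^ 2` -/

section TestVector

open WittVector (teichmuller)

variable (p f) in
/-- The matrix `(0 1; 1 c)`. -/
def swapK (c : Zq p f) : K p f := Matrix.GeneralLinearGroup.mk'' !![0, 1; 1, c] (by simp)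

variable [NeZero f]

/-- `∑ [l]^{q-1-p} ∏ (1 - [l m]^{p^i})^{r_i}`. -/
def momentCoeff (r : Fin f → ℕ) (m : Fq p f) : Zq p f :=
  ∑ l : Fq p f, teichmuller p l ^ (p ^ f - 1 - p) * ∏ i : Fin f, (1 - (teichmuller p l * teichmuller p m) ^ p ^ (i : ℕ)) ^ r i

/-- The logarithmic derivative of `momentCoeff` in the direction `i`. -/
def derivCoeff (r : Fin f → ℕ) (i : Fin f) (m : Fq p f) : Zq p f :=
  ∑ l : Fq p f, teichmuller p l ^ (p ^ f - 1 - p) * ((1 - (teichmuller p l * teichmuller p m) ^ p ^ (i : ℕ)) ^ (r i - 1) *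
    teichmuller p l ^ p ^ (i : ℕ) * ∏ j ∈ Finset.univ.erase i, (1 - (teichmuller p l * teichmuller p m) ^ p ^ (j : ℕ)) ^ r j)

/-- For `m ≠ 0`, replacing `l` by `l m` scales the weight `[l] ^ (q - 1 - p)` by `[m] ^ (-p)`. For
`m = 0` the sum is an exact power sum equal to zero. -/
theorem momentCoeff_eq (hp : 2 < p) (hf : 2 ≤ f) (r : Fin f → ℕ) (m : Fq p f) :
    momentCoeff r m = teichmuller p m ^ p * momentCoeff r 1 := by
  have hq := p_lt_card hp hf
  by_cases hm : m = 0
  · subst hm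
    have hpos : ∀ i : Fin f, p ^ (i : ℕ) ≠ 0 := fun i => pow_ne_zero _ (Fact.out : p.Prime).ne_zero
    rw [WittVector.teichmuller_zero, zero_pow (by omega), zero_mul, momentCoeff]
    simp only [WittVector.teichmuller_zero, mul_zero, zero_pow (hpos _), sub_zero, one_pow,
      Finset.prod_const_one, mul_one]
    exact sum_teichmuller_pow (Nat.not_dvd_of_pos_of_lt (by omega) (by omega))
  · have h1 : momentCoeff r 1 = teichmuller p m ^ (p ^ f - 1 - p) * momentCoeff r m := by
      rw [momentCoeff, momentCoeff, Finset.mul_sum, ← Equiv.sum_comp (Equiv.mulRight₀ m hm)]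
      refine Finset.sum_congr rfl fun l _ => ?_
      rw [Equiv.mulRight₀_apply]
      simp only [map_mul, map_one, mul_one]
      ring
    have h2 : teichmuller p m ^ (p ^ f - 1) = (1 : Zq p f) := tch_pow_sub_one (RingHom.id _) hm
    rw [h1, ← mul_assoc, ← pow_add, Nat.add_sub_of_le (by omega), h2, one_mul]

theorem one_sub_pow_char (x : Fq p f) (n : ℕ) : 1 - x ^ p ^ n = (1 - x) ^ p ^ n := by
  rw [sub_pow_char_pow, one_pow]

/-- Modulo `p` the product becomes `(1 - l) ^ a₀`, so only powers `l ^ (q - 1 - p + n)` with `n ≤ a₀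
< p` occur, and none of these exponents is a multiple of `q - 1`. -/
theorem constantCoeff_momentCoeff (hp : 2 < p) (hf : 2 ≤ f) {r : Fin f → ℕ} {a₀ : ℕ}
    (hr : p ≤ r 0) (ha₁ : 1 ≤ a₀) (ha₂ : a₀ ≤ p - 1)
    (hra : ∑ i : Fin f, r i * p ^ (i : ℕ) ≡ a₀ [MOD p ^ f - 1]) :
    WittVector.constantCoeff (momentCoeff (p := p) r 1) = 0 := by
  have hq := p_lt_card hp hf
  have hpos : 0 < ∑ i : Fin f, r i * p ^ (i : ℕ) := by
    refine lt_of_lt_of_le ?_ (Finset.single_le_sum (fun i _ => Nat.zero_le _) (Finset.mem_univ 0))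
    simp only [Fin.val_zero, pow_zero]
    omega
  have h : ∀ l : Fq p f, l ^ (p ^ f - 1 - p) * ∏ i : Fin f, (1 - l ^ p ^ (i : ℕ)) ^ r i =
      ∑ n ∈ Finset.range (a₀ + 1), ((-1) ^ n * (a₀.choose n : Fq p f)) * l ^ (p ^ f - 1 - p + n) := by
    intro l
    have h1 : ∏ i : Fin f, (1 - l ^ p ^ (i : ℕ)) ^ r i = (-l + 1) ^ a₀ := by
      simp only [one_sub_pow_char, ← pow_mul, mul_comm (p ^ _) (r _)]
      rw [Finset.prod_pow_eq_pow_sum, pow_congr hpos ha₁ hra]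
      ring
    rw [h1, add_pow, Finset.mul_sum]
    refine Finset.sum_congr rfl fun n _ => ?_
    rw [one_pow, neg_pow l, pow_add]
    ring
  rw [momentCoeff, map_sum]
  simp only [map_mul, map_prod, map_pow, map_sub, map_one, mul_one, constantCoeff_teichmuller, h]
  rw [Finset.sum_comm]
  refine Finset.sum_eq_zero fun n hn => ?_
  have hn' := Finset.mem_range.1 hn
  rw [← Finset.mul_sum]
  have := sum_pow_Fq (RingHom.id (Fq p f)) (p ^ f - 1 - p + n)
  rw [if_neg fun h => Nat.not_dvd_of_pos_of_lt h.1 (by omega) h.2] at this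
  simp only [RingHom.id_apply] at this
  rw [this, mul_zero]

/-- Modulo `p` the powers of `l` combine to `l ^ (q - 1)`, the indicator of `l ≠ 0`, which explains
the exponent `q - 1 - p`. What is left is the sum of `(1 - l m) ^ E` over `l ≠ 0`, where `E = ∑ r_i
p ^ i - p`. The sum over all `l` vanishes, since `q - 1 ∤ E` if `m ≠ 0` and since there are `q`
equal terms if `m = 0`; removing `l = 0` leaves `-1`. -/
theorem constantCoeff_derivCoeff (hp : 2 < p) (hf : 2 ≤ f) {r : Fin f → ℕ} {a₀ : ℕ}
    (hr : ∀ i, p ^ f ≤ r i) (ha₂ : a₀ ≤ p - 1)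
    (hra : ∑ i : Fin f, r i * p ^ (i : ℕ) ≡ a₀ [MOD p ^ f - 1]) (m : Fq p f) :
    WittVector.constantCoeff (derivCoeff r 1 m) = -1 := by
  classical
  have hq := p_lt_card hp hf
  set E := p * (r 1 - 1) + ∑ j ∈ Finset.univ.erase (1 : Fin f), p ^ (j : ℕ) * r j with hE
  have hE1 : E + p = ∑ i : Fin f, r i * p ^ (i : ℕ) := by
    rw [← Finset.add_sum_erase _ _ (Finset.mem_univ (1 : Fin f)), val_one_Fin hf, pow_one, hE]
    simp only [mul_comm (p ^ _) (r _)]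
    obtain ⟨n, hn⟩ : ∃ n, r 1 = n + 1 := ⟨r 1 - 1, by have := hr 1; omega⟩
    rw [hn, Nat.add_sub_cancel]
    ring
  have hE0 : 0 < E := by
    have : p * 1 ≤ p * (r 1 - 1) := Nat.mul_le_mul_left _ (by have := hr 1; omega)
    omega
  have hEd : ¬ p ^ f - 1 ∣ E := by
    intro h
    have h1 : p ≡ a₀ [MOD p ^ f - 1] := by
      refine Nat.ModEq.trans ?_ (hE1 ▸ hra)
      exact (Nat.modEq_iff_dvd' (Nat.le_add_left _ _)).2 (by simpa using h)
    have h2 := Nat.ModEq.eq_of_lt_of_lt h1 (by omega) (by omega)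
    omega
  have h : ∀ l : Fq p f, l ^ (p ^ f - 1 - p) * ((1 - (l * m) ^ p ^ ((1 : Fin f) : ℕ)) ^ (r 1 - 1) *
      l ^ p ^ ((1 : Fin f) : ℕ) *
        ∏ j ∈ Finset.univ.erase (1 : Fin f), (1 - (l * m) ^ p ^ (j : ℕ)) ^ r j) =
      (1 - l * m) ^ E - if l = 0 then 1 else 0 := by
    intro l
    simp only [one_sub_pow_char, ← pow_mul]
    rw [Finset.prod_pow_eq_pow_sum, val_one_Fin hf, pow_one,
      show ∀ a b c d : Fq p f, a * (b * c * d) = a * c * (b * d) by intros; ring, ← pow_add,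
      ← pow_add, ← hE, Nat.sub_add_cancel (by omega)]
    split_ifs with hl
    · rw [hl, zero_pow (by omega), zero_mul, zero_mul, sub_zero, one_pow, sub_self]
    · rw [← card_Fq (p := p) (f := f), FiniteField.pow_card_sub_one_eq_one l hl, one_mul, sub_zero]
  rw [derivCoeff, map_sum]
  simp only [map_mul, map_prod, map_pow, map_sub, map_one, constantCoeff_teichmuller, h]
  rw [Finset.sum_sub_distrib, Finset.sum_ite_eq', if_pos (Finset.mem_univ _), sub_eq_neg_self]
  by_cases hm : m = 0
  · subst hm
    simp only [mul_zero, sub_zero, one_pow, Finset.sum_const, Finset.card_univ, nsmul_one]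
    exact FiniteField.cast_card_eq_zero _
  · have := sum_pow_Fq (RingHom.id (Fq p f)) E
    rw [if_neg fun h => hEd h.2] at this
    rw [← this]
    exact Equiv.sum_comp ((Equiv.mulRight₀ m hm).trans (Equiv.subLeft 1)) fun x => x ^ E

/-- The exponent of `∏ X_j^{r_j} · Y_i^n / X_i^n`. -/
def shiftBot {f : ℕ} (r : Fin f → ℕ) (i : Fin f) (n : ℕ) : Fin f × Fin 2 →₀ ℕ :=
  Finsupp.equivFunOnFinite.symm fun x => if x.1 = i then (if x.2 = 0 then r i - n else n)
    else if x.2 = 0 then r x.1 else 0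

theorem shiftBot_zero (r : Fin f → ℕ) (i j : Fin f) (n : ℕ) :
    shiftBot r i n (j, 0) = if j = i then r i - n else r j := rfl

theorem shiftBot_one (r : Fin f → ℕ) (i j : Fin f) (n : ℕ) :
    shiftBot r i n (j, 1) = if j = i then n else 0 := rfl

theorem shiftBot_add {r : Fin f → ℕ} {i : Fin f} {n : ℕ} (h : n ≤ r i) (j : Fin f) :
    shiftBot r i n (j, 0) + shiftBot r i n (j, 1) = r j := by
  rw [shiftBot_zero, shiftBot_one]
  split_ifs with hj
  · subst hj
    omega
  · rfl

theorem monomial_shiftBot {R : Type*} [CommRing R] (r : Fin f → ℕ) (i : Fin f) (n : ℕ) :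
    (monomial (shiftBot r i n) 1 : MvPolynomial (Fin f × Fin 2) R) =
      X (i, 0) ^ (r i - n) * X (i, 1) ^ n * ∏ j ∈ Finset.univ.erase i, X (j, 0) ^ r j := by
  rw [monomial_eq_prod, ← Finset.mul_prod_erase _ _ (Finset.mem_univ i), shiftBot_zero,
    shiftBot_one, if_pos rfl, if_pos rfl]
  congr 1
  refine Finset.prod_congr rfl fun j hj => ?_
  rw [shiftBot_zero, shiftBot_one, if_neg (Finset.ne_of_mem_erase hj),
    if_neg (Finset.ne_of_mem_erase hj), pow_zero, mul_one]

variable {R : Type*} [CommRing R] (ι : Zq p f →+* R)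

/-- The vector `∑ [l]^{q-1-p} ∏ (X_i + [l]^{p^i} Y_i)^{r_i} + c ∏ X_i^{r_i} Y_0^p / X_0^p`. -/
def testVec (r : Fin f → ℕ) (hr : p ≤ r 0) : SymMod ι r 0 :=
  ∑ l : Fq p f, tch ι l ^ (p ^ f - 1 - p) •
    (MonoidAlgebra.of R (K p f) (swapK p f (teichmuller p l)) • symMono ι 0 (repTop_add r) 1) +
  ι (momentCoeff r 1) • symMono ι 0 (shiftBot_add hr) 1

theorem swapK_val (c : Zq p f) :
    (swapK p f c : Matrix (Fin 2) (Fin 2) (Zq p f)) = !![0, 1; 1, c] := rfl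

theorem testVec_val (r : Fin f → ℕ) (hr : p ≤ r 0) :
    (symEquiv ι r 0 (testVec ι r hr)).1 =
      ∑ l : Fq p f, C (tch ι l ^ (p ^ f - 1 - p)) *
        ∏ i : Fin f, (X (i, 0) + C (tch ι l ^ p ^ (i : ℕ)) * X (i, 1)) ^ r i +
      C (ι (momentCoeff r 1)) * monomial (shiftBot r 0 p) 1 := by
  rw [testVec, map_add, map_sum]
  simp only [map_smul, Submodule.coe_add, AddSubmonoidClass.coe_finsetSum, Submodule.coe_smul,
    of_smul_val, symMono_val, pow_zero, C_1, one_mul, smul_eq_C_mul]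
  congr 1
  refine Finset.sum_congr rfl fun l _ => ?_
  congr 1
  rw [monomial_repTop, map_prod]
  refine Finset.prod_congr rfl fun i _ => ?_
  rw [map_pow]
  congr 1
  simp [subst, swapK_val, Fin.sum_univ_two, frobenius_pow_teichmuller, tch, -RingHom.coe_pow]

theorem exists_momentCoeff_eq (hp : 2 < p) (hf : 2 ≤ f) {r : Fin f → ℕ} {a₀ : ℕ}
    (hr : p ≤ r 0) (ha₁ : 1 ≤ a₀) (ha₂ : a₀ ≤ p - 1)
    (hra : ∑ i : Fin f, r i * p ^ (i : ℕ) ≡ a₀ [MOD p ^ f - 1]) :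
    ∃ c : R, ι (momentCoeff (p := p) r 1) = p * c := by
  obtain ⟨c, hc⟩ := (dvd_iff_coeff _).2 (constantCoeff_momentCoeff hp hf hr ha₁ ha₂ hra)
  exact ⟨ι c, by rw [hc, map_mul, map_natCast]⟩

/-- Each factor becomes `(1 - [l m] ^ (p ^ i)) X_i + p [l] ^ (p ^ i) Y_i`. The zeroth-order term is
`[m] ^ p momentCoeff r 1 ∏ X_i ^ r_i`. It is cancelled modulo `p ^ 2` by the correction term of the
test vector, because `Y_0 ^ p ↦ -[m] ^ p X_0 ^ p` modulo `p` and `momentCoeff r 1` is itself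
divisible by `p`. The first-order term is the stated one. -/
theorem sq_dvd_subst_some_testVec (hp : 2 < p) (hf : 2 ≤ f) {r : Fin f → ℕ} {a₀ : ℕ}
    (hr : p ≤ r 0) (ha₁ : 1 ≤ a₀) (ha₂ : a₀ ≤ p - 1)
    (hra : ∑ i : Fin f, r i * p ^ (i : ℕ) ≡ a₀ [MOD p ^ f - 1]) (m : Fq p f) :
    C (p : R) ^ 2 ∣ subst ι (heckeRep (some m)).adjugate (symEquiv ι r 0 (testVec ι r hr)).1 -
      C (p : R) * ∑ i : Fin f, monomial (shiftBot r i 1) (r i * ι (derivCoeff r i m)) := by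
  classical
  obtain ⟨c, hc⟩ := exists_momentCoeff_eq ι hp hf hr ha₁ ha₂ hra
  set a : Fq p f → Fin f → MvPolynomial (Fin f × Fin 2) R := fun l i =>
    C (ι (1 - (teichmuller p l * teichmuller p m) ^ p ^ (i : ℕ))) * X (i, 0) with ha
  set b : Fq p f → Fin f → MvPolynomial (Fin f × Fin 2) R := fun l i =>
    C (ι (teichmuller p l ^ p ^ (i : ℕ))) * X (i, 1) with hb
  have hfac : ∀ l (i : Fin f), subst ι (heckeRep (some m)).adjugate
      (X (i, 0) + C (tch ι l ^ p ^ (i : ℕ)) * X (i, 1)) = a l i + C (p : R) * b l i := by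
    intro l i
    rw [map_add, map_mul, subst_some_zero, subst_some_one, algHom_C, algebraMap_eq, ha, hb]
    simp only [tch, map_sub, map_one, map_pow, map_mul, mul_pow]
    ring
  choose w hw using fun l => sq_dvd_prod_sub (C (p : R)) (a l) (b l) r Finset.univ
  have hw' : ∀ l, ∏ i, (a l i + C (p : R) * b l i) ^ r i = ∏ i, a l i ^ r i +
      C (p : R) * ∑ i, (r i : MvPolynomial (Fin f × Fin 2) R) * (a l i ^ (r i - 1) * b l i * ∏ j ∈ Finset.univ.erase i, a l j ^ r j) +
      C (p : R) ^ 2 * w l := fun l => by linear_combination hw l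
  obtain ⟨s, hs⟩ : C (p : R) ∣ subst ι (heckeRep (some m)).adjugate (monomial (shiftBot r 0 p) 1) +
      C (tch ι m ^ p) * ∏ i, X (i, 0) ^ r i := by
    have hodd : Odd p := (Fact.out : p.Prime).odd_of_ne_two (by omega)
    rw [monomial_shiftBot, map_mul, map_mul, map_pow, map_pow, map_prod, subst_some_zero,
      subst_some_one]
    simp only [map_pow, subst_some_zero]
    rw [← Finset.mul_prod_erase _ _ (Finset.mem_univ (0 : Fin f))]
    have h1 := sub_dvd_pow_sub_pow
      (-(C (tch ι m) ^ p ^ ((0 : Fin f) : ℕ)) * X (0, 0) + C (p : R) * X (0, 1))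
      (-(C (tch ι m) ^ p ^ ((0 : Fin f) : ℕ)) * X ((0 : Fin f), (0 : Fin 2))) p
    rw [add_sub_cancel_left] at h1
    obtain ⟨t, ht⟩ := (dvd_mul_right _ _).trans h1
    rw [sub_eq_iff_eq_add] at ht
    have h2 : r 0 = r 0 - p + p := by omega
    refine ⟨X (0, 0) ^ (r 0 - p) * t * ∏ j ∈ Finset.univ.erase 0, X (j, 0) ^ r j, ?_⟩
    rw [ht, Fin.val_zero, pow_zero, pow_one, neg_mul, hodd.neg_pow, mul_pow]
    conv_lhs => enter [2, 2, 1]; rw [h2, pow_add]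
    ring
  rw [← eq_sub_iff_add_eq] at hs
  have h0 : ∑ l : Fq p f, C (tch ι l ^ (p ^ f - 1 - p)) * ∏ i, a l i ^ r i =
      C (tch ι m ^ p) * C (ι (momentCoeff r 1)) * ∏ i, X (i, 0) ^ r i := by
    have : tch ι m ^ p * ι (momentCoeff r 1) = ι (momentCoeff r m) := by
      rw [momentCoeff_eq hp hf r m, map_mul, map_pow, tch]
    rw [← C_mul, this, momentCoeff, map_sum, map_sum, Finset.sum_mul]
    refine Finset.sum_congr rfl fun l _ => ?_
    simp only [ha, mul_pow, Finset.prod_mul_distrib, map_mul, map_prod, map_pow, tch]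
    ring
  have h1 : ∑ l : Fq p f, C (tch ι l ^ (p ^ f - 1 - p)) * ∑ i, (r i : MvPolynomial (Fin f × Fin 2) R) * (a l i ^ (r i - 1) * b l i *
      ∏ j ∈ Finset.univ.erase i, a l j ^ r j) =
      ∑ i : Fin f, monomial (shiftBot r i 1) (r i * ι (derivCoeff r i m)) := by
    simp only [Finset.mul_sum]
    rw [Finset.sum_comm]
    refine Finset.sum_congr rfl fun i _ => ?_
    rw [← mul_one ((r i : R) * _), ← C_mul_monomial, monomial_shiftBot, derivCoeff, map_sum,
      Finset.mul_sum, map_sum, Finset.sum_mul]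
    refine Finset.sum_congr rfl fun l _ => ?_
    simp only [ha, hb, mul_pow, Finset.prod_mul_distrib, map_mul, map_prod, map_pow, tch,
      map_natCast, pow_one]
    ring
  refine ⟨∑ l : Fq p f, C (tch ι l ^ (p ^ f - 1 - p)) * w l + C c * s, ?_⟩
  have hl : ∀ l, subst ι (heckeRep (some m)).adjugate (C (tch ι l ^ (p ^ f - 1 - p)) *
      ∏ i : Fin f, (X (i, 0) + C (tch ι l ^ p ^ (i : ℕ)) * X (i, 1)) ^ r i) =
      C (tch ι l ^ (p ^ f - 1 - p)) * ∏ i, (a l i + C (p : R) * b l i) ^ r i := by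
    intro l
    rw [map_mul, algHom_C, algebraMap_eq, map_prod]
    congr 1
    exact Finset.prod_congr rfl fun i _ => by rw [map_pow, hfac]
  rw [testVec_val, map_add, map_sum, map_mul, algHom_C, algebraMap_eq, hs, ← h1]
  simp only [hl, hw', mul_add, Finset.sum_add_distrib, h0]
  simp only [mul_left_comm _ (C (p : R)) _, mul_left_comm _ (C (p : R) ^ 2) _, ← Finset.mul_sum]
  rw [hc]
  simp only [map_mul]
  ring

/-- The zeroth- and first-order terms are sums of Teichmüller powers with exponents congruent to `a₀
- p` and `a₀ - p - p ^ i` modulo `q - 1`. Neither is `0`, so these terms vanish exactly. In the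
correction term one `p` comes from `momentCoeff` and another from `X_1 ^ r_1`. -/
theorem sq_dvd_subst_none_testVec (hp : 2 < p) (hf : 2 ≤ f) {r : Fin f → ℕ} {a₀ : ℕ}
    (hr : ∀ i, p ^ f ≤ r i) (hr' : p ≤ r 0) (ha₁ : 1 ≤ a₀) (ha₂ : a₀ ≤ p - 1)
    (hra : ∑ i : Fin f, r i * p ^ (i : ℕ) ≡ a₀ [MOD p ^ f - 1]) :
    C (p : R) ^ 2 ∣ subst ι (heckeRep (none : Option (Fq p f))).adjugate
      (symEquiv ι r 0 (testVec ι r hr')).1 := by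
  classical
  have hq := p_lt_card hp hf
  obtain ⟨c, hc⟩ := exists_momentCoeff_eq ι hp hf hr' ha₁ ha₂ hra
  rw [testVec_val, map_add, map_sum]
  refine dvd_add ?_ ?_
  · have hfac : ∀ l (i : Fin f), subst ι (heckeRep (none : Option (Fq p f))).adjugate
        (X (i, 0) + C (tch ι l ^ p ^ (i : ℕ)) * X (i, 1)) =
        C (tch ι l ^ p ^ (i : ℕ)) * X (i, 1) + C (p : R) * X (i, 0) := by
      intro l i
      rw [map_add, map_mul, subst_none_zero, subst_none_one, algHom_C, algebraMap_eq, add_comm]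
    choose w hw using fun l => sq_dvd_prod_sub (C (p : R))
      (fun i : Fin f => C (tch ι l ^ p ^ (i : ℕ)) * X (i, 1))
      (fun i => (X (i, 0) : MvPolynomial (Fin f × Fin 2) R)) r Finset.univ
    have hw' := fun l => sub_eq_iff_eq_add.1 (hw l)
    have hmain : ∑ l : Fq p f, C (tch ι l ^ (p ^ f - 1 - p)) *
        ∏ i : Fin f, (C (tch ι l ^ p ^ (i : ℕ)) * X (i, 1)) ^ r i =
        (0 : MvPolynomial (Fin f × Fin 2) R) := by
      have h1 : ∀ l : Fq p f, C (tch ι l ^ (p ^ f - 1 - p)) *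
          ∏ i : Fin f, (C (tch ι l ^ p ^ (i : ℕ)) * X (i, 1)) ^ r i =
          C (tch ι l ^ (p ^ f - 1 - p + ∑ i : Fin f, r i * p ^ (i : ℕ))) *
            ∏ i : Fin f, (X (i, 1) : MvPolynomial (Fin f × Fin 2) R) ^ r i := by
        intro l
        simp only [mul_pow, Finset.prod_mul_distrib, ← map_pow, ← pow_mul, ← map_prod]
        rw [Finset.prod_pow_eq_pow_sum, ← mul_assoc, ← C_mul, ← pow_add]
        simp only [mul_comm (p ^ _) (r _)]
      rw [Finset.sum_congr rfl fun l _ => h1 l, ← Finset.sum_mul, ← map_sum, sum_tch_pow, map_zero,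
        zero_mul]
      intro h
      have h2 : p ^ f - 1 - p + ∑ i : Fin f, r i * p ^ (i : ℕ) ≡ p ^ f - 1 - p + a₀
        [MOD p ^ f - 1] := hra.add_left _
      exact Nat.not_dvd_of_pos_of_lt (by omega) (by omega) ((h2.dvd_iff dvd_rfl).1 h)
    have hder : ∀ i : Fin f, ∑ l : Fq p f, C (tch ι l ^ (p ^ f - 1 - p)) *
        ((r i : MvPolynomial (Fin f × Fin 2) R) * ((C (tch ι l ^ p ^ (i : ℕ)) * X (i, 1)) ^ (r i - 1) * X (i, 0) *
          ∏ j ∈ Finset.univ.erase i, (C (tch ι l ^ p ^ (j : ℕ)) * X (j, 1)) ^ r j)) =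
        (0 : MvPolynomial (Fin f × Fin 2) R) := by
      intro i
      set E := p ^ (i : ℕ) * (r i - 1) + ∑ j ∈ Finset.univ.erase i, p ^ (j : ℕ) * r j with hE
      have hE1 : E + p ^ (i : ℕ) = ∑ i : Fin f, r i * p ^ (i : ℕ) := by
        rw [← Finset.add_sum_erase _ _ (Finset.mem_univ i), hE]
        simp only [mul_comm (p ^ _) (r _)]
        obtain ⟨n, hn⟩ : ∃ n, r i = n + 1 := ⟨r i - 1, by have := hr i; omega⟩
        rw [hn, Nat.add_sub_cancel]
        ring
      have h1 : ∀ l : Fq p f, C (tch ι l ^ (p ^ f - 1 - p)) *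
        ((r i : MvPolynomial (Fin f × Fin 2) R) * ((C (tch ι l ^ p ^ (i : ℕ)) * X (i, 1)) ^ (r i - 1) * X (i, 0) *
          ∏ j ∈ Finset.univ.erase i, (C (tch ι l ^ p ^ (j : ℕ)) * X (j, 1)) ^ r j)) =
          C (tch ι l ^ (p ^ f - 1 - p + E)) * ((r i : MvPolynomial (Fin f × Fin 2) R) * (X (i, 1) ^ (r i - 1) * X (i, 0) *
          ∏ j ∈ Finset.univ.erase i, (X (j, 1) : MvPolynomial (Fin f × Fin 2) R) ^ r j)) := by
        intro l
        simp only [mul_pow, Finset.prod_mul_distrib, ← map_pow, ← pow_mul, ← map_prod]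
        rw [Finset.prod_pow_eq_pow_sum, hE, pow_add, pow_add]
        simp only [map_mul]
        ring
      rw [Finset.sum_congr rfl fun l _ => h1 l, ← Finset.sum_mul, ← map_sum, sum_tch_pow, map_zero,
        zero_mul]
      intro h
      have h2 : p ^ f - 1 - p + E + (p + p ^ (i : ℕ)) ≡ a₀ [MOD p ^ f - 1] := by
        rw [show p ^ f - 1 - p + E + (p + p ^ (i : ℕ)) = E + p ^ (i : ℕ) + (p ^ f - 1) by omega, hE1]
        exact (modEq_sub_one rfl).trans hra
      have h3 : 0 + (p + p ^ (i : ℕ)) ≡ a₀ [MOD p ^ f - 1] :=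
        ((Nat.modEq_zero_iff_dvd.2 h).symm.add_right _).trans h2
      rw [zero_add] at h3
      have h4 : p ^ (i : ℕ) * p ≤ p ^ f := by
        rw [← pow_succ]
        exact Nat.pow_le_pow_right (by omega) i.2
      have h5 : p + p ^ (i : ℕ) < p ^ f - 1 := by
        rcases Nat.eq_zero_or_pos (i : ℕ) with h0 | h0
        · rw [h0, pow_zero]
          omega
        · have := Nat.le_self_pow h0.ne' p
          have h4' : p ^ (i : ℕ) * 3 ≤ p ^ f := (Nat.mul_le_mul_left _ hp).trans h4
          omega
      have h6 := Nat.ModEq.eq_of_lt_of_lt h3 h5 (by omega)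
      omega
    refine ⟨∑ l : Fq p f, C (tch ι l ^ (p ^ f - 1 - p)) * w l, ?_⟩
    have hl : ∀ l, subst ι (heckeRep (none : Option (Fq p f))).adjugate
        (C (tch ι l ^ (p ^ f - 1 - p)) *
          ∏ i : Fin f, (X (i, 0) + C (tch ι l ^ p ^ (i : ℕ)) * X (i, 1)) ^ r i) =
        C (tch ι l ^ (p ^ f - 1 - p)) *
          ∏ i : Fin f, (C (tch ι l ^ p ^ (i : ℕ)) * X (i, 1) + C (p : R) * X (i, 0)) ^ r i := by
      intro l
      rw [map_mul, algHom_C, algebraMap_eq, map_prod]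
      congr 1
      exact Finset.prod_congr rfl fun i _ => by rw [map_pow, hfac]
    simp only [hl, hw', mul_add, Finset.sum_add_distrib, hmain]
    simp only [mul_left_comm _ (C (p : R)) _, mul_left_comm _ (C (p : R) ^ 2) _, ← Finset.mul_sum]
    simp only [Finset.mul_sum (s := (Finset.univ : Finset (Fin f)))]
    rw [Finset.sum_comm]
    simp only [hder]
    simp [Finset.mul_sum]
  · rw [map_mul, algHom_C, algebraMap_eq, hc, C_mul, pow_two, mul_assoc]
    refine mul_dvd_mul dvd_rfl (Dvd.dvd.mul_left ?_ _)
    rw [monomial_eq_prod, map_prod]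
    refine Dvd.dvd.trans ?_ (Finset.dvd_prod_of_mem _ (Finset.mem_univ (1 : Fin f)))
    rw [map_mul, map_pow, subst_none_zero, shiftBot_zero, if_neg (one_ne_zero_Fin hf)]
    exact ((dvd_mul_right _ _).trans (dvd_pow_self _ (by have := hr 1; omega))).mul_right _

end TestVector

/-! ### Compatibility with extension of scalars -/

section BaseChange

variable {R R' : Type*} [CommRing R] [CommRing R'] (φ : R →+* R') (ι : Zq p f →+* R)

theorem map_subst (m : Matrix (Fin 2) (Fin 2) (Zq p f)) (v : MvPolynomial (Fin f × Fin 2) R) :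
    MvPolynomial.map φ (subst ι m v) = subst (φ.comp ι) m (MvPolynomial.map φ v) := by
  have h : (MvPolynomial.map φ).comp (subst ι m).toRingHom =
      (subst (φ.comp ι) m).toRingHom.comp (MvPolynomial.map φ) := by
    refine MvPolynomial.ringHom_ext (fun c => ?_) (fun x => ?_)
    · simp
    · simp [subst]
  exact RingHom.congr_fun h v

theorem cIndBaseChange_heckeT (r : Fin f → ℕ) (s : ℕ) (F : cInd (p := p) (f := f) R (SymMod ι r s)) :
    cIndBaseChange φ ι r s (heckeT ι r s F) = heckeT (φ.comp ι) r s (cIndBaseChange φ ι r s F) := by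
  ext g : 2
  change (symEquiv (φ.comp ι) r s).symm (symMap φ r (symEquiv ι r s (∑ z : Option (Fq p f), _))) =
    ∑ z : Option (Fq p f), _
  rw [map_sum, map_sum, map_sum]
  exact Finset.sum_congr rfl fun z _ => Subtype.ext (map_subst φ ι _ _)

theorem symMap_symMono {r : Fin f → ℕ} (s : ℕ) {d : Fin f × Fin 2 →₀ ℕ}
    (hd : ∀ i, d (i, 0) + d (i, 1) = r i) (c : R) :
    (symEquiv (φ.comp ι) r s).symm (symMap φ r (symEquiv ι r s (symMono ι s hd c))) =
      symMono (φ.comp ι) s hd (φ c) :=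
  Subtype.ext (map_monomial φ d c)

theorem symMono_smul {r : Fin f → ℕ} (s : ℕ) {d : Fin f × Fin 2 →₀ ℕ}
    (hd : ∀ i, d (i, 0) + d (i, 1) = r i) (c c' : R) :
    symMono ι s hd (c * c') = c • symMono ι s hd c' :=
  Subtype.ext (smul_monomial c).symm

/-- A semilinear map factors through a surjective semilinear map that kills its kernel. -/
theorem exists_linearMap_comp_eq_of_semilinear (hφ : Function.Surjective φ) {A B D : Type*}
    [AddCommGroup A] [Module R A] [AddCommGroup B] [Module R' B] [AddCommGroup D] [Module R' D]
    (σ : A →ₛₗ[φ] B) (g : A →ₛₗ[φ] D) (hσ : Function.Surjective σ) (h : ∀ a, σ a = 0 → g a = 0) :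
    ∃ Φ : B →ₗ[R'] D, ∀ a, Φ (σ a) = g a := by
  have key : ∀ a a', σ a = σ a' → g a = g a' := fun a a' e => by
    rw [← sub_eq_zero, ← map_sub]
    exact h _ (by rw [map_sub, e, sub_self])
  have hs := Function.surjInv_eq hσ
  refine ⟨⟨⟨fun b => g (Function.surjInv hσ b), fun b b' => ?_⟩, fun c b => ?_⟩,
    fun a => key _ _ (hs _)⟩
  · rw [← map_add]
    exact key _ _ (by rw [map_add, hs, hs, hs])
  · obtain ⟨c, rfl⟩ := hφ c
    change g _ = φ c • g _
    rw [← map_smulₛₗ]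
    exact key _ _ (by rw [map_smulₛₗ, hs, hs])

theorem cIndBaseChange_surjective (hφ : Function.Surjective φ) (r : Fin f → ℕ) (s : ℕ) :
    Function.Surjective (cIndBaseChange (p := p) φ ι r s) := by
  intro F
  refine cInd_mem_of_br_mem (AddMonoidHom.range (cIndBaseChange φ ι r s).toAddMonoidHom) F
    fun h => ?_
  generalize F.1 h = v
  rw [eq_sum_symMono v, map_sum]
  refine AddSubgroup.sum_mem _ fun d _ => ?_
  obtain ⟨c, hc⟩ := hφ (coeff d.1 (symEquiv (φ.comp ι) r s v).1)
  refine ⟨br h⁻¹ (symMono ι s ((mem_symSpace_iff _ _).1 (symEquiv _ r s v).2 d.1 d.2) c), ?_⟩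
  change cIndBaseChange φ ι r s _ = _
  rw [cIndBaseChange_br, symMap_symMono, hc]

end BaseChange

/-! ### Integral relations for the Hecke operator -/

section HeckeRelations

variable {R : Type*} [CommRing R] [IsDomain R] (ι : Zq p f →+* R) [NeZero f]

/-- Applying `T` to `∏ Y_i ^ r_i - ∏ X_i ^ (p - 1) Y_i ^ (r_i - p + 1)` leaves only the `α`-term
modulo `p`, and this term is `∏ Y_i ^ r_i`. The base point `g α⁻¹` places it at `g`. -/
theorem exists_eq_heckeT_add (hp0 : (p : R) ≠ 0) (hp : 2 < p) {r : Fin f → ℕ} (hr : ∀ i, p ≤ r i)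
    (g : G p f) : ∃ H F : cInd (p := p) (f := f) R (SymMod ι r 0),
      br g (symMono ι 0 (repTop_add r) 1) = heckeT ι r 0 H + (p : R) • F := by
  classical
  let v : SymMod ι r 0 := symMono ι 0 (repTop_add r) 1 - symMono ι 0 (subTop_add hr) 1
  have h1 : ∀ l : Fq p f, ∃ w, symModAct ι r 0 (heckeRep (some l)).adjugate v = (p : R) • w :=
    fun l => exists_eq_smul_of_dvd ι hp0 _ (dvd_subst_some ι hp hr l)
  choose w hw using h1
  obtain ⟨w', hw'⟩ := exists_eq_smul_of_dvd ι hp0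
    (symModAct ι r 0 (heckeRep (none : Option (Fq p f))).adjugate v -
      symMono ι 0 (repTop_add r) 1) (dvd_subst_none ι hp r)
  refine ⟨br (g * (heckeG none)⁻¹) v, -(br g w' +
    ∑ l : Fq p f, br (g * (heckeG none)⁻¹ * heckeG (some l)) (w l)), ?_⟩
  rw [heckeT_br, Fintype.sum_option, inv_mul_cancel_right, sub_eq_iff_eq_add.1 hw', map_add,
    smul_neg, smul_add, Finset.smul_sum]
  simp only [hw, map_smul]
  abel

/-- The test vector is a combination of `K`-translates of `∏ Y_i ^ r_i`, up to a correction
divisible by `p`. -/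
theorem exists_testVec_eq_heckeT_add (hp0 : (p : R) ≠ 0) (hp : 2 < p) (hf : 2 ≤ f) {r : Fin f → ℕ} {a₀ : ℕ}
    (hr : ∀ i, p ≤ r i) (ha₁ : 1 ≤ a₀) (ha₂ : a₀ ≤ p - 1)
    (hra : ∑ i : Fin f, r i * p ^ (i : ℕ) ≡ a₀ [MOD p ^ f - 1]) (g : G p f) :
    ∃ H F : cInd (p := p) (f := f) R (SymMod ι r 0),
      br g (testVec ι r (hr 0)) = heckeT ι r 0 H + (p : R) • F := by
  obtain ⟨c, hc⟩ := exists_momentCoeff_eq ι hp hf (hr 0) ha₁ ha₂ hra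
  choose H F hHF using exists_eq_heckeT_add ι hp0 hp hr
  refine ⟨∑ l : Fq p f, tch ι l ^ (p ^ f - 1 - p) •
      H (g * inclK (swapK p f (WittVector.teichmuller p l))),
    ∑ l : Fq p f, tch ι l ^ (p ^ f - 1 - p) •
      F (g * inclK (swapK p f (WittVector.teichmuller p l))) +
      c • br g (symMono ι 0 (shiftBot_add (hr 0)) 1), ?_⟩
  rw [testVec, map_add, map_sum, map_sum, hc, smul_add, Finset.smul_sum, ← add_assoc,
    ← Finset.sum_add_distrib, map_smul, mul_smul]
  congr 1
  refine Finset.sum_congr rfl fun l _ => ?_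
  rw [map_smul, br_smul, hHF, smul_add, map_smul, smul_comm (p : R)]

theorem exists_heckeT_testVec (hp0 : (p : R) ≠ 0) (hp : 2 < p) (hf : 2 ≤ f) {r : Fin f → ℕ} {a₀ : ℕ}
    (hr : ∀ i, p ^ f ≤ r i) (hr' : ∀ i, p ≤ r i) (hr₁ : ∀ i, 1 ≤ r i) (ha₁ : 1 ≤ a₀)
    (ha₂ : a₀ ≤ p - 1)
    (hra : ∑ i : Fin f, r i * p ^ (i : ℕ) ≡ a₀ [MOD p ^ f - 1]) (g : G p f) :
    ∃ F : cInd (p := p) (f := f) R (SymMod ι r 0),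
      heckeT ι r 0 (br g (testVec ι r (hr' 0))) = (p : R) •
        (∑ m : Fq p f, br (g * heckeG (some m))
          (∑ i : Fin f, symMono ι 0 (shiftBot_add (hr₁ i)) (r i * ι (derivCoeff r i m))) +
          (p : R) • F) := by
  have hp2 : (p : R) ^ 2 ≠ 0 := pow_ne_zero _ hp0
  have h1 : ∀ m : Fq p f, ∃ w, symModAct ι r 0 (heckeRep (some m)).adjugate (testVec ι r (hr' 0)) -
      (p : R) • ∑ i : Fin f, symMono ι 0 (shiftBot_add (hr₁ i)) (r i * ι (derivCoeff r i m)) =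
      (p : R) ^ 2 • w := fun m => by
    refine exists_eq_smul_of_dvd ι hp2 _ ?_
    have := sq_dvd_subst_some_testVec ι hp hf (hr' 0) ha₁ ha₂ hra m
    rw [← C_pow] at this
    convert this using 2
    rw [map_sub, (symEquiv ι r 0).map_smul, map_sum, ← smul_eq_C_mul, AddSubgroupClass.coe_sub,
      Submodule.coe_smul, AddSubmonoidClass.coe_finsetSum]
    rfl
  choose w hw using h1
  obtain ⟨w', hw'⟩ := exists_eq_smul_of_dvd ι hp2
    (symModAct ι r 0 (heckeRep (none : Option (Fq p f))).adjugate (testVec ι r (hr' 0))) (by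
      rw [C_pow]
      exact sq_dvd_subst_none_testVec ι hp hf hr (hr' 0) ha₁ ha₂ hra)
  refine ⟨br (g * heckeG none) w' + ∑ m : Fq p f, br (g * heckeG (some m)) (w m), ?_⟩
  have hw1 := fun m => sub_eq_iff_eq_add.1 (hw m)
  rw [heckeT_br, Fintype.sum_option, hw']
  simp only [hw1, map_add, map_smul, Finset.sum_add_distrib, ← Finset.smul_sum]
  rw [smul_add, smul_smul, ← pow_two, smul_add]
  abel

/-- The polynomials `X_i Y_{i-1}^p - Y_i X_{i-1}^p` over an arbitrary ring. -/
def thetaLift (R : Type*) [CommRing R] (p : ℕ) {f : ℕ} [NeZero f] (i : Fin f) :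
    MvPolynomial (Fin f × Fin 2) R :=
  X (i, 0) * X (i - 1, 1) ^ p - X (i, 1) * X (i - 1, 0) ^ p

/-- For `[l]`, both monomials of `θ_i` become `-[l] ^ (p ^ i) X_i X_{i-1} ^ p` modulo `p`, by
oddness of `p` and `l ^ q = l` at the wrap-around. For `α`, each contains an `X` and picks up a
factor `p`. -/
theorem dvd_subst_thetaLift (hp : 2 < p) (z : Option (Fq p f)) (i : Fin f) :
    C (p : R) ∣ subst ι (heckeRep z).adjugate (thetaLift R p i) := by
  rw [thetaLift]
  cases z with
  | none =>
    simp only [map_sub, map_mul, map_pow, subst_none_zero, subst_none_one]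
    refine dvd_sub ((dvd_mul_right _ _).mul_right _) (Dvd.dvd.mul_left ?_ _)
    exact (dvd_mul_right _ _).trans (dvd_pow_self _ (by omega))
  | some l =>
    have hodd : Odd p := (Fact.out : p.Prime).odd_of_ne_two (by omega)
    simp only [map_sub, map_mul, map_pow, subst_some_zero, subst_some_one]
    have h1 := sub_dvd_pow_sub_pow
      (-(C (tch ι l) ^ p ^ ((i - 1 : Fin f) : ℕ)) * X (i - 1, 0) + C (p : R) * X (i - 1, 1))
      (-(C (tch ι l) ^ p ^ ((i - 1 : Fin f) : ℕ)) * X (i - 1, (0 : Fin 2))) p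
    rw [add_sub_cancel_left] at h1
    obtain ⟨t, ht⟩ := (dvd_mul_right _ _).trans h1
    have h2 : ((C (tch ι l) : MvPolynomial (Fin f × Fin 2) R) ^ p ^ ((i - 1 : Fin f) : ℕ)) ^ p =
        C (tch ι l) ^ p ^ (i : ℕ) := by
      rw [tch, ← C_pow, ← C_pow, ← C_pow, ← map_pow, ← map_pow, ← map_pow, ← map_pow, ← map_pow,
        ← map_pow, pow_pow_sub_one]
    rw [sub_eq_iff_eq_add, neg_mul, hodd.neg_pow, mul_pow, h2] at ht
    refine ⟨X (i, 0) * t - X (i, 1) * X (i - 1, 0) ^ p, ?_⟩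
    rw [neg_mul, ht]
    ring

/-- Substitutions preserve the multigrading. This allows an inhomogeneous lift of a multiple of the
`θ_i` to be replaced by its component of multidegree `r`. -/
theorem subst_weightedHomogeneousComponent (m : Matrix (Fin 2) (Fin 2) (Zq p f)) (r : Fin f → ℕ)
    (W : MvPolynomial (Fin f × Fin 2) R) :
    subst ι m (weightedHomogeneousComponent
      (fun x : Fin f × Fin 2 => (Pi.single x.1 1 : Fin f → ℕ)) r W) =
      weightedHomogeneousComponent (fun x : Fin f × Fin 2 => (Pi.single x.1 1 : Fin f → ℕ)) r
        (subst ι m W) := by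
  classical
  conv_lhs => rw [W.as_sum]
  conv_rhs => rw [W.as_sum]
  simp only [map_sum]
  refine Finset.sum_congr rfl fun d _ => ?_
  have h1 : monomial d (coeff d W) ∈ symSpace R
      (Finsupp.weight (fun x : Fin f × Fin 2 => (Pi.single x.1 1 : Fin f → ℕ)) d) :=
    isWeightedHomogeneous_monomial _ _ _ rfl
  rw [weightedHomogeneousComponent_of_mem h1,
    weightedHomogeneousComponent_of_mem (subst_mem ι m _ _ h1)]
  split_ifs
  · rfl
  · rw [map_zero]

end HeckeRelations

/-! ### Consequences of the integral relations in `Θ̄` -/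

section Reduction

variable {E : Type*} [NormedField E] [IsUltrametricDist E] {ι : Zq p f →+* OE E}
  {r : Fin f → ℕ} {ap : E}

/-- Over `E` the scalar `s` is invertible, so `F = (T - a_p) (s⁻¹ H)`. Only `F` has to be integral,
not `s⁻¹ H`. -/
theorem mem_relations_of_smul_eq {a s : OE E} (ha : (a : E) = ap) (hs : s ≠ 0)
    {F H : cInd (p := p) (f := f) (OE E) (SymMod ι r 0)}
    (h : s • F = heckeT ι r 0 H - a • H) : F ∈ relations ι r ap := by
  have hs' : (s : E) ≠ 0 := fun h0 => hs (Subtype.ext h0)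
  refine ⟨(s : E)⁻¹ • cIndBaseChange (OE E).subtype ι r 0 H, ?_⟩
  have h1 := congrArg (cIndBaseChange (OE E).subtype ι r 0) h
  rw [map_sub, map_smulₛₗ, map_smulₛₗ, cIndBaseChange_heckeT] at h1
  rw [map_smul, LinearMap.sub_apply, LinearMap.smul_apply, LinearMap.id_apply, inv_smul_eq_iff₀ hs',
    ← ha]
  exact h1.symm

theorem toThetaBar_of_mem {F : cInd (p := p) (f := f) (OE E) (SymMod ι r 0)}
    (h : F ∈ relations ι r ap) : toThetaBar ι r ap F = 0 := by
  rw [toThetaBar, (Submodule.Quotient.mk_eq_zero _).2 h, TensorProduct.tmul_zero]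
  rfl

theorem toThetaBar_add (F F' : cInd (p := p) (f := f) (OE E) (SymMod ι r 0)) :
    toThetaBar ι r ap (F + F') = toThetaBar ι r ap F + toThetaBar ι r ap F' := by
  rw [toThetaBar, Submodule.Quotient.mk_add, TensorProduct.tmul_add]
  rfl

theorem toThetaBar_smul (c : OE E) (F : cInd (p := p) (f := f) (OE E) (SymMod ι r 0)) :
    toThetaBar ι r ap (c • F) = IsLocalRing.residue (OE E) c • toThetaBar ι r ap F := by
  rw [toThetaBar, Submodule.Quotient.mk_smul, TensorProduct.tmul_smul]
  exact (algebraMap_smul (kE E) c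
    ((1 : kE E) ⊗ₜ[OE E] (Submodule.Quotient.mk F : Theta ι r ap))).symm

variable (ι r ap) in
/-- `toThetaBar` as a semilinear map. -/
def thetaBarMap : cInd (p := p) (f := f) (OE E) (SymMod ι r 0) →ₛₗ[IsLocalRing.residue (OE E)]
    ThetaBar ι r ap where
  toFun := toThetaBar ι r ap
  map_add' := toThetaBar_add
  map_smul' := toThetaBar_smul

theorem thetaBarMap_smul_eq_zero {c : OE E} (hc : IsLocalRing.residue (OE E) c = 0)
    (F : cInd (p := p) (f := f) (OE E) (SymMod ι r 0)) : thetaBarMap ι r ap (c • F) = 0 := by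
  rw [map_smulₛₗ, hc, zero_smul]

/-- A vector reducing to zero has coefficients in the maximal ideal, which acts as zero on `Θ̄`. -/
theorem thetaBarMap_eq_of_baseChange_eq_zero
    (F : cInd (p := p) (f := f) (OE E) (SymMod ι r 0))
    (hF : cIndBaseChange (IsLocalRing.residue (OE E)) ι r 0 F = 0) : thetaBarMap ι r ap F = 0 := by
  refine cInd_mem_of_br_mem (AddMonoidHom.ker (thetaBarMap ι r ap).toAddMonoidHom) F fun h => ?_
  have h1 : symMap (IsLocalRing.residue (OE E)) r (symEquiv ι r 0 (F.1 h)) = 0 :=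
    congrFun (congrArg Subtype.val hF) h
  generalize F.1 h = v at h1
  rw [eq_sum_symMono v, map_sum]
  refine AddSubgroup.sum_mem _ fun d _ => ?_
  have h2 : IsLocalRing.residue (OE E) (coeff d.1 (symEquiv ι r 0 v).1) = 0 := by
    rw [← coeff_map]
    exact (congrArg (coeff d.1) (congrArg Subtype.val h1)).trans (coeff_zero _)
  rw [← mul_one (coeff d.1 _), symMono_smul, map_smul]
  exact thetaBarMap_smul_eq_zero h2 _

variable (ι r ap) in
theorem exists_redMap : ∃ σ : cInd (p := p) (f := f) (kE E) (SymMod (toK ι) r 0) →ₗ[kE E]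
    ThetaBar ι r ap, ∀ F, σ (cIndBaseChange (IsLocalRing.residue (OE E)) ι r 0 F) =
      toThetaBar ι r ap F :=
  exists_linearMap_comp_eq_of_semilinear _ IsLocalRing.residue_surjective _ (thetaBarMap ι r ap)
    (cIndBaseChange_surjective _ ι IsLocalRing.residue_surjective r 0)
    thetaBarMap_eq_of_baseChange_eq_zero

variable {a b c : OE E}

theorem thetaBarMap_heckeT (ha : (a : E) = ap) (ha' : IsLocalRing.residue (OE E) a = 0)
    (H : cInd (p := p) (f := f) (OE E) (SymMod ι r 0)) :
    thetaBarMap ι r ap (heckeT ι r 0 H) = 0 := by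
  have h := toThetaBar_of_mem (mem_relations_of_smul_eq ha one_ne_zero (one_smul _ (heckeT ι r 0 H - a • H)))
  change thetaBarMap ι r ap _ = 0 at h
  rwa [map_sub, thetaBarMap_smul_eq_zero ha', sub_zero] at h

/-- From `(T - a) H = p F - a H = a (b F - H)`, division by `a` gives a relation that reduces to `H
= 0`. The hypothesis on `b = p / a` is where slope less than `1` is used. -/
theorem thetaBarMap_of_heckeT_eq (ha : (a : E) = ap) (ha0 : a ≠ 0) (hab : a * b = p)
    (hb : IsLocalRing.residue (OE E) b = 0) {H F : cInd (p := p) (f := f) (OE E) (SymMod ι r 0)}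
    (h : heckeT ι r 0 H = (p : OE E) • F) : thetaBarMap ι r ap H = 0 := by
  have h1 : thetaBarMap ι r ap (b • F - H) = 0 := toThetaBar_of_mem
    (mem_relations_of_smul_eq ha ha0 (H := H) (by rw [h, ← hab, smul_sub, mul_smul]))
  rwa [map_sub, thetaBarMap_smul_eq_zero hb, zero_sub, neg_eq_zero] at h1

/-- Expanding, `(T - a) (U + a H) = p D + a (T H - U) - a² H = p (D - a F - c H)`. The hypothesis on
`c = a² / p` is where slope greater than `1/2` is used. -/
theorem thetaBarMap_of_heckeT_eq_smul (ha : (a : E) = ap) (hp0 : (p : OE E) ≠ 0)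
    (ha' : IsLocalRing.residue (OE E) a = 0) (hc : IsLocalRing.residue (OE E) c = 0)
    (hac : a * a = c * p) {U H F D : cInd (p := p) (f := f) (OE E) (SymMod ι r 0)}
    (hU : U = heckeT ι r 0 H + (p : OE E) • F) (h : heckeT ι r 0 U = (p : OE E) • D) :
    thetaBarMap ι r ap D = 0 := by
  have h1 : thetaBarMap ι r ap (D - a • F - c • H) = 0 := toThetaBar_of_mem
    (mem_relations_of_smul_eq ha hp0 (H := U + a • H) (by
      rw [map_add, map_smul, h, smul_add, smul_smul, hac, mul_comm c, mul_smul, hU, smul_add,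
        smul_sub, smul_sub, smul_comm a (p : OE E) F]
      abel))
  rwa [map_sub, map_sub, thetaBarMap_smul_eq_zero ha', thetaBarMap_smul_eq_zero hc, sub_zero,
    sub_zero] at h1

variable [NeZero f] {σ : cInd (p := p) (f := f) (kE E) (SymMod (toK ι) r 0) →ₗ[kE E] ThetaBar ι r ap}

/-- The vectors all of whose translates are killed by a map out of the compact induction. -/
def kerBr {k M C : Type*} [Field k] [AddCommGroup M] [Module k M] [Module k[K p f] M]
    [IsScalarTower k k[K p f] M] [AddCommGroup C] [Module k C]
    (σ : cInd (p := p) (f := f) k M →ₗ[k] C) : Submodule k[K p f] M :=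
  submoduleOfStable (⨅ g, LinearMap.ker (σ ∘ₗ br g)) fun k v hv => by
    simp only [Submodule.mem_iInf, LinearMap.mem_ker, LinearMap.comp_apply] at hv ⊢
    intro g
    rw [br_smul]
    exact hv _

theorem mem_kerBr {k M C : Type*} [Field k] [AddCommGroup M] [Module k M] [Module k[K p f] M]
    [IsScalarTower k k[K p f] M] [AddCommGroup C] [Module k C]
    (σ : cInd (p := p) (f := f) k M →ₗ[k] C) (v : M) : v ∈ kerBr σ ↔ ∀ g, σ (br g v) = 0 := by
  change v ∈ (⨅ g, LinearMap.ker (σ ∘ₗ br g) : Submodule k M) ↔ _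
  simp only [Submodule.mem_iInf, LinearMap.mem_ker, LinearMap.comp_apply]

theorem eq_zero_of_mem_kerBr {k M C : Type*} [Field k] [AddCommGroup M] [Module k M] [Module k[K p f] M]
    [IsScalarTower k k[K p f] M] [AddCommGroup C] [Module k C]
    {σ : cInd (p := p) (f := f) k M →ₗ[k] C} {F : cInd (p := p) (f := f) k M}
    (h : ∀ g, F.1 g ∈ kerBr σ) : σ F = 0 :=
  cInd_mem_of_br_mem (LinearMap.ker σ).toAddSubgroup F fun g => (mem_kerBr σ _).1 (h g) g⁻¹

/-- The generator `∏ X_i ^ r_i` is a `K`-translate of `∏ Y_i ^ r_i`, which is in the image of `T`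
modulo `p`. -/
theorem Xsub_le_kerBr (hσ : ∀ F, σ (cIndBaseChange (IsLocalRing.residue (OE E)) ι r 0 F) =
      toThetaBar ι r ap F) (hp : 2 < p) (hr : ∀ i, p ≤ r i) (ha : (a : E) = ap)
    (hp0 : (p : OE E) ≠ 0) (hp' : IsLocalRing.residue (OE E) (p : OE E) = 0)
    (ha' : IsLocalRing.residue (OE E) a = 0) : Xsub (toK ι) r ≤ kerBr σ := by
  refine Submodule.span_le.2 fun v hv => (mem_kerBr σ v).2 fun g => ?_
  have h1 : ∀ g : G p f, thetaBarMap ι r ap (br g (symMono ι 0 (repTop_add r) 1)) = 0 := by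
    intro g
    obtain ⟨H, F, h⟩ := exists_eq_heckeT_add ι hp0 hp hr g
    rw [h, map_add, thetaBarMap_heckeT ha ha', thetaBarMap_smul_eq_zero hp', add_zero]
  have h2 : MonoidAlgebra.of (OE E) (K p f) (swapK p f 0) • symMono ι 0 (repTop_add r) 1 =
      symMono ι 0 (repBot_add r) 1 := by
    refine (symEquiv ι r 0).injective (Subtype.ext ?_)
    rw [of_smul_val, symMono_val, symMono_val, monomial_repTop, monomial_repBot]
    simp [subst, swapK_val, Fin.sum_univ_two, -RingHom.coe_pow]
  have h3 : v = (symEquiv (toK ι) r 0).symm (symMap (IsLocalRing.residue (OE E)) r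
      (symEquiv ι r 0 (symMono ι 0 (repBot_add r) 1))) := by
    rw [symMap_symMono, map_one]
    exact (symEquiv (toK ι) r 0).injective (Subtype.ext (hv.trans (monomial_repBot r).symm))
  rw [h3, ← cIndBaseChange_br, hσ, ← h2, br_smul]
  exact h1 _

/-- A multiple of the `θ_i` lifts to a vector whose image under `T` is divisible by `p`, so
`thetaBarMap_of_heckeT_eq` applies. -/
theorem Vstar_le_kerBr (hσ : ∀ F, σ (cIndBaseChange (IsLocalRing.residue (OE E)) ι r 0 F) =
      toThetaBar ι r ap F) (hp : 2 < p) (ha : (a : E) = ap) (ha0 : a ≠ 0) (hp0 : (p : OE E) ≠ 0)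
    (hab : a * b = p) (hb : IsLocalRing.residue (OE E) b = 0) : Vstar (toK ι) r ≤ kerBr σ := by
  classical
  refine Submodule.span_le.2 fun v hv => (mem_kerBr σ v).2 fun g => ?_
  obtain ⟨h, hh⟩ := Ideal.mem_span_range_iff_exists_fun.1 hv
  -- The multipliers are lifted arbitrarily; the component of multidegree `r` is extracted
  -- afterwards.
  choose h' hh' using fun i => map_surjective _ (IsLocalRing.residue_surjective (R := OE E)) (h i)
  let w : Fin f × Fin 2 → (Fin f → ℕ) := fun x => Pi.single x.1 1
  let W : MvPolynomial (Fin f × Fin 2) (OE E) := ∑ i, h' i * thetaLift (OE E) p i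
  have hW : MvPolynomial.map (IsLocalRing.residue (OE E)) W = (symEquiv (toK ι) r 0 v).1 := by
    rw [← hh, map_sum]
    refine Finset.sum_congr rfl fun i _ => ?_
    rw [map_mul, hh']
    simp [thetaLift, thetaPoly]
  let u : SymMod ι r 0 := (symEquiv ι r 0).symm
    ⟨weightedHomogeneousComponent w r W, weightedHomogeneousComponent_mem w W r⟩
  have hu : ∀ z, ∃ w', symModAct ι r 0 (heckeRep z).adjugate u = (p : OE E) • w' := fun z => by
    refine exists_eq_smul_of_dvd ι hp0 _ ?_
    have h1 : C (p : OE E) ∣ subst ι (heckeRep z).adjugate W := by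
      rw [map_sum]
      refine Finset.dvd_sum fun i _ => ?_
      rw [map_mul]
      exact (dvd_subst_thetaLift ι hp z i).mul_left _
    obtain ⟨W', hW'⟩ := h1
    rw [symModAct_val]
    change _ ∣ subst ι (heckeRep z).adjugate (weightedHomogeneousComponent w r W)
    rw [subst_weightedHomogeneousComponent, hW', weightedHomogeneousComponent_C_mul]
    exact dvd_mul_right _ _
  choose u' hu' using hu
  have hv' : v = (symEquiv (toK ι) r 0).symm (symMap (IsLocalRing.residue (OE E)) r
      (symEquiv ι r 0 u)) := by
    refine (symEquiv (toK ι) r 0).injective (Subtype.ext ?_)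
    change (symEquiv (toK ι) r 0 v).1 = MvPolynomial.map _ (weightedHomogeneousComponent w r W)
    ext d
    rw [coeff_map, coeff_weightedHomogeneousComponent]
    split_ifs with hd
    · rw [← hW, coeff_map]
    · rw [map_zero]
      by_contra h0
      exact hd ((symEquiv (toK ι) r 0 v).2 h0)
  rw [hv', ← cIndBaseChange_br, hσ]
  refine thetaBarMap_of_heckeT_eq (F := ∑ z, br (g * heckeG z) (u' z)) ha ha0 hab hb ?_
  rw [heckeT_br, Finset.smul_sum]
  simp only [hu', map_smul]

/-- This is the vanishing of `D` in `thetaBarMap_of_heckeT_eq_smul` for `U = [g, testVec]`. -/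
theorem redMap_sum_eq_zero (hσ : ∀ F, σ (cIndBaseChange (IsLocalRing.residue (OE E)) ι r 0 F) =
      toThetaBar ι r ap F) (hp : 2 < p) (hf : 2 ≤ f) {a₀ : ℕ}
    (hr : ∀ i, p ^ f ≤ r i) (hr' : ∀ i, p ≤ r i) (hr₁ : ∀ i, 1 ≤ r i) (ha₁ : 1 ≤ a₀)
    (ha₂ : a₀ ≤ p - 1) (hra : ∑ i : Fin f, r i * p ^ (i : ℕ) ≡ a₀ [MOD p ^ f - 1])
    (ha : (a : E) = ap) (hp0 : (p : OE E) ≠ 0)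
    (hp' : IsLocalRing.residue (OE E) (p : OE E) = 0) (ha' : IsLocalRing.residue (OE E) a = 0)
    (hc : IsLocalRing.residue (OE E) c = 0) (hac : a * a = c * p) (g : G p f) :
    σ (∑ m : Fq p f, br (g * heckeG (some m)) (∑ i : Fin f,
      symMono (toK ι) 0 (shiftBot_add (hr₁ i)) (r i * toK ι (derivCoeff r i m)))) = 0 := by
  obtain ⟨H, F, h1⟩ := exists_testVec_eq_heckeT_add ι hp0 hp hf hr' ha₁ ha₂ hra g
  obtain ⟨F', h2⟩ := exists_heckeT_testVec ι hp0 hp hf hr hr' hr₁ ha₁ ha₂ hra g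
  have h3 := thetaBarMap_of_heckeT_eq_smul ha hp0 ha' hc hac h1 h2
  rw [map_add, thetaBarMap_smul_eq_zero hp', add_zero] at h3
  rw [← h3]
  refine Eq.trans ?_ (hσ _)
  simp only [map_sum, cIndBaseChange_br, symMap_symMono, map_mul, map_natCast]
  rfl

end Reduction

/-! ### Integrality from the slope, and the residue map -/

section Integers

variable {E : Type*} [NormedField E] [IsUltrametricDist E]

theorem mem_OE_iff (x : E) : x ∈ OE E ↔ ‖x‖ ≤ 1 := by
  rw [Valuation.mem_valuationSubring_iff, NormedField.valuation_apply]
  exact Iff.rfl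

theorem residue_eq_zero_of_norm_lt (x : OE E) (hx : ‖(x : E)‖ < 1) :
    IsLocalRing.residue (OE E) x = 0 := by
  rw [IsLocalRing.residue_eq_zero_iff, IsLocalRing.mem_maximalIdeal, mem_nonunits_iff]
  intro h
  obtain ⟨y, hy⟩ := h.exists_right_inv
  have h1 : ‖(x : E)‖ * ‖(y : E)‖ = 1 := by
    rw [← norm_mul, ← Subring.coe_mul, hy]
    exact norm_one
  have h2 := (mem_OE_iff (y : E)).1 y.2
  nlinarith [norm_nonneg (x : E), norm_nonneg (y : E)]

/-- The elements are `a = a_p`, `b = p / a_p` and `c = a_p² / p`, of valuations `v`, `1 - v` and `2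
v - 1` for `v = v(a_p)`, all positive. -/
theorem exists_integral_coeffs [NormedAlgebra ℚ_[p] E] {ap : E} (hap₁ : 1 / 2 < slope p ap)
    (hap₂ : slope p ap < 1) : (p : OE E) ≠ 0 ∧ IsLocalRing.residue (OE E) (p : OE E) = 0 ∧
      ∃ a b c : OE E, (a : E) = ap ∧ a ≠ 0 ∧ a * b = p ∧ a * a = c * p ∧
        IsLocalRing.residue (OE E) a = 0 ∧ IsLocalRing.residue (OE E) b = 0 ∧
        IsLocalRing.residue (OE E) c = 0 := by
  have hp1 : (1 : ℝ) < p := by exact_mod_cast (Fact.out : p.Prime).one_lt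
  have hp0 : (0 : ℝ) < p := by linarith
  have hnp : ‖(p : E)‖ = (p : ℝ)⁻¹ := by
    rw [← map_natCast (algebraMap ℚ_[p] E), norm_algebraMap', Padic.norm_p]
  have hpE : (p : E) ≠ 0 := by
    rw [← norm_ne_zero_iff, hnp]
    positivity
  -- `Real.logb` takes the value `0` at `0`, so the slope of `0` is `0`, which the lower bound
  -- excludes.
  have hap0 : ap ≠ 0 := by
    rintro rfl
    rw [slope, norm_zero, Real.logb_zero] at hap₁
    norm_num at hap₁
  have hx : 0 < ‖ap‖ := norm_pos_iff.2 hap0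
  have h1 : (p : ℝ)⁻¹ < ‖ap‖ := by
    rw [← Real.rpow_neg_one, ← Real.lt_logb_iff_rpow_lt hp1 hx]
    rw [slope] at hap₂
    linarith
  have h2 : ‖ap‖ ^ 2 < (p : ℝ)⁻¹ := by
    rw [← Real.rpow_neg_one, ← Real.logb_lt_iff_lt_rpow hp1 (by positivity), Real.logb_pow]
    rw [slope] at hap₁
    push_cast
    linarith
  have h3 : (p : ℝ)⁻¹ < 1 := inv_lt_one_of_one_lt₀ hp1
  have ha : ‖ap‖ < 1 := by nlinarith
  have hb : ‖(p : E) / ap‖ < 1 := by rwa [norm_div, hnp, div_lt_one hx]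
  have hc : ‖ap * ap / p‖ < 1 := by
    rw [norm_div, norm_mul, hnp, div_lt_one (by positivity), ← pow_two]
    exact h2
  refine ⟨fun h => hpE ?_, residue_eq_zero_of_norm_lt _ ?_,
    ⟨ap, (mem_OE_iff _).2 ha.le⟩, ⟨(p : E) / ap, (mem_OE_iff _).2 hb.le⟩,
    ⟨ap * ap / p, (mem_OE_iff _).2 hc.le⟩, rfl, fun h => hap0 (congrArg Subtype.val h), ?_, ?_,
    residue_eq_zero_of_norm_lt _ ha, residue_eq_zero_of_norm_lt _ hb,
    residue_eq_zero_of_norm_lt _ hc⟩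
  · exact (map_natCast (OE E).subtype p).symm.trans (congrArg Subtype.val h)
  · rw [show (((p : OE E) : E)) = (p : E) from map_natCast (OE E).subtype p, hnp]
    exact h3
  · exact Subtype.ext ((mul_div_cancel₀ _ hap0).trans (map_natCast (OE E).subtype p).symm)
  · refine Subtype.ext ?_
    change ap * ap = ap * ap / p * ((p : OE E) : E)
    rw [show (((p : OE E) : E)) = (p : E) from map_natCast (OE E).subtype p,
      div_mul_cancel₀ _ hpE]

theorem exists_residue_factor (ι : Zq p f →+* OE E)
    (hp : IsLocalRing.residue (OE E) (p : OE E) = 0) :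
    ∃ φ : Fq p f →+* kE E, ∀ x, toK ι x = φ (WittVector.constantCoeff x) := by
  have hs : Function.Surjective (WittVector.constantCoeff : Zq p f →+* Fq p f) := fun x =>
    ⟨_, constantCoeff_teichmuller x⟩
  have hker : RingHom.ker (WittVector.constantCoeff : Zq p f →+* Fq p f) ≤
      RingHom.ker (toK ι) := by
    intro x hx
    obtain ⟨y, rfl⟩ := (dvd_iff_coeff x).2 hx
    rw [RingHom.mem_ker, map_mul, map_natCast]
    rw [map_natCast] at hp
    rw [hp, zero_mul]
  exact ⟨RingHom.liftOfSurjective _ hs ⟨toK ι, hker⟩, fun x =>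
    (RingHom.liftOfRightInverse_comp_apply _ _ (Function.rightInverse_surjInv hs)
      ⟨toK ι, hker⟩ x).symm⟩

end Integers

/-! ### Torus eigenvectors in the weight and in `Q` -/

section Final

variable {k : Type*} [Field k]

theorem exists_cIndMap_subtype_eq {M : Type*} [AddCommGroup M] [Module k M] [Module k[K p f] M]
    [IsScalarTower k k[K p f] M] (N : Submodule k[K p f] M) {F : cInd (p := p) (f := f) k M}
    (hF : ∀ g, F.1 g ∈ N) : ∃ F' : cInd (p := p) (f := f) k N, cIndMap N.subtype F' = F :=
  cInd_mem_of_br_mem (LinearMap.range (cIndMap (R := k) (p := p) (f := f) N.subtype)).toAddSubgroup F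
    fun h => ⟨br h⁻¹ ⟨F.1 h, hF h⟩, cIndMap_br _ _ _⟩

variable [NeZero f] {φ : Fq p f →+* k} {a₀ : ℕ}

/-- The substitutions for `[l]` fix every `X_i`, while `α` multiplies `X_1 ^ (p - 2)` by `p ^ (p -
2) = 0`, the exponent being positive as `p > 2`. -/
theorem heckeT_br_repBot {ι : Zq p f →+* k} (hp : 2 < p) (hf : 2 ≤ f) (hpk : (p : k) = 0) (s : ℕ)
    (g : G p f) : heckeT ι (secondWeight p f a₀) s (br g (symMono ι s (repBot_add _) 1)) =
      ∑ l : Fq p f, br (g * heckeG (some l)) (symMono ι s (repBot_add _) 1) := by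
  rw [heckeT_br, Fintype.sum_option]
  have h1 : ∀ l, symModAct ι (secondWeight p f a₀) s (heckeRep (some l)).adjugate
      (symMono ι s (repBot_add _) 1) = symMono ι s (repBot_add _) 1 := by
    intro l
    refine (symEquiv ι _ s).injective (Subtype.ext ?_)
    rw [symModAct_val, symMono_val, monomial_repBot, map_prod]
    exact Finset.prod_congr rfl fun i _ => by rw [map_pow, subst_some_zero]
  have h2 : symModAct ι (secondWeight p f a₀) s (heckeRep (none : Option (Fq p f))).adjugate
      (symMono ι s (repBot_add _) 1) = 0 := by
    refine (symEquiv ι _ s).injective (Subtype.ext ?_)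
    rw [symModAct_val, symMono_val, monomial_repBot, map_prod]
    refine Finset.prod_eq_zero (Finset.mem_univ 1) ?_
    rw [map_pow, subst_none_zero, hpk, C_0, zero_mul, zero_pow]
    rw [secondWeight, if_neg (one_ne_zero_Fin hf), if_pos rfl]
    omega
  rw [h2, map_zero, zero_add]
  exact Finset.sum_congr rfl fun l _ => by rw [h1]

/-- The matrix `(1 0; 0 [u])` fixes every `X_i`, so it acts only through the twist `D^p`, that is,
by `u ^ p`. -/
theorem torPr_smul_repBot {ι : Zq p f →+* k} (hφ : ∀ a, ι a = φ (WittVector.constantCoeff a))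
    (hp : 2 < p) (hf : 2 ≤ f) (r : Fin f → ℕ) :
    torPr φ p • symMono ι p (repBot_add r) 1 = symMono ι p (repBot_add r) 1 := by
  have hq := p_lt_card hp hf
  rw [torPr_smul φ (m := p) (by omega), if_pos (by rw [Nat.sub_add_cancel (by omega)])]
  intro u
  refine (symEquiv ι _ p).injective (Subtype.ext ?_)
  have h1 : (torK p f u : Matrix (Fin 2) (Fin 2) (Zq p f)) =
      !![1, 0; 0, WittVector.teichmuller p (u : Fq p f)] := rfl
  rw [of_smul_val, symMono_val, (symEquiv ι r p).map_smul, Submodule.coe_smul, symMono_val,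
    monomial_repBot, map_prod, smul_eq_C_mul, h1]
  congr 1
  · rw [Matrix.det_fin_two_of, hφ]
    simp
  · refine Finset.prod_congr rfl fun i _ => ?_
    rw [map_pow]
    simp [subst, Fin.sum_univ_two, -RingHom.coe_pow]

/-- The projector maps `M` onto the line of one basis vector, so in any subquotient its fixed
vectors are multiples of that vector's class. -/
theorem IsQuot.exists_eq_smul {M : Type*} [AddCommGroup M] [Module k M]
    [Module k[K p f] M] [IsScalarTower k k[K p f] M] {Λ : ((Fin 2 → Fq p f) → k) →ₗ[k] M}
    (hΛ : IsQuot φ a₀ Λ) (ha₁ : 1 ≤ a₀) (hq : a₀ < p ^ f - 1) {n : ℕ}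
    (hn : n ∈ Finset.Icc a₀ (p ^ f - 1)) (N N' : Submodule k[K p f] M) (hN : Λ (mn φ a₀ n) ∈ N)
    {x : N ⧸ N'.submoduleOf N} (hx : torPr φ n • x = x) :
    ∃ c : k, x = c • Submodule.Quotient.mk ⟨Λ (mn φ a₀ n), hN⟩ := by
  obtain ⟨⟨y, hy⟩, rfl⟩ := Submodule.Quotient.mk_surjective _ x
  obtain ⟨F, rfl⟩ := hΛ.surj y
  refine ⟨cf φ a₀ n F, ?_⟩
  rw [← hx, ← Submodule.Quotient.mk_smul, ← Submodule.Quotient.mk_smul]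
  exact congrArg Submodule.Quotient.mk (Subtype.ext (hΛ.torPr_smul ha₁ hq F hn))

theorem wt_shiftBot_one (r : Fin f → ℕ) (i : Fin f) (n : ℕ) :
    wt p (shiftBot r i n) 1 = n * p ^ (i : ℕ) := by
  rw [wt, Finset.sum_eq_single i]
  · rw [shiftBot_one, if_pos rfl]
  · intro j _ hj
    rw [shiftBot_one, if_neg hj, zero_mul]
  · exact fun h => absurd (Finset.mem_univ i) h

/-- The `y`-weight is exactly `p ^ i`, and the `x`-weight matters only modulo `q - 1`, both
exponents being positive. -/
theorem evFn_shiftBot {ι : Zq p f →+* k} (φ : Fq p f →+* k) (hp : 2 < p) (hf : 2 ≤ f)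
    {r : Fin f → ℕ} (hr : ∀ i, p ^ f ≤ r i) (hr₁ : ∀ i, 1 ≤ r i) (ha₁ : 1 ≤ a₀)
    (hra : ∑ i : Fin f, r i * p ^ (i : ℕ) ≡ a₀ [MOD p ^ f - 1]) (i : Fin f) (c : k) :
    evFn φ ι r 0 (symMono ι 0 (shiftBot_add (hr₁ i)) c) = c • mn φ a₀ (p ^ (i : ℕ)) := by
  have hq := p_lt_card hp hf
  have hp1 : 1 ≤ p ^ (i : ℕ) := Nat.one_le_pow _ _ (by omega)
  have hlt : p ^ (i : ℕ) < p ^ f := Nat.pow_lt_pow_right (by omega) i.2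
  have hw := wt_add (p := p) (shiftBot_add (hr₁ i))
  have hw1 := wt_shiftBot_one (p := p) r i 1
  have hge : r i * p ^ (i : ℕ) ≤ ∑ i : Fin f, r i * p ^ (i : ℕ) :=
    Finset.single_le_sum (f := fun i : Fin f => r i * p ^ (i : ℕ)) (fun i _ => Nat.zero_le _)
      (Finset.mem_univ i)
  have hge' : r i * 1 ≤ r i * p ^ (i : ℕ) := Nat.mul_le_mul_left _ hp1
  have := hr i
  rw [evFn_symMono]
  congr 1
  rw [one_mul] at hw1
  refine mono_congr φ (Or.inr ⟨by omega, by omega, ?_⟩) (Or.inl hw1)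
  refine Nat.ModEq.add_right_cancel' (p ^ (i : ℕ)) ?_
  rw [Nat.sub_add_cancel (by omega), ← hw1, hw]
  exact hra.trans (modEq_sub_one (by omega)).symm

end Final

/-! ### A map on a simple layer that kills the image of `T` -/

section Simple

variable {k : Type*} [Field k] [NeZero f] {φ : Fq p f →+* k} {ι : Zq p f →+* k} {a₀ : ℕ}

/-- The equivalence `e.symm` sends `∏ X_i ^ b_i` to a vector fixed by the torus projector, hence to
a multiple of `y`. So `hΦ` kills the image of `T [g, ∏ X_i ^ b_i]` for every `g`. The vectors with
this property form a subrepresentation, which is everything by simplicity. -/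
theorem comp_heckeT_eq_zero (hp : 2 < p) (hf : 2 ≤ f)
    (hφ : ∀ x, ι x = φ (WittVector.constantCoeff x))
    {S C : Type*} [AddCommGroup S] [Module k S] [Module k[K p f] S] [IsScalarTower k k[K p f] S]
    [AddCommGroup C] [Module k C] [IsSimpleModule k[K p f] S] {y : S}
    (hy : ∀ x : S, torPr φ p • x = x → ∃ c : k, x = c • y)
    {Φ : cInd (p := p) (f := f) k S →ₗ[k] C}
    (hΦ : ∀ g : G p f, Φ (∑ m : Fq p f, br (g * heckeG (some m)) y) = 0)
    (e : S ≃ₗ[k[K p f]] SymMod ι (secondWeight p f a₀) p)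
    (F : cInd (p := p) (f := f) k (SymMod ι (secondWeight p f a₀) p)) :
    Φ (cIndMap e.symm.toLinearMap (heckeT ι (secondWeight p f a₀) p F)) = 0 := by
  have := charP_of_ringHom φ
  let χ := Φ ∘ₗ cIndMap e.symm.toLinearMap ∘ₗ heckeT ι (secondWeight p f a₀) p
  have hsimple : IsSimpleModule k[K p f] (SymMod ι (secondWeight p f a₀) p) :=
    IsSimpleModule.congr e.symm
  have hx0 : symMono ι p (repBot_add (secondWeight p f a₀)) 1 ≠ 0 := fun h =>
    one_ne_zero ((monomial_eq_zero (R := k)).1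
      (congrArg (fun w => (symEquiv ι (secondWeight p f a₀) p w).1) h))
  have hx1 := torPr_smul_repBot hφ hp hf (secondWeight p f a₀)
  have hT := heckeT_br_repBot (a₀ := a₀) (ι := ι) hp hf (CharP.cast_eq_zero k p) p
  generalize symMono ι p (repBot_add (secondWeight p f a₀)) 1 = x at hx0 hx1 hT
  have hx : x ∈ kerBr χ := by
    rw [mem_kerBr]
    intro g
    obtain ⟨c, hc⟩ := hy (e.symm x)
      ((e.symm.map_smul (torPr φ p) x).symm.trans (congrArg e.symm hx1))
    have h1 : ∀ g : G p f, cIndMap e.symm.toLinearMap (br (R := k) g x) = c • br g y := by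
      intro g
      rw [cIndMap_br, ← map_smul, ← hc]
      rfl
    change Φ (cIndMap e.symm.toLinearMap (heckeT ι (secondWeight p f a₀) p (br g x))) = 0
    rw [hT, map_sum, Finset.sum_congr rfl fun m _ => h1 _, ← Finset.smul_sum, map_smul, hΦ,
      smul_zero]
  have htop : kerBr χ = ⊤ := (eq_bot_or_eq_top (kerBr χ)).resolve_left fun h =>
    hx0 ((Submodule.mem_bot _).1 (h ▸ hx))
  exact eq_zero_of_mem_kerBr (σ := χ) fun g => htop ▸ Submodule.mem_top

end Simple

/-! ### The key vector lies in `F_{f-2}` -/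

section Second

variable {E : Type*} [NormedField E] [IsUltrametricDist E] [NeZero f] {ι : Zq p f →+* OE E}
  {r : Fin f → ℕ} {ap : E} {a₀ : ℕ} {φ : Fq p f →+* kE E}
  {π : cInd (p := p) (f := f) (kE E) (Qmod (toK ι) r) →ₗ[kE E] ThetaBar ι r ap}
  {Λ : ((Fin 2 → Fq p f) → kE E) →ₗ[kE E] Qmod (toK ι) r}

theorem br_mem_Ffil {j : ℕ} {v : Qmod (toK ι) r} (hv : v ∈ Qfil (toK ι) r j) (g : G p f) :
    π (br g v) ∈ Ffil π j :=
  ⟨br g ⟨v, hv⟩, congrArg π (cIndMap_br _ _ _)⟩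

/-- In the relation from the test vector, the term `i = 1` is `-r_1` times the wanted sum, and `r_1`
is invertible in `k_E`. All other terms lie in `F_{f-2}`: for `i ≥ 2` because `p ^ 2 ∣ p ^ i`, and
for `i = 0` because `1 < a₀` or `p ∣ r_0`. -/
theorem sum_br_mem_Ffil (hp : 2 < p) (hf : 2 ≤ f) (hr : ∀ i, p ^ f ≤ r i) (hr₁' : ∀ i, 1 ≤ r i)
    (ha₁ : 1 ≤ a₀) (ha₂ : a₀ ≤ p - 1)
    (hra : ∑ i : Fin f, r i * p ^ (i : ℕ) ≡ a₀ [MOD p ^ f - 1])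
    (hr₁ : ¬ p ∣ r 1) (hr₀ : a₀ = 1 → p ∣ r 0)
    (hφ : ∀ x, toK ι x = φ (WittVector.constantCoeff x))
    (hΛ' : ∀ v : SymMod (toK ι) r 0, Λ (evFn φ (toK ι) r 0 v) = Submodule.Quotient.mk v)
    (hfil : ∀ F ∈ fnFil φ a₀ 2, Λ F ∈ Qfil (toK ι) r (f - 2))
    (hπ : ∀ g : G p f, π (indToQ ι r (∑ m : Fq p f, br (g * heckeG (some m)) (∑ i : Fin f,
      symMono (toK ι) 0 (shiftBot_add (hr₁' i)) (r i * toK ι (derivCoeff r i m))))) = 0) (g : G p f) :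
    π (∑ m : Fq p f, br (g * heckeG (some m)) (Λ (mn φ a₀ p))) ∈ Ffil π (f - 2) := by
  have := charP_of_ringHom φ
  have hq := p_lt_card hp hf
  have hp2 : p < p ^ 2 := by nlinarith
  have h1 := hπ g
  have h2 : ∀ m : Fq p f, indToQ ι r (br (g * heckeG (some m)) (∑ i : Fin f,
      symMono (toK ι) 0 (shiftBot_add (hr₁' i)) (r i * toK ι (derivCoeff r i m)))) =
      ∑ i : Fin f, ((r i : kE E) * toK ι (derivCoeff r i m)) •
        br (g * heckeG (some m)) (Λ (mn φ a₀ (p ^ (i : ℕ)))) := by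
    intro m
    rw [indToQ, cIndMap_br, Submodule.mkQ_apply, ← hΛ', map_sum, map_sum, map_sum]
    refine Finset.sum_congr rfl fun i _ => ?_
    rw [evFn_shiftBot φ hp hf hr hr₁' ha₁ hra, map_smul, map_smul]
  rw [map_sum] at h1
  simp only [h2] at h1
  rw [Finset.sum_comm, map_sum, ← Finset.add_sum_erase _ _ (Finset.mem_univ (1 : Fin f))] at h1
  have h3 : ∀ m : Fq p f, toK ι (derivCoeff r 1 m) = -1 := fun m => by
    rw [hφ, constantCoeff_derivCoeff hp hf hr ha₂ hra, map_neg, map_one]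
  have h4 : ∀ i ∈ Finset.univ.erase (1 : Fin f),
      π (∑ m : Fq p f, ((r i : kE E) * toK ι (derivCoeff r i m)) •
        br (g * heckeG (some m)) (Λ (mn φ a₀ (p ^ (i : ℕ))))) ∈ Ffil π (f - 2) := by
    intro i hi
    rw [map_sum]
    refine Submodule.sum_mem _ fun m _ => ?_
    rw [map_smul]
    -- If `a₀ = 1`, the index `p ^ 0 = 1` is not below `a₀`, so membership in the filtration fails
    -- and the coefficient `r_0` has to vanish.
    by_cases h0 : a₀ = 1 ∧ i = 0
    · rw [h0.2, (CharP.cast_eq_zero_iff (kE E) p _).2 (hr₀ h0.1), zero_mul, zero_smul]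
      exact Submodule.zero_mem _
    · refine Submodule.smul_mem _ _ (br_mem_Ffil (hfil _ (mn_mem_fnFil φ ha₁ (by omega) ?_ ?_)) _)
      · have := Nat.pow_lt_pow_right (a := p) (by omega) i.2
        omega
      · by_cases hi0 : i = 0
        · rw [hi0, Fin.val_zero, pow_zero, Nat.mod_eq_of_lt (by omega)]
          omega
        · have hi2 : 2 ≤ (i : ℕ) := by
            have hne : (i : ℕ) ≠ 1 := fun h => Finset.ne_of_mem_erase hi
              (Fin.ext (h.trans (val_one_Fin hf).symm))
            have hne0 : (i : ℕ) ≠ 0 := fun h => hi0 (Fin.ext (by rw [h, Fin.val_zero]))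
            omega
          rw [Nat.mod_eq_zero_of_dvd (pow_dvd_pow p hi2)]
          exact ha₁
  simp only [h3, val_one_Fin hf, pow_one, mul_neg_one] at h1
  rw [← Finset.smul_sum, map_smul] at h1
  have h5 := neg_mem (Submodule.sum_mem _ h4)
  rw [← eq_neg_of_add_eq_zero_left h1] at h5
  have h6 : -(r 1 : kE E) ≠ 0 := neg_ne_zero.2 fun h => hr₁ ((CharP.cast_eq_zero_iff (kE E) p _).1 h)
  exact (Submodule.smul_mem_iff _ h6).1 h5

end Second

/-! ### The map on the graded piece and its factorization -/

section Graded

variable {k : Type*} [Field k] [NeZero f] {φ : Fq p f →+* k} {ι : Zq p f →+* k} {a₀ : ℕ}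
  {M : Type*} [AddCommGroup M] [Module k M] [Module k[K p f] M] [IsScalarTower k k[K p f] M]

theorem IsQuot.second_layer {Λ : ((Fin 2 → Fq p f) → k) →ₗ[k] M}
    (hφ : ∀ a, ι a = φ (WittVector.constantCoeff a)) (hΛ : IsQuot φ a₀ Λ) (hp : 2 < p)
    (hf : 2 ≤ f) (ha₁ : 1 ≤ a₀) (ha₂ : a₀ ≤ p - 1) (hq : a₀ < p ^ f - 1)
    {N N' : Submodule k[K p f] M} (hN : N = hΛ.fil ha₁ ha₂ hq 1 (Nat.le_of_succ_le hf))
    (hN' : N' = hΛ.fil ha₁ ha₂ hq 2 hf) :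
    IsSimpleModule k[K p f] (N ⧸ N'.submoduleOf N) ∧
      Nonempty ((N ⧸ N'.submoduleOf N) ≃ₗ[k[K p f]] SymMod ι (secondWeight p f a₀) p) := by
  subst hN hN'
  exact ⟨hΛ.isSimpleModule ha₁ ha₂ hq hf, hΛ.nonempty_equiv hφ hp hf ha₁ ha₂ hq⟩

variable {C : Type*} [AddCommGroup C] [Module k C]

/-- The image of `ind N` under a map out of `ind M`. -/
abbrev imageInd (π : cInd (p := p) (f := f) k M →ₗ[k] C) (N : Submodule k[K p f] M) :
    Submodule k C :=
  LinearMap.range (π ∘ₗ cIndMap N.subtype)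

theorem map_mem_imageInd {π : cInd (p := p) (f := f) k M →ₗ[k] C} {N : Submodule k[K p f] M}
    {F : cInd (p := p) (f := f) k M} (hF : ∀ g, F.1 g ∈ N) : π F ∈ imageInd π N := by
  obtain ⟨F', rfl⟩ := exists_cIndMap_subtype_eq _ hF
  exact ⟨F', rfl⟩

/-- Functions in `ind N` that vanish in `ind (N / N')` take values in `N'`, so `π` sends them to the
image of `ind N'`. -/
theorem exists_gradedMap (π : cInd (p := p) (f := f) k M →ₗ[k] C) (N N' : Submodule k[K p f] M) :
    ∃ Φ : cInd (p := p) (f := f) k (N ⧸ N'.submoduleOf N) →ₗ[k]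
        imageInd π N ⧸ (imageInd π N').submoduleOf (imageInd π N),
      (∀ F : cInd (p := p) (f := f) k N, Φ (cIndMap (N'.submoduleOf N).mkQ F) =
        Submodule.Quotient.mk ((π ∘ₗ cIndMap N.subtype).rangeRestrict F)) ∧
      Function.Surjective Φ := by
  let q := cIndMap (R := k) (p := p) (f := f) (N'.submoduleOf N).mkQ
  let t := ((imageInd π N').submoduleOf (imageInd π N)).mkQ ∘ₗ
    (π ∘ₗ cIndMap N.subtype).rangeRestrict
  have hs : Function.Surjective q := cIndMap_surjective _ (Submodule.mkQ_surjective _)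
  have hk : ∀ F, q F = 0 → t F = 0 := fun F hF => by
    refine (Submodule.Quotient.mk_eq_zero _).2 ?_
    change π (cIndMap N.subtype F) ∈ imageInd π N'
    exact map_mem_imageInd fun g => (Submodule.Quotient.mk_eq_zero (N'.submoduleOf N)).1
      (congrFun (congrArg Subtype.val hF) g)
  have h := exists_linearMap_comp_eq (R := k) (A := cInd (p := p) (f := f) k N)
    (B := cInd (p := p) (f := f) k (N ⧸ N'.submoduleOf N))
    (C := imageInd π N ⧸ (imageInd π N').submoduleOf (imageInd π N)) q t
  obtain ⟨Φ, hΦ⟩ := h hs hk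
  refine ⟨Φ, hΦ, fun y => ?_⟩
  obtain ⟨y, rfl⟩ := Submodule.Quotient.mk_surjective _ y
  obtain ⟨F, rfl⟩ := (π ∘ₗ cIndMap N.subtype).surjective_rangeRestrict y
  exact ⟨_, hΦ F⟩

theorem exists_factor_heckeT (hp : 2 < p) (hf : 2 ≤ f)
    (hφ : ∀ x, ι x = φ (WittVector.constantCoeff x)) {π : cInd (p := p) (f := f) k M →ₗ[k] C}
    {N N' : Submodule k[K p f] M} (hsimple : IsSimpleModule k[K p f] (N ⧸ N'.submoduleOf N))
    {y : M} (hy : y ∈ N)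
    (hfix : ∀ x : N ⧸ N'.submoduleOf N, torPr φ p • x = x →
      ∃ c : k, x = c • Submodule.Quotient.mk ⟨y, hy⟩)
    (hsum : ∀ g : G p f, π (∑ m : Fq p f, br (g * heckeG (some m)) y) ∈ imageInd π N')
    {Φ : cInd (p := p) (f := f) k (N ⧸ N'.submoduleOf N) →ₗ[k]
        imageInd π N ⧸ (imageInd π N').submoduleOf (imageInd π N)}
    (hΦ : ∀ F : cInd (p := p) (f := f) k N, Φ (cIndMap (N'.submoduleOf N).mkQ F) =
        Submodule.Quotient.mk ((π ∘ₗ cIndMap N.subtype).rangeRestrict F))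
    (e : (N ⧸ N'.submoduleOf N) ≃ₗ[k[K p f]] SymMod ι (secondWeight p f a₀) p) :
    ∃ Ψ : (cInd (p := p) (f := f) k (SymMod ι (secondWeight p f a₀) p) ⧸
        LinearMap.range (heckeT ι (secondWeight p f a₀) p)) →ₗ[k]
        imageInd π N ⧸ (imageInd π N').submoduleOf (imageInd π N),
      ∀ F : cInd (p := p) (f := f) k (N ⧸ N'.submoduleOf N),
        Φ F = Ψ (Submodule.Quotient.mk (cIndMap e.toLinearMap F)) := by
  have hzero : ∀ g : G p f, Φ (∑ m : Fq p f, br (g * heckeG (some m))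
      (Submodule.Quotient.mk ⟨y, hy⟩)) = 0 := fun g => by
    have h1 : ∑ m : Fq p f, br (R := k) (g * heckeG (some m))
        (Submodule.Quotient.mk ⟨y, hy⟩ : N ⧸ N'.submoduleOf N) =
        cIndMap (N'.submoduleOf N).mkQ (∑ m : Fq p f, br (g * heckeG (some m)) ⟨y, hy⟩) := by
      simp only [map_sum, cIndMap_br]
      rfl
    rw [h1, hΦ]
    refine (Submodule.Quotient.mk_eq_zero _).2 ?_
    change π (cIndMap _ _) ∈ imageInd π N'
    rw [map_sum (cIndMap _)]
    simp only [cIndMap_br]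
    exact hsum g
  have hT := comp_heckeT_eq_zero hp hf hφ hfix hzero e
  refine ⟨(LinearMap.range (heckeT ι (secondWeight p f a₀) p)).liftQ
    (Φ ∘ₗ cIndMap e.symm.toLinearMap) ?_, fun F => ?_⟩
  · rintro _ ⟨F, rfl⟩
    exact hT F
  · refine congrArg Φ (Subtype.ext (funext fun g => ?_))
    exact (e.symm_apply_apply (F.1 g)).symm

end Graded

end HeckeRed

end

/-! ### Assembly of the theorem -/

theorem mainTheorem4 (p f : ℕ) [Fact p.Prime] [NeZero f] (hp : 2 < p) (hf : 2 ≤ f)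
    {E : Type*} [NormedField E] [NormedAlgebra ℚ_[p] E] [IsUltrametricDist E]
    [Algebra.IsAlgebraic ℚ_[p] E] (ι : Zq p f →+* OE E)
    (r : Fin f → ℕ) (hr : ∀ i, p ^ f ≤ r i)
    (a₀ : ℕ) (ha₁ : 1 ≤ a₀) (ha₂ : a₀ ≤ p - 1)
    (hra : ∑ i : Fin f, r i * p ^ (i : ℕ) ≡ a₀ [MOD p ^ f - 1])
    (hr₁ : ¬ p ∣ r 1) (hr₀ : a₀ = 1 → p ∣ r 0)
    (ap : E) (hap₁ : 1 / 2 < slope p ap) (hap₂ : slope p ap < 1) :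
    IsSimpleModule (kE E)[K p f] (Qsecond (toK ι) r) ∧
    Nonempty (Qsecond (toK ι) r ≃ₗ[(kE E)[K p f]] SymMod (toK ι) (secondWeight p f a₀) p) ∧
    ∃ π : cInd (p := p) (f := f) (kE E) (Qmod (toK ι) r) →ₗ[kE E] ThetaBar ι r ap,
      (∀ F : cInd (p := p) (f := f) (OE E) (SymMod ι r 0),
        π (indToQ ι r (cIndBaseChange (IsLocalRing.residue (OE E)) ι r 0 F)) =
          toThetaBar ι r ap F) ∧
      ∃ Φ : cInd (p := p) (f := f) (kE E) (Qsecond (toK ι) r) →ₗ[kE E] Fsecond π,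
        (∀ F : cInd (p := p) (f := f) (kE E) (Qfil (toK ι) r (f - 1)),
          Φ (cIndMap ((Qfil (toK ι) r (f - 2)).submoduleOf (Qfil (toK ι) r (f - 1))).mkQ F) =
            Submodule.Quotient.mk ((restrictFil π (f - 1)).rangeRestrict F)) ∧
        Function.Surjective Φ ∧
        ∀ e : Qsecond (toK ι) r ≃ₗ[(kE E)[K p f]] SymMod (toK ι) (secondWeight p f a₀) p,
          ∃ Ψ : (cInd (p := p) (f := f) (kE E) (SymMod (toK ι) (secondWeight p f a₀) p) ⧸
              LinearMap.range (heckeT (toK ι) (secondWeight p f a₀) p)) →ₗ[kE E] Fsecond π,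
            ∀ F : cInd (p := p) (f := f) (kE E) (Qsecond (toK ι) r),
              Φ F = Ψ (Submodule.Quotient.mk (cIndMap e.toLinearMap F)) := by
  have hq := p_lt_card hp hf
  have hq' : a₀ < p ^ f - 1 := by omega
  have hpf : p ≤ p ^ f := Nat.le_self_pow (by omega) p
  have hr' : ∀ i, p ≤ r i := fun i => hpf.trans (hr i)
  have hr₁' : ∀ i, 1 ≤ r i := fun i => le_trans (by omega) (hr' i)
  have hcoeffs := exists_integral_coeffs hap₁ hap₂
  have hp0 := hcoeffs.1
  have hp' := hcoeffs.2.1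
  refine hcoeffs.2.2.elim fun a H => H.elim fun b H => H.elim fun c H => ?_
  have ha := H.1
  have ha0 := H.2.1
  have hab := H.2.2.1
  have hac := H.2.2.2.1
  have ha' := H.2.2.2.2.1
  have hb' := H.2.2.2.2.2.1
  have hc' := H.2.2.2.2.2.2
  refine (exists_residue_factor ι hp').elim fun φ hφ => ?_
  have hchar := charP_of_ringHom φ
  refine (exists_isQuot hφ hp hf hr ha₁ ha₂ hra).elim fun Λ H => ?_
  have hΛ := H.1
  have hΛ' := H.2
  -- The digit filtration descends from `Q` at `m = 0` to `0` at `m = f`, so the socle steps `f - 1`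
  -- and `f - 2` are `m = 1` and `m = 2`.
  have e1 : Qfil (toK ι) r (f - 1) = hΛ.fil ha₁ ha₂ hq' 1 (Nat.le_of_succ_le hf) :=
    hΛ.socleFil_eq ha₁ ha₂ hq' _
  have e2 : Qfil (toK ι) r (f - 2) = hΛ.fil ha₁ ha₂ hq' 2 hf := hΛ.socleFil_eq ha₁ ha₂ hq' _
  have hlayer := hΛ.second_layer hφ hp hf ha₁ ha₂ hq' e1 e2
  have hsimple := hlayer.1
  refine ⟨hlayer.1, hlayer.2, ?_⟩
  refine (exists_redMap ι r ap).elim fun σ hσ => ?_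
  have hker : Vstar (toK ι) r ⊔ Xsub (toK ι) r ≤ kerBr σ :=
    sup_le (Vstar_le_kerBr hσ hp ha ha0 hp0 hab hb') (Xsub_le_kerBr hσ hp hr' ha hp0 hp' ha')
  have hσQ : ∀ F, indToQ ι r F = 0 → σ F = 0 := fun F hF =>
    eq_zero_of_mem_kerBr fun g => hker ((Submodule.Quotient.mk_eq_zero _).1
      (congrFun (congrArg Subtype.val hF) g))
  refine (exists_linearMap_comp_eq (indToQ ι r) σ
    (cIndMap_surjective _ (Submodule.mkQ_surjective _)) hσQ).elim fun π hπ => ?_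
  refine ⟨π, fun F => (hπ _).trans (hσ F), ?_⟩
  -- The index `n = p` has residue `0 < a₀` modulo `p`; its torus character `u ^ p` is that of `∏
  -- X_i ^ b_i` in `W`.
  have hpmem : Λ (mn φ a₀ p) ∈ Qfil (toK ι) r (f - 1) := by
    rw [e1, hΛ.mem_fil]
    exact mn_mem_fnFil φ ha₁ hq' (by omega) (by rw [pow_one, Nat.mod_self]; exact ha₁)
  have hfil : ∀ F ∈ fnFil φ a₀ 2, Λ F ∈ Qfil (toK ι) r (f - 2) := fun F hF => by
    rw [e2, hΛ.mem_fil]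
    exact hF
  have hsum := sum_br_mem_Ffil (π := π) hp hf hr hr₁' ha₁ ha₂ hra hr₁ hr₀ hφ hΛ' hfil fun g =>
    (hπ _).trans (redMap_sum_eq_zero hσ hp hf hr hr' hr₁' ha₁ ha₂ hra ha hp0 hp' ha' hc' hac g)
  refine (exists_gradedMap π (Qfil (toK ι) r (f - 1)) (Qfil (toK ι) r (f - 2))).elim fun Φ hΦ => ?_
  exact ⟨Φ, hΦ.1, hΦ.2, fun e => exists_factor_heckeT hp hf hφ hsimple hpmem
    (fun x hx => hΛ.exists_eq_smul ha₁ hq' (Finset.mem_Icc.2 ⟨by omega, by omega⟩) _ _ hpmem hx)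
    hsum hΦ.1 e⟩
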